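/- **Setting.** Let $\Omega\subset\mathbb R^2$ be a polygonal domain with a finite conforming triangulation $\mathcal T_h$ (closed triangles), set of edges $\mathcal F_h$. Let $\Omega^1,\Omega^2$ be disjoint open sets, $\Gamma=\partial\Omega^1\cap\partial\Omega^2$, $\Omega\setminus\Gamma=\Omega^1\cup\Omega^2$, and assume that $T\cap\Gamma$ is empty or a segment (possibly a point) for every $T\in\mathcal T_h$. Put $\hat\Omega^i=\overline{\Omega^i}\setminus\Gamma$ (that is, $\Omega^i$ with its part of the outer boundary), and $$\mathcal T_h^i=\{T: T\cap\Omega^i\ne\emptyset\},\quad \Omega_h^i=\bigcup_{T\in\mathcal T_h^i}T,\quad \mathcal F_h^i=\{F: F\cap\hat\Omega^i\neq\emptyset\},\quad \mathcal F_h^\Gamma=\{F: F\cap\Gamma\ne\emptyset\};$$ $\mathcal F_g^i$ is the set of interior edges $F\in\mathcal F_h^i$ such that one of the two triangles sharing $F$ meets $\Gamma$; $\mathcal T_h^{c}=\mathcal T_h^1\cap\mathcal T_h^2$ is the set of cut triangles. Assume that an edge shared by two triangles of $\mathcal T_h^i$ always belongs to $\mathcal F_h^i$ ($i=1,2$). Let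 $h_T$, $h_F$ be the diameter of $T$ and the length of $F$. Each edge has a fixed unit normal $n_F$, outward to $\Omega$ on $\partial\Omega$, and equal to $n_\Gamma$ if $F\subset\Gamma$, where $n_\Gamma$ is the unit normal of $\Gamma$ oriented from $\Omega^1$ to $\Omega^2$. On an interior edge, $n_F$ points from $T_F^-$ to $T_F^+$, $[\![v]\!]=v^--v^+$ and $\langle v\rangle=\frac12(v^-+v^+)$; on a boundary edge $[\![v]\!]=\langle v\rangle=v$. Let $k_1,k_2,\gamma,\gamma_g>0$, $K=k_i$ on $\Omega^i$, $\omega_1=\frac{k_2}{k_1+k_2}$, $\omega_2=\frac{k_1}{k_1+k_2}$, $k_\Gamma=\frac{k_1k_2}{k_1+k_2}$, and on $\Gamma$ let $[v]=v^1-v^2$, $\{v\}=\omega_1v^1+\omega_2v^2$. Let $f\in L^2(\Omega)$. **Spaces.** $\mathcal D_h=\mathcal D_h^1\times\mathcal D_h^2$, where $\mathcal D_h^i$ consists of the functions on $\mathcal T_h^i$ that are affine on each triangle; $\mathcal C_h\subset\mathcal D_h$ is the set of pairs $v$ with $v^i\in H^1(\Omega_h^i)$ and $v^i=0$ on $\partial\Omega^i\setminus\Gamma$;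 $\mathcal M_h=\mathcal M_h^1\times\mathcal M_h^2$, where $\mathcal M_h^i$ consists of the functions $\mu$ that are affine on each edge of $\mathcal F_h^i$ and satisfy $\sum_{F\ni N}\mathfrak s_{F,N}h_F\,\mu|_F(N)=0$ for every mesh vertex $N$ interior to $\Omega_h^i$, with $\mathfrak s_{F,N}=\pm1$ according to whether $n_F$ points in the clockwise or counterclockwise sense around $N$. **Forms.** Let $\mathcal G_h$ be the set of the pieces of $\Gamma$: the segments $G=T\cap\Gamma$, $T\in\mathcal T_h^c$, with $h_G=h_T$, and the edges $G=F\subset\Gamma$, each taken once, with $h_G=h_F$. Traces on $T\cap\Gamma$ are taken from $T$; on an edge $F\subset\Gamma$, the trace of $v^i$ is taken from the triangle of $\mathcal T_h^i$ having $F$ as an edge. Define $$a_h(u,v)=\sum_{i=1}^2\Big(\sum_{T\in\mathcal T_h^i}\int_{T\cap\Omega^i}k_i\nabla u^i\cdot\nabla v^i\,dx+\sum_{F\in\mathcal F_g^i}\gamma_gh_F\int_Fk_i[\![\partial_nu^i]\!][\![\partial_nv^i]\!]\,ds\Big)+\sum_{G\in\mathcal G_h}\int_G\Big(\frac{\gamma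 k_\Gamma}{h_G}[u][v]-\{K\nabla u\cdot n_\Gamma\}[v]-\{K\nabla v\cdot n_\Gamma\}[u]\Big)ds,$$ $$d_h(u,v)=\sum_{i=1}^2\sum_{F\in\mathcal F_h^i}\int_{F\cap\hat\Omega^i}\big(\langle k_i\nabla u^i\cdot n_F\rangle[\![v^i]\!]+\langle k_i\nabla v^i\cdot n_F\rangle[\![u^i]\!]\big)ds,\qquad l_h(v)=\sum_{i=1}^2\int_{\Omega^i}fv^i\,dx,$$ $$b_F^i(\mu,w)=\frac{k_ih_F}2\sum_{N}\mu|_F(N)\,w(N)\ \ (N\text{ the two endpoints of }F),\qquad b_h(\mu,v)=\sum_{i=1}^2\sum_{F\in\mathcal F_h^i}b_F^i(\mu^i,[\![v^i]\!]).$$ **Flux.** Let $m\in\{0,1\}$ and let $(u_h,\theta_h)\in\mathcal D_h\times\mathcal M_h$ solve the mixed problem $$a_h(u_h,v)-d_h(u_h,v)+b_h(\theta_h,v)=l_h(v)\ \ \forall v\in\mathcal D_h,\qquad b_h(\mu,u_h)=0\ \ \forall\mu\in\mathcal M_h.$$ Consider the fields $\sigma_h$ in the global Raviart–Thomas space $\mathcal{RT}_h^m(\Omega)$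 (on each triangle in $P^m(T)^2+xP^m(T)$, with normal components continuous across the interior edges) such that, for all $F\in\mathcal F_h$ and $v\in P^m(F)$, $$\int_F\sigma_h\cdot n_F\,v\,ds=\begin{cases}\int_F\langle k_i\nabla u_h^i\cdot n_F\rangle v\,ds-b_F^i(\theta_h^i,v)&F\in\mathcal F_h^i\setminus\mathcal F_h^\Gamma,\\ \sum_{i=1}^2\big(\int_{F\cap\hat\Omega^i}\langle k_i\nabla u_h^i\cdot n_F\rangle v\,ds-b_F^i(\theta_h^i,v)\big)&F\in\mathcal F_h^\Gamma,\ F\not\subset\Gamma,\\ \int_F\{K\nabla u_h\cdot n_\Gamma\}v\,ds-\gamma k_\Gamma h_F^{-1}\int_F[u_h]v\,ds&F\subset\Gamma\end{cases}$$ (terms with an index $i$ such that $F\notin\mathcal F_h^i$ being zero) and, if $m=1$, for all $T\in\mathcal T_h$ and $\zeta\in\mathbb R^2$, $$\int_T\sigma_h\cdot\zeta\,dx=\sum_{i=1}^2\int_{T\cap\Omega^i}k_i\nabla u_h^i\cdot\zeta\,dx-\int_{T\cap\Gamma}\{K\zeta\cdot n_\Gamma\}[u_h]\,ds+\sum_{i=1}^2\sum_{F\in\mathcal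 F_g^i,\,F\subset\partial T}\gamma_gk_ih_F\int_F[\![\nabla u_h^i\cdot n_F]\!][\![\zeta\cdot n_F]\!]\,ds,$$ where in $\{K\zeta\cdot n_\Gamma\}$ and $[\![\zeta\cdot n_F]\!]$ the vector $\zeta$ on $T$ is extended by $0$ outside $T$. **Theorem (local conservation).** The function $u_h$ belongs to $\mathcal C_h$ and solves the CutFEM problem $a_h(u_h,v)=l_h(v)$ for all $v\in\mathcal C_h$; there is exactly one such flux $\sigma_h\in\mathcal{RT}^m_h(\Omega)$; and on every triangle $T\in\mathcal T_h$, cut or not, $$(\operatorname{div}\sigma_h)|_T=-\pi^m_Tf,$$ where $\pi^m_T$ is the $L^2(T)$-orthogonal projection onto $P^m(T)$. -/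

import Mathlib

open MeasureTheory Set
open scoped RealInnerProductSpace

noncomputable section

namespace CutFEM

/-- The Euclidean plane. -/
abbrev Plane := EuclideanSpace ℝ (Fin 2)

/-- Polynomial functions on the plane of total degree at most `m`. -/
def Poly (m : ℕ) : Submodule ℝ (Plane → ℝ) :=
  Submodule.span ℝ {p | ∃ a b : ℕ, a + b ≤ m ∧ p = fun x => x 0 ^ a * x 1 ^ b}

/-- The (constant) gradient of an affine function. -/
def grad (v : Plane →ᵃ[ℝ] ℝ) : Plane :=
  WithLp.toLp 2 fun j => v.linear (EuclideanSpace.single j 1)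

/-- The divergence of a vector field. -/
def divergence (τ : Plane → Plane) (x : Plane) : ℝ :=
  ∑ j : Fin 2, fderiv ℝ τ x (EuclideanSpace.single j 1) j

/-- The local Raviart-Thomas space `(P^m)² + x P^m`. -/
def LocalRT (m : ℕ) : Set (Plane → Plane) :=
  {τ | ∃ (a : Fin 2 → Plane → ℝ) (b : Plane → ℝ), (∀ j, a j ∈ Poly m) ∧ b ∈ Poly m ∧
    τ = fun x => WithLp.toLp 2 fun j => a j x + b x * x j}

/-- `q` is the `L²(S)`-orthogonal projection of `f` onto the polynomials of degree at most `m`. -/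
def IsL2Projection (m : ℕ) (S : Set Plane) (f q : Plane → ℝ) : Prop :=
  q ∈ Poly m ∧ ∀ p ∈ Poly m, ∫ x in S, (f x - q x) * p x = 0

/-- The closed simplex (edge or triangle) with a given vertex set. -/
def hull (s : Finset Plane) : Set Plane := convexHull ℝ (s : Set Plane)

/-- The diameter of a triangle, respectively the length of an edge. -/
def size (s : Finset Plane) : ℝ := Metric.diam (hull s)

/-- The integral over a part of a line, with respect to arc length. -/
def lineIntegral (S : Set Plane) (g : Plane → ℝ) : ℝ := ∫ x in S, g x ∂(μH[1])

/-- `n`, a normal of the edge `F`, points out of the triangle `T`, which has `F` as an edge. -/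
def PointsOut (n : Plane) (F T : Finset Plane) : Prop :=
  ∀ x ∈ F, ∀ y ∈ T, ⟪n, y - x⟫ ≤ 0

/-- A pair of families, indexed by the subdomain `i` and by a simplex (triangle or edge), of affine
functions.  An element of `P¹` of a simplex is given by an affine function on the plane. -/
abbrev Broken := Fin 2 → Finset Plane → (Plane →ᵃ[ℝ] ℝ)

/-- A finite conforming triangular mesh.  Triangles and edges are stored as their vertex sets. -/
structure Mesh where
  complex : Geometry.SimplicialComplex ℝ Plane
  finite : complex.faces.Finite
  /-- every vertex and every edge belongs to a triangle -/
  pure : ∀ s ∈ complex.faces, ∃ T ∈ complex.faces, s ⊆ T ∧ T.card = 3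

namespace Mesh

variable (M : Mesh)

/-- The set of triangles. -/
def tris : Finset (Finset Plane) := M.finite.toFinset.filter fun s => s.card = 3

/-- The set of edges. -/
def edges : Finset (Finset Plane) := M.finite.toFinset.filter fun s => s.card = 2

open Classical in
/-- The triangles (one or two) that share the edge `F`. -/
def trisAt (F : Finset Plane) : Finset (Finset Plane) := M.tris.filter fun T => F ⊆ T

open Classical in
/-- The edges of the triangle `T`. -/
def edgesOf (T : Finset Plane) : Finset (Finset Plane) := M.edges.filter fun F => F ⊆ T

open Classical in
/-- The edges that have `N` as an endpoint. -/
def edgesAt (N : Plane) : Finset (Finset Plane) := M.edges.filter fun F => N ∈ F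

/-- The closed polygon that is meshed. -/
def closedDomain : Set Plane := ⋃ T ∈ M.tris, hull T

/-- The polygonal domain. -/
def domain : Set Plane := interior M.closedDomain

end Mesh

/-- A triangular mesh of a polygonal domain `Ω`, together with a division of `Ω` into two
subdomains by an interface that cuts every triangle along a straight line, and with normals of the
edges and of the interface.  The subdomains `Ω¹, Ω²` have the indices `0, 1`. -/
structure CutMesh extends Mesh where
  /-- the subdomains -/
  Ω : Fin 2 → Set Plane
  isOpen_Ω : ∀ i, IsOpen (Ω i)
  disjoint_Ω : Disjoint (Ω 0) (Ω 1)
  /-- outside the interface `∂Ω¹ ∩ ∂Ω²`, the domain consists of the two subdomains -/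
  union_Ω : Ω 0 ∪ Ω 1 = toMesh.domain \ (frontier (Ω 0) ∩ frontier (Ω 1))
  /-- a triangle that meets the interface does so in a segment (which may be a point) -/
  straight : ∀ T ∈ toMesh.tris, (hull T ∩ (frontier (Ω 0) ∩ frontier (Ω 1))).Nonempty →
    ∃ a b, hull T ∩ (frontier (Ω 0) ∩ frontier (Ω 1)) = segment ℝ a b
  /-- the unit normals of the edges -/
  nF : Finset Plane → Plane
  norm_nF : ∀ F ∈ toMesh.edges, ‖nF F‖ = 1
  nF_orthogonal : ∀ F ∈ toMesh.edges, ∀ x ∈ F, ∀ y ∈ F, ⟪nF F, y - x⟫ = 0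
  /-- the normal of a boundary edge points out of the domain -/
  nF_boundary : ∀ F ∈ toMesh.edges, ∀ T, toMesh.trisAt F = {T} → PointsOut (nF F) F T
  /-- the normal of an edge contained in the interface is oriented from `Ω¹` to `Ω²` -/
  nF_interface : ∀ F ∈ toMesh.edges, hull F ⊆ frontier (Ω 0) ∩ frontier (Ω 1) →
    ∀ T ∈ toMesh.trisAt F, (PointsOut (nF F) F T ↔ (hull T ∩ Ω 0).Nonempty)
  /-- the unit normal of the interface in a triangle that meets both subdomains -/
  nΓ : Finset Plane → Plane
  norm_nΓ : ∀ T ∈ toMesh.tris, (∀ i, (hull T ∩ Ω i).Nonempty) → ‖nΓ T‖ = 1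
  nΓ_orthogonal : ∀ T ∈ toMesh.tris, (∀ i, (hull T ∩ Ω i).Nonempty) →
    ∀ x ∈ hull T ∩ (frontier (Ω 0) ∩ frontier (Ω 1)),
    ∀ y ∈ hull T ∩ (frontier (Ω 0) ∩ frontier (Ω 1)), ⟪nΓ T, y - x⟫ = 0
  /-- it is oriented from `Ω¹` to `Ω²` -/
  nΓ_oriented : ∀ T ∈ toMesh.tris, (∀ i, (hull T ∩ Ω i).Nonempty) →
    ∀ x ∈ hull T ∩ (frontier (Ω 0) ∩ frontier (Ω 1)),
    (∀ y ∈ hull T ∩ Ω 0, ⟪nΓ T, y - x⟫ ≤ 0) ∧ (∀ y ∈ hull T ∩ Ω 1, 0 ≤ ⟪nΓ T, y - x⟫)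

/-- The coefficients `k_i` and the stabilization parameters `γ`, `γ_g`. -/
structure Params where
  k : Fin 2 → ℝ
  k_pos : ∀ i, 0 < k i
  γ : ℝ
  γ_pos : 0 < γ
  γg : ℝ
  γg_pos : 0 < γg

namespace Params

variable (c : Params)

/-- The weights of the mean across the interface: `ω₁ = k₂ / (k₁ + k₂)`, `ω₂ = k₁ / (k₁ + k₂)`. -/
def ω (i : Fin 2) : ℝ := c.k i.rev / (c.k 0 + c.k 1)

/-- The harmonic mean `k₁ k₂ / (k₁ + k₂)`. -/
def kΓ : ℝ := c.k 0 * c.k 1 / (c.k 0 + c.k 1)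

end Params

namespace CutMesh

variable (M : CutMesh) (c : Params)

/-- The interface. -/
def Γ : Set Plane := frontier (M.Ω 0) ∩ frontier (M.Ω 1)

/-- The subdomain `Ω^i` together with its part of the outer boundary.  It differs from `Ω^i` only by
points of `∂Ω`; it serves to attribute the boundary edges to the subdomains. -/
def side (i : Fin 2) : Set Plane := closure (M.Ω i) \ M.Γ

open Classical in
/-- The triangles that meet `Ω^i`. -/
def trisI (i : Fin 2) : Finset (Finset Plane) := M.tris.filter fun T => (hull T ∩ M.Ω i).Nonempty

/-- The union of the triangles that meet `Ω^i`. -/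
def domainI (i : Fin 2) : Set Plane := ⋃ T ∈ M.trisI i, hull T

open Classical in
/-- The edges that meet `Ω^i` (for a boundary edge: its part of the outer boundary). -/
def edgesI (i : Fin 2) : Finset (Finset Plane) := M.edges.filter fun F => (hull F ∩ M.side i).Nonempty

open Classical in
/-- The triangles that are cut into two parts, one in each subdomain. -/
def cutTris : Finset (Finset Plane) := M.tris.filter fun T => ∀ i, (hull T ∩ M.Ω i).Nonempty

open Classical in
/-- The edges that meet the interface. -/
def edgesΓ : Finset (Finset Plane) := M.edges.filter fun F => (hull F ∩ M.Γ).Nonempty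

open Classical in
/-- The edges that are contained in the interface. -/
def fittedEdges : Finset (Finset Plane) := M.edges.filter fun F => hull F ⊆ M.Γ

open Classical in
/-- The edges carrying the ghost penalty: the interior edges meeting `Ω^i` one of whose two
triangles meets the interface. -/
def ghostEdges (i : Fin 2) : Finset (Finset Plane) :=
  (M.edgesI i).filter fun F =>
    (M.trisAt F).card = 2 ∧ ∃ T ∈ M.trisAt F, (hull T ∩ M.Γ).Nonempty

/-- Every edge shared by two triangles that meet `Ω^i` meets `Ω^i` itself. -/
def Resolved : Prop :=
  ∀ i, ∀ F ∈ M.edges, ∀ T ∈ M.trisI i, ∀ T' ∈ M.trisI i, T ≠ T' → F ⊆ T → F ⊆ T' → F ∈ M.edgesI i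

open Classical in
/-- `1` if `T` is the triangle `T_F^-`, out of which the normal of `F` points, and `-1` if `T` is
the triangle `T_F^+`. -/
def sgn (T F : Finset Plane) : ℝ := if PointsOut (M.nF F) F T then 1 else -1

/-- The jump `w^- - w^+` at `F` of a quantity with values `w T`; on a boundary edge the jump is the
value itself. -/
def jump (F : Finset Plane) (w : Finset Plane → ℝ) : ℝ := ∑ T ∈ M.trisAt F, M.sgn T F * w T

/-- The mean `(w^- + w^+) / 2` at `F` of a quantity with values `w T`; on a boundary edge the mean is
the value itself. -/
def mean (F : Finset Plane) (w : Finset Plane → ℝ) : ℝ :=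
  (∑ T ∈ M.trisAt F, w T) / ((M.trisAt F).card : ℝ)

open Classical in
/-- `1` or `-1`, according to whether the normal of the edge `F` with endpoint `N` points in the
clockwise or counterclockwise sense around `N`.  The vector `t` goes from `N` to the other
endpoint of `F`. -/
def nodeSgn (F : Finset Plane) (N : Plane) : ℝ :=
  let t : Plane := ∑ P ∈ F, (P - N)
  if 0 < ⟪M.nF F, (!₂[t 1, -t 0] : Plane)⟫ then 1 else -1

/-- The space `D_h` of discontinuous piecewise affine functions; `v^i` lives on the triangles that
meet `Ω^i`. -/
def D : Set Broken := {v | ∀ i, ∀ T, T ∉ M.trisI i → v i T = 0}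

/-- The space `C_h`: the pairs in `D_h` such that `v^i` is in `H¹` of the union of the triangles
that meet `Ω^i`, and vanishes on `∂Ω^i \ Γ`. -/
def C : Set Broken :=
  {v | v ∈ M.D ∧
    (∀ i, ∀ F ∈ M.edges, ∀ T ∈ M.trisI i, ∀ T' ∈ M.trisI i, F ⊆ T → F ⊆ T' →
      ∀ x ∈ hull F, v i T x = v i T' x) ∧
    (∀ i, ∀ F ∈ M.edges, ∀ T ∈ M.trisI i, M.trisAt F = {T} →
      ∀ x ∈ hull F ∩ (frontier (M.Ω i) \ M.Γ), v i T x = 0)}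

/-- The space `M_h` of multipliers; `μ^i` lives on the edges that meet `Ω^i`. -/
def Mult : Set Broken :=
  {μ | (∀ i, ∀ F, F ∉ M.edgesI i → μ i F = 0) ∧
    ∀ i, ∀ N ∈ M.complex.vertices, N ∈ interior (M.domainI i) →
      ∑ F ∈ M.edgesAt N, M.nodeSgn F N * size F * μ i F N = 0}

/-- The value at `x` of `v^i` on an edge contained in the interface. -/
def trace (v : Broken) (i : Fin 2) (F : Finset Plane) (x : Plane) : ℝ :=
  ∑ T ∈ M.trisAt F ∩ M.trisI i, v i T x

/-- The normal derivative of `v^i` on an edge contained in the interface. -/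
def traceNormal (v : Broken) (i : Fin 2) (F : Finset Plane) : ℝ :=
  ∑ T ∈ M.trisAt F ∩ M.trisI i, ⟪grad (v i T), M.nF F⟫

/-- The jump `v¹ - v²` across the interface in the triangle `T`. -/
def jumpΓ (v : Broken) (T : Finset Plane) (x : Plane) : ℝ := v 0 T x - v 1 T x

/-- The jump `v¹ - v²` across the interface at an edge `F` contained in it. -/
def jumpΓF (v : Broken) (F : Finset Plane) (x : Plane) : ℝ := M.trace v 0 F x - M.trace v 1 F x

/-- The weighted mean `{K ∇v · n_Γ}` in the triangle `T`. -/
def fluxΓ (v : Broken) (T : Finset Plane) : ℝ :=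
  ∑ i : Fin 2, c.ω i * (c.k i * ⟪grad (v i T), M.nΓ T⟫)

/-- The weighted mean `{K ∇v · n_Γ}` at an edge `F` contained in the interface. -/
def fluxΓF (v : Broken) (F : Finset Plane) : ℝ :=
  ∑ i : Fin 2, c.ω i * (c.k i * M.traceNormal v i F)

/-- The CutFEM bilinear form `a_h`.  The pieces of the interface are its intersections with the cut
triangles and the edges that it contains. -/
def a (u v : Broken) : ℝ :=
  (∑ i : Fin 2,
    (∑ T ∈ M.trisI i, ∫ _ in hull T ∩ M.Ω i, c.k i * ⟪grad (u i T), grad (v i T)⟫) +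
    ∑ i : Fin 2, ∑ F ∈ M.ghostEdges i, c.γg * size F * lineIntegral (hull F) fun _ =>
      c.k i * M.jump F (fun T => ⟪grad (u i T), M.nF F⟫) *
        M.jump F (fun T => ⟪grad (v i T), M.nF F⟫)) +
  (∑ T ∈ M.cutTris, lineIntegral (hull T ∩ M.Γ) fun x =>
    c.γ * c.kΓ / size T * jumpΓ u T x * jumpΓ v T x
      - M.fluxΓ c u T * jumpΓ v T x - M.fluxΓ c v T * jumpΓ u T x) +
  ∑ F ∈ M.fittedEdges, lineIntegral (hull F) fun x =>
    c.γ * c.kΓ / size F * M.jumpΓF u F x * M.jumpΓF v F x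
      - M.fluxΓF c u F * M.jumpΓF v F x - M.fluxΓF c v F * M.jumpΓF u F x

/-- The linear form `l_h`. -/
def l (f : Plane → ℝ) (v : Broken) : ℝ :=
  ∑ i : Fin 2, ∑ T ∈ M.trisI i, ∫ x in hull T ∩ M.Ω i, f x * v i T x

/-- The mean `⟨k_i ∇u^i · n_F⟩` on the edge `F`. -/
def meanFlux (u : Broken) (i : Fin 2) (F : Finset Plane) : ℝ :=
  M.mean F fun T => c.k i * ⟪grad (u i T), M.nF F⟫

/-- The bilinear form `d_h`. -/
def d (u v : Broken) : ℝ :=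
  ∑ i : Fin 2, ∑ F ∈ M.edgesI i, lineIntegral (hull F ∩ M.side i) fun x =>
    M.meanFlux c u i F * M.jump F (fun T => v i T x)
      + M.meanFlux c v i F * M.jump F (fun T => u i T x)

/-- The contribution `b_F^i` of the edge `F` to the form `b_h^i`, for a function `w` on `F`. -/
def bF (i : Fin 2) (F : Finset Plane) (μ : Broken) (w : Plane → ℝ) : ℝ :=
  c.k i * size F / 2 * ∑ N ∈ F, μ i F N * w N

/-- The bilinear form `b_h`. -/
def b (μ v : Broken) : ℝ :=
  ∑ i : Fin 2, ∑ F ∈ M.edgesI i, bF c i F μ fun x => M.jump F fun T => v i T x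

/-- `u` is a solution of the CutFEM discretization. -/
def SolvesPrimal (f : Plane → ℝ) (u : Broken) : Prop :=
  u ∈ M.C ∧ ∀ v ∈ M.C, M.a c u v = M.l f v

/-- `(u, θ)` is a solution of the auxiliary mixed formulation. -/
def SolvesMixed (f : Plane → ℝ) (u θ : Broken) : Prop :=
  u ∈ M.D ∧ θ ∈ M.Mult ∧
    (∀ v ∈ M.D, M.a c u v - M.d c u v + M.b c θ v = M.l f v) ∧
    ∀ μ ∈ M.Mult, M.b c μ u = 0

/-- The global Raviart-Thomas space: the piecewise Raviart-Thomas fields whose normal component is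
continuous across the interior edges.  A field is given by its restrictions to the triangles. -/
def RT (m : ℕ) : Set (Finset Plane → Plane → Plane) :=
  {σ | (∀ T ∈ M.tris, σ T ∈ LocalRT m) ∧ (∀ T, T ∉ M.tris → σ T = 0) ∧
    ∀ F ∈ M.edges, ∀ T ∈ M.trisAt F, ∀ T' ∈ M.trisAt F, ∀ x ∈ hull F,
      ⟪σ T x, M.nF F⟫ = ⟪σ T' x, M.nF F⟫}

/-- The edge degrees of freedom of the flux. -/
def EdgeDofs (m : ℕ) (u θ : Broken) (σ : Finset Plane → Plane → Plane) : Prop :=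
  ∀ F ∈ M.edges, ∀ T ∈ M.trisAt F, ∀ v ∈ Poly m,
    (∀ i, F ∈ M.edgesI i → F ∉ M.edgesΓ →
      lineIntegral (hull F) (fun x => ⟪σ T x, M.nF F⟫ * v x) =
        lineIntegral (hull F) (fun x => M.meanFlux c u i F * v x) - bF c i F θ v) ∧
    (F ∈ M.edgesΓ → F ∉ M.fittedEdges →
      lineIntegral (hull F) (fun x => ⟪σ T x, M.nF F⟫ * v x) =
        ∑ i : Fin 2, (lineIntegral (hull F ∩ M.side i) (fun x => M.meanFlux c u i F * v x)
          - bF c i F θ v)) ∧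
    (F ∈ M.fittedEdges →
      lineIntegral (hull F) (fun x => ⟪σ T x, M.nF F⟫ * v x) =
        lineIntegral (hull F) (fun x => M.fluxΓF c u F * v x)
          - c.γ * c.kΓ * (size F)⁻¹ * lineIntegral (hull F) (fun x => M.jumpΓF u F x * v x))

open Classical in
/-- The weighted mean `{K ζ · n}` across the interface, for a constant vector `ζ` on the triangle
`T`, extended by zero: only the subdomains that `T` meets contribute. -/
def meanΓ (T : Finset Plane) (ζ n : Plane) : ℝ :=
  ∑ i : Fin 2, if T ∈ M.trisI i then c.ω i * (c.k i * ⟪ζ, n⟫) else 0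

open Classical in
/-- The integral over `T ∩ Γ` of `{K ζ · n_Γ} [u]`.  If `T` is not cut into two parts, then only an
edge of `T` contained in the interface contributes. -/
def interfaceTerm (u : Broken) (T : Finset Plane) (ζ : Plane) : ℝ :=
  if T ∈ M.cutTris then
    lineIntegral (hull T ∩ M.Γ) fun x => M.meanΓ c T ζ (M.nΓ T) * jumpΓ u T x
  else
    ∑ F ∈ M.edgesOf T ∩ M.fittedEdges,
      lineIntegral (hull F) fun x => M.meanΓ c T ζ (M.nF F) * M.jumpΓF u F x

/-- The interior degrees of freedom of the flux (for `m = 1`).  In the jump of `ζ · n_F`, the vector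
`ζ` is extended by zero outside `T`. -/
def InteriorDofs (u : Broken) (σ : Finset Plane → Plane → Plane) : Prop :=
  ∀ T ∈ M.tris, ∀ ζ : Plane,
    ∫ x in hull T, ⟪σ T x, ζ⟫ =
      ∑ i : Fin 2, (∫ _ in hull T ∩ M.Ω i, c.k i * ⟪grad (u i T), ζ⟫)
        - M.interfaceTerm c u T ζ
        + ∑ i : Fin 2, ∑ F ∈ M.edgesOf T ∩ M.ghostEdges i,
            c.γg * c.k i * size F * lineIntegral (hull F) fun _ =>
              M.jump F (fun T' => ⟪grad (u i T'), M.nF F⟫) * (M.sgn T F * ⟪ζ, M.nF F⟫)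

/-- `σ` is the flux reconstructed from `u` and `θ`: the element of the global Raviart-Thomas space
with the prescribed degrees of freedom. -/
def IsFlux (m : ℕ) (u θ : Broken) (σ : Finset Plane → Plane → Plane) : Prop :=
  σ ∈ M.RT m ∧ M.EdgeDofs c m u θ σ ∧ (m = 1 → M.InteriorDofs c u σ)

end CutMesh

end CutFEM

end

noncomputable section

namespace CutFEM

/-! ### Integration along segments -/

/-! Functions in `D` satisfy no continuity condition between triangles, so the mixed equation may be
tested with the pair `testFn M T g` that equals one affine function g on a single triangle T (in
every subdomain that T meets) and vanishes elsewhere. Both components equal g on a cut triangle, so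
the interface jump of the test function vanishes there and the load is the integral of f g over the
whole of T. The form a_h becomes the prescribed interior moment of σ against ∇g, minus the signed
moments on the edges of T contained in Γ (`a_testFn`). The form d_h - b_h becomes the signed moments
on the other edges of T (`d_sub_b_testFn`). For this the symmetric half of d_h must drop out, which
it does because u has no jumps. With the Green formula `setIntegral_divergence_eq` the equation
turns into ∫_T div σ g = -∫_T f g for all g in P^m (`setIntegral_divergence_mul`). Since div σ is
itself in P^m, it is minus the projection of f. The degrees of freedom of the flux are designed for
exactly this cancellation.

Conformity of u comes from the multiplier μ = h_F⁻¹⟦u⟧. It satisfies the vertex constraint of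
`Mult`, because around a vertex each triangle contributes to two edges with opposite signs
(`sum_nodeSgn_mul_jump`). Then b_h(μ, u) = 0 is a sum of squares of the vertex jumps, so all of them
vanish (`jump_eq_zero_of_b`). On `C` the forms d_h(u, ·) and b_h(θ, ·) vanish, which leaves the
CutFEM equation.

Existence and uniqueness of the flux are unisolvence on each triangle. Edge moments determine the
normal traces, which determine the field at each vertex, where two independent normals meet. What
remains for m = 1 is the two-dimensional space of fields `bubble`, on which the mean is injective
because ∫ ⟪bubble β, β⟫ is the integral of a variance. Both triangles at an edge receive the same
normal trace, so the local fields fit together. -/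

theorem hausdorffMeasure_restrict_segment {P Q : Plane} (h : P ≠ Q) :
    (μH[1] : Measure Plane).restrict (segment ℝ P Q) =
      nndist P Q • Measure.map (AffineMap.lineMap P Q : ℝ → Plane)
        (volume.restrict (Icc (0 : ℝ) 1)) := by
  have hc : Continuous (AffineMap.lineMap P Q : ℝ → Plane) := AffineMap.lineMap_continuous
  have hi : Function.Injective (AffineMap.lineMap P Q : ℝ → Plane) :=
    AffineMap.lineMap_injective ℝ h
  ext S hS
  rw [Measure.restrict_apply hS, Measure.smul_apply, Measure.map_apply hc.measurable hS,
    Measure.restrict_apply (hc.measurable hS), segment_eq_image_lineMap, ← hausdorffMeasure_real,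
    ← hausdorffMeasure_lineMap_image, Set.image_preimage_inter]

theorem lineIntegral_segment {P Q : Plane} (h : P ≠ Q) (g : Plane → ℝ) :
    lineIntegral (segment ℝ P Q) g =
      dist P Q * ∫ t in (0 : ℝ)..1, g (AffineMap.lineMap P Q t) := by
  have hc : Continuous (AffineMap.lineMap P Q : ℝ → Plane) := AffineMap.lineMap_continuous
  have hi : Function.Injective (AffineMap.lineMap P Q : ℝ → Plane) :=
    AffineMap.lineMap_injective ℝ h
  have he : MeasurableEmbedding (AffineMap.lineMap P Q : ℝ → Plane) :=
    hc.measurableEmbedding hi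
  rw [lineIntegral, hausdorffMeasure_restrict_segment h, integral_smul_nnreal_measure,
    he.integral_map,
    intervalIntegral.integral_of_le zero_le_one, integral_Icc_eq_integral_Ioc]
  rfl

theorem integrableOn_segment {P Q : Plane} {g : Plane → ℝ} (hg : Continuous g) {S : Set Plane}
    (hS : S ⊆ segment ℝ P Q) : IntegrableOn g S μH[1] := by
  have hK : IsCompact (segment ℝ P Q) := by
    rw [segment_eq_image_lineMap]
    exact isCompact_Icc.image AffineMap.lineMap_continuous
  refine (hg.continuousOn.integrableOn_of_subset_isCompact hK hK.measurableSet subset_rfl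
    ?_).mono_set hS
  rw [hausdorffMeasure_segment]
  exact edist_ne_top P Q

theorem lineIntegral_add {P Q : Plane} {S : Set Plane} (hS : S ⊆ segment ℝ P Q)
    {g g' : Plane → ℝ} (hg : Continuous g) (hg' : Continuous g') :
    lineIntegral S (fun x => g x + g' x) = lineIntegral S g + lineIntegral S g' :=
  integral_add (integrableOn_segment hg hS) (integrableOn_segment hg' hS)

theorem lineIntegral_const_mul (S : Set Plane) (r : ℝ) (g : Plane → ℝ) :
    lineIntegral S (fun x => r * g x) = r * lineIntegral S g :=
  integral_const_mul _ _

/-- The `L²` product of two affine functions along a segment. -/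
theorem lineIntegral_affine_mul {P Q : Plane} (h : P ≠ Q) (g v : Plane →ᵃ[ℝ] ℝ) :
    lineIntegral (segment ℝ P Q) (fun x => g x * v x) =
      dist P Q / 6 * (2 * g P * v P + g P * v Q + g Q * v P + 2 * g Q * v Q) := by
  rw [lineIntegral_segment h]
  have (t : ℝ) : g (AffineMap.lineMap P Q t) * v (AffineMap.lineMap P Q t) =
      g P * v P + (g P * v Q + g Q * v P - 2 * (g P * v P)) * t +
        (g P * v P + g Q * v Q - g P * v Q - g Q * v P) * t ^ 2 := by
    rw [AffineMap.apply_lineMap, AffineMap.apply_lineMap, AffineMap.lineMap_apply_ring',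
      AffineMap.lineMap_apply_ring']
    ring
  simp_rw [this]
  rw [intervalIntegral.integral_add
    (Continuous.intervalIntegrable (by fun_prop) _ _)
    (Continuous.intervalIntegrable (by fun_prop) _ _),
    intervalIntegral.integral_add (Continuous.intervalIntegrable (by fun_prop) _ _)
    (Continuous.intervalIntegrable (by fun_prop) _ _),
    intervalIntegral.integral_const, intervalIntegral.integral_const_mul,
    intervalIntegral.integral_const_mul, integral_id, integral_pow]
  norm_num
  ring

theorem hull_pair (P Q : Plane) : hull {P, Q} = segment ℝ P Q := by
  classical
  rw [hull]; push_cast; exact convexHull_pair P Q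

theorem size_pair (P Q : Plane) : size {P, Q} = dist P Q := by
  classical
  rw [size, hull, convexHull_diam]; push_cast; exact Metric.diam_pair

/-! ### Integration over triangles -/

/-- The cross product of two vectors of the plane. -/
def cross (a b : Plane) : ℝ := a 0 * b 1 - a 1 * b 0

/-- The clockwise rotation by a right angle. -/
def rot (a : Plane) : Plane := !₂[a 1, -a 0]

theorem inner_eq (a b : Plane) : ⟪a, b⟫ = a 0 * b 0 + a 1 * b 1 := by
  simp [PiLp.inner_apply, Fin.sum_univ_two, mul_comm]

/-- The reference triangle. -/
def refTriangle : Set (ℝ × ℝ) := {p | 0 ≤ p.1 ∧ 0 ≤ p.2 ∧ p.1 + p.2 ≤ 1}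

theorem isClosed_refTriangle : IsClosed refTriangle := by
  have h0 : IsClosed {p : ℝ × ℝ | 0 ≤ p.1} := isClosed_le (by fun_prop) (by fun_prop)
  have h1 : IsClosed {p : ℝ × ℝ | 0 ≤ p.2} := isClosed_le (by fun_prop) (by fun_prop)
  have h2 : IsClosed {p : ℝ × ℝ | p.1 + p.2 ≤ 1} := isClosed_le (by fun_prop) (by fun_prop)
  exact h0.inter (h1.inter h2)

theorem isCompact_refTriangle : IsCompact refTriangle := by
  refine (isCompact_Icc (a := ((0, 0) : ℝ × ℝ)) (b := (1, 1))).of_isClosed_subset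
    isClosed_refTriangle fun p hp => ?_
  obtain ⟨h0, h1, h2⟩ := hp
  exact ⟨⟨h0, h1⟩, ⟨by simp; linarith, by simp; linarith⟩⟩

theorem setIntegral_refTriangle {G : ℝ × ℝ → ℝ} (hG : Continuous G) :
    ∫ p in refTriangle, G p = ∫ t in (0 : ℝ)..1, ∫ s in (0 : ℝ)..(1 - t), G (s, t) := by
  have hm := isClosed_refTriangle.measurableSet
  have hi : Integrable (refTriangle.indicator G) (volume.prod volume) :=
    (integrable_indicator_iff hm).2 (hG.continuousOn.integrableOn_compact isCompact_refTriangle)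
  rw [← integral_indicator hm, Measure.volume_eq_prod, integral_prod_symm _ hi,
    intervalIntegral.integral_of_le zero_le_one, ← integral_Icc_eq_integral_Ioc,
    ← integral_indicator measurableSet_Icc]
  congr 1
  ext t
  by_cases ht : t ∈ Icc (0 : ℝ) 1
  · rw [indicator_of_mem ht, intervalIntegral.integral_of_le (by linarith [ht.2]),
      ← integral_Icc_eq_integral_Ioc, ← integral_indicator measurableSet_Icc]
    congr 1
    ext s
    by_cases hs : s ∈ Icc (0 : ℝ) (1 - t)
    · rw [indicator_of_mem hs, indicator_of_mem]
      exact ⟨hs.1, ht.1, by simp; linarith [hs.2]⟩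
    · rw [indicator_of_notMem hs, indicator_of_notMem]
      exact fun h => hs ⟨h.1, by have := h.2.2; simp at this; linarith⟩
  · rw [indicator_of_notMem ht]
    refine integral_eq_zero_of_ae (Filter.Eventually.of_forall fun s => ?_)
    refine indicator_of_notMem (fun h => ht ⟨h.2.1, ?_⟩) _
    have h1 := h.1
    have h2 := h.2.2
    simp at h1 h2
    linarith

/-- The affine parametrization of a triangle. -/
def triMap (A B C : Plane) (p : ℝ × ℝ) : Plane := A + p.1 • (B - A) + p.2 • (C - A)

theorem continuous_triMap (A B C : Plane) : Continuous (triMap A B C) := by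
  unfold triMap; fun_prop

theorem hull_triple (A B C : Plane) : hull {A, B, C} = triMap A B C '' refTriangle := by
  classical
  rw [hull]
  push_cast
  ext x
  rw [convexHull_insert (by simp), convexHull_pair]
  simp only [mem_convexJoin, mem_singleton_iff, exists_eq_left, mem_image]
  constructor
  · rintro ⟨y, ⟨a, b, ha, hb, hab, rfl⟩, c, d, hc, hd, hcd, rfl⟩
    refine ⟨(d * a, d * b), ⟨by positivity, by positivity, ?_⟩, ?_⟩
    · simp only; nlinarith
    · obtain rfl : b = 1 - a := by linarith
      obtain rfl : c = 1 - d := by linarith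
      simp only [triMap]
      module
  · rintro ⟨⟨s, t⟩, ⟨hs, ht, hst⟩, rfl⟩
    simp only at hs ht hst
    by_cases h : s + t = 0
    · obtain rfl : s = 0 := by linarith
      obtain rfl : t = 0 := by linarith
      exact ⟨B, left_mem_segment ℝ B C, by simpa [triMap] using left_mem_segment ℝ A B⟩
    · have h' : 0 < s + t := lt_of_le_of_ne (by linarith) (Ne.symm h)
      refine ⟨(s / (s + t)) • B + (t / (s + t)) • C,
        ⟨s / (s + t), t / (s + t), by positivity, by positivity, by field_simp, rfl⟩,
        1 - (s + t), s + t, by linarith, h'.le, by ring, ?_⟩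
      rw [smul_add, smul_smul, smul_smul, mul_div_cancel₀ _ h, mul_div_cancel₀ _ h, triMap]
      module

/-- Affine change of variables from the reference triangle, with Jacobian determinant `cross (B - A)
(C - A)`. It is carried out in ℝ × ℝ and transported to the Euclidean plane by the measure
preserving map `w`. -/
theorem setIntegral_triangle {A B C : Plane} (h : cross (B - A) (C - A) ≠ 0) (g : Plane → ℝ) :
    ∫ x in hull {A, B, C}, g x =
      |cross (B - A) (C - A)| * ∫ p in refTriangle, g (triMap A B C p) := by
  let w : ℝ × ℝ ≃ᵐ Plane :=
    MeasurableEquiv.finTwoArrow.symm.trans (MeasurableEquiv.toLp 2 (Fin 2 → ℝ))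
  have hw : MeasurePreserving w :=
    (PiLp.volume_preserving_toLp (Fin 2)).comp (volume_preserving_finTwoArrow ℝ).symm
  let ℓ : ℝ × ℝ → ℝ × ℝ := fun p =>
    (A 0 + (p.1 * (B - A) 0 + p.2 * (C - A) 0), A 1 + (p.1 * (B - A) 1 + p.2 * (C - A) 1))
  have hwℓ (p : ℝ × ℝ) : w (ℓ p) = triMap A B C p := by
    ext j
    fin_cases j <;> simp [w, ℓ, triMap] <;> ring
  let L : (ℝ × ℝ) →L[ℝ] (ℝ × ℝ) := LinearMap.toContinuousLinearMap
    (Matrix.toLin (Module.Basis.finTwoProd ℝ) (Module.Basis.finTwoProd ℝ)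
      !![(B - A) 0, (C - A) 0; (B - A) 1, (C - A) 1])
  have hdet : L.det = cross (B - A) (C - A) := by
    simp only [L, LinearMap.det_toContinuousLinearMap, LinearMap.det_toLin,
      Matrix.det_fin_two_of, cross]
    ring
  have hL : ∀ p, HasFDerivAt ℓ L p := by
    intro p
    have h1 : ℓ = fun p => (A 0, A 1) + L p := by
      ext p <;> simp [ℓ, L, Matrix.toLin_finTwoProd_apply] <;> ring
    rw [h1]
    exact L.hasFDerivAt.const_add _
  have hinj : Function.Injective ℓ := by
    intro p q hpq
    simp only [ℓ, Prod.mk.injEq] at hpq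
    obtain ⟨h0, h1⟩ := hpq
    simp only [cross] at h
    generalize (B - A) 0 = b0 at *
    generalize (B - A) 1 = b1 at *
    generalize (C - A) 0 = c0 at *
    generalize (C - A) 1 = c1 at *
    ext
    · have : (p.1 - q.1) * (b0 * c1 - b1 * c0) = 0 := by linear_combination c1 * h0 - c0 * h1
      rcases mul_eq_zero.1 this with h' | h'
      · linarith
      · exact absurd h' h
    · have : (p.2 - q.2) * (b0 * c1 - b1 * c0) = 0 := by linear_combination b0 * h1 - b1 * h0
      rcases mul_eq_zero.1 this with h' | h'
      · linarith
      · exact absurd h' h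
  have hpre : w ⁻¹' (hull {A, B, C}) = ℓ '' refTriangle := by
    rw [hull_triple]
    ext q
    simp only [mem_preimage, mem_image, ← hwℓ]
    exact exists_congr fun p => and_congr_right fun _ => w.injective.eq_iff
  rw [← hw.setIntegral_preimage_emb w.measurableEmbedding, hpre,
    integral_image_eq_integral_abs_det_fderiv_smul volume isClosed_refTriangle.measurableSet
      (fun p _ => (hL p).hasFDerivWithinAt) hinj.injOn]
  simp only [hwℓ, hdet, smul_eq_mul]
  exact integral_const_mul _ _

/-! ### The Green formula on a triangle -/

/-- The mean of a function over a segment. -/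
def segMean (P Q : Plane) (g : Plane → ℝ) : ℝ := ∫ t in (0 : ℝ)..1, g (AffineMap.lineMap P Q t)

theorem segMean_comm (P Q : Plane) (g : Plane → ℝ) : segMean P Q g = segMean Q P g := by
  have := intervalIntegral.integral_comp_sub_left (a := 0) (b := 1)
    (fun t => g (AffineMap.lineMap P Q t)) 1
  simp only [sub_self, sub_zero] at this
  rw [segMean, ← this, segMean]
  simp_rw [AffineMap.lineMap_apply_one_sub]

theorem continuous_lineMap_comp {g : Plane → ℝ} (hg : Continuous g) (P Q : Plane) :
    Continuous fun t : ℝ => g (AffineMap.lineMap P Q t) :=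
  hg.comp AffineMap.lineMap_continuous

theorem segMean_sub (P Q : Plane) {g g' : Plane → ℝ} (hg : Continuous g) (hg' : Continuous g') :
    segMean P Q (fun x => g x - g' x) = segMean P Q g - segMean P Q g' :=
  intervalIntegral.integral_sub ((continuous_lineMap_comp hg P Q).intervalIntegrable _ _)
    ((continuous_lineMap_comp hg' P Q).intervalIntegrable _ _)

/-- In the coordinates (s, t) of `triMap`, differentiation along B - A is ∂/∂s. The fundamental
theorem of calculus in s leaves the values at s = 1 - t, on the side BC, and at s = 0, on the side
AC. -/
theorem setIntegral_fderiv_edge {A B C : Plane} (h : cross (B - A) (C - A) ≠ 0) {g : Plane → ℝ}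
    (hg : ContDiff ℝ 1 g) :
    ∫ x in hull {A, B, C}, fderiv ℝ g x (B - A) =
      |cross (B - A) (C - A)| * (segMean B C g - segMean A C g) := by
  have hd : Continuous fun x => fderiv ℝ g x (B - A) :=
    (hg.continuous_fderiv one_ne_zero).clm_apply continuous_const
  have hd' : Continuous fun p => fderiv ℝ g (triMap A B C p) (B - A) :=
    hd.comp (continuous_triMap A B C)
  rw [setIntegral_triangle h, setIntegral_refTriangle hd']
  congr 1
  rw [segMean, segMean, ← intervalIntegral.integral_sub
    ((continuous_lineMap_comp hg.continuous B C).intervalIntegrable _ _)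
    ((continuous_lineMap_comp hg.continuous A C).intervalIntegrable _ _)]
  congr 1
  ext t
  have hder (s : ℝ) : HasDerivAt (fun s => g (triMap A B C (s, t)))
      (fderiv ℝ g (triMap A B C (s, t)) (B - A)) s := by
    have h1 : HasDerivAt (fun s : ℝ => triMap A B C (s, t)) (B - A) s := by
      have := (((hasDerivAt_id s).smul_const (B - A)).const_add A).add_const (t • (C - A))
      simpa only [triMap, one_smul, id] using this
    exact ((hg.differentiable one_ne_zero _).hasFDerivAt).comp_hasDerivAt s h1
  rw [intervalIntegral.integral_eq_sub_of_hasDerivAt (fun s _ => hder s)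
    ((hd'.comp (Continuous.prodMk_left t)).intervalIntegrable _ _)]
  congr 2
  · simp only [triMap, AffineMap.lineMap_apply_module]
    module
  · simp only [triMap, AffineMap.lineMap_apply_module]
    module

theorem rot_sub (a b : Plane) : rot (a - b) = rot a - rot b := by
  ext j
  fin_cases j
  · simp [rot]
  · simp [rot]; ring

theorem cross_swap (a b : Plane) : cross a b = -cross b a := by
  simp only [cross]; ring

/-- The divergence is the trace of the derivative, written here in the oblique basis a, b. With a
and b the sides of a triangle, `setIntegral_fderiv_edge` applies to both terms. -/
theorem divergence_mul_cross {τ : Plane → Plane} (hτ : Differentiable ℝ τ) (a b x : Plane) :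
    divergence τ x * cross a b =
      fderiv ℝ (fun y => ⟪τ y, rot b⟫) x a - fderiv ℝ (fun y => ⟪τ y, rot a⟫) x b := by
  have hf (c d : Plane) : fderiv ℝ (fun y => ⟪τ y, c⟫) x d = ⟪fderiv ℝ τ x d, c⟫ := by
    rw [fderiv_inner_apply ℝ (hτ x) (differentiableAt_const c)]
    simp
  have hdec (d : Plane) :
      d = d 0 • EuclideanSpace.single 0 1 + d 1 • EuclideanSpace.single 1 1 := by
    ext j; fin_cases j <;> simp
  rw [hf, hf]
  conv_rhs => rw [hdec a, hdec b]
  simp only [map_add, map_smul, divergence, Fin.sum_univ_two, inner_eq]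
  simp [rot, cross]
  ring

/-- The divergence theorem on a triangle. -/
theorem setIntegral_divergence {A B C : Plane} (h : cross (B - A) (C - A) ≠ 0) {τ : Plane → Plane}
    (hτ : ContDiff ℝ 1 τ) :
    ∫ x in hull {A, B, C}, divergence τ x =
      cross (B - A) (C - A) / |cross (B - A) (C - A)| *
        (segMean B C (fun x => ⟪τ x, rot (C - B)⟫) + segMean C A (fun x => ⟪τ x, rot (A - C)⟫) +
          segMean A B (fun x => ⟪τ x, rot (B - A)⟫)) := by
  classical
  -- Exchanging B and C gives the integral of the derivative along C - A from the same lemma.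
  have hT : (({A, B, C} : Finset Plane)) = {A, C, B} := by
    ext; simp only [Finset.mem_insert, Finset.mem_singleton]; tauto
  have hc (v : Plane) : ContDiff ℝ 1 fun x => ⟪τ x, v⟫ := hτ.inner ℝ contDiff_const
  have h1 := setIntegral_fderiv_edge h (hc (rot (C - A)))
  have h2 := setIntegral_fderiv_edge (A := A) (B := C) (C := B)
    (by rw [cross_swap]; exact neg_ne_zero.2 h) (hc (rot (B - A)))
  rw [cross_swap, abs_neg, ← hT] at h2
  have hK : IsCompact (hull {A, B, C}) := by
    rw [hull_triple]; exact isCompact_refTriangle.image (continuous_triMap A B C)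
  have hi (v w : Plane) : IntegrableOn (fun x => fderiv ℝ (fun y => ⟪τ y, v⟫) x w)
      (hull {A, B, C}) :=
    (((hc v).continuous_fderiv one_ne_zero).clm_apply
      continuous_const).continuousOn.integrableOn_compact hK
  have h3 : (∫ x in hull {A, B, C}, divergence τ x) * cross (B - A) (C - A) =
      (∫ x in hull {A, B, C}, fderiv ℝ (fun y => ⟪τ y, rot (C - A)⟫) x (B - A)) -
      ∫ x in hull {A, B, C}, fderiv ℝ (fun y => ⟪τ y, rot (B - A)⟫) x (C - A) := by
    rw [← integral_sub (hi _ _) (hi _ _), ← integral_mul_const]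
    simp_rw [divergence_mul_cross (hτ.differentiable one_ne_zero)]
  rw [h1, h2, segMean_comm C B] at h3
  have h4 : segMean B C (fun x => ⟪τ x, rot (C - B)⟫) =
      segMean B C (fun x => ⟪τ x, rot (C - A)⟫) - segMean B C (fun x => ⟪τ x, rot (B - A)⟫) := by
    rw [← segMean_sub _ _ (hc _).continuous (hc _).continuous]
    simp_rw [← inner_sub_right, ← rot_sub, sub_sub_sub_cancel_right]
  have h5 : segMean C A (fun x => ⟪τ x, rot (A - C)⟫) =
      - segMean A C (fun x => ⟪τ x, rot (C - A)⟫) := by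
    rw [segMean_comm, segMean, segMean, ← intervalIntegral.integral_neg]
    simp_rw [← inner_neg_right]
    congr; ext t; congr 1
    ext j; fin_cases j <;> simp [rot]
  rw [h4, h5]
  have h6 : |cross (B - A) (C - A)| ≠ 0 := abs_ne_zero.2 h
  have h7 := abs_mul_abs_self (cross (B - A) (C - A))
  generalize cross (B - A) (C - A) = D at *
  rw [div_mul_eq_mul_div, eq_div_iff h6]
  apply mul_right_cancel₀ h
  linear_combination |D| * h3 + (segMean B C (fun x => ⟪τ x, rot (C - A)⟫) -
    segMean A C (fun x => ⟪τ x, rot (C - A)⟫) - (segMean B C (fun x => ⟪τ x, rot (B - A)⟫) -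
    segMean A B (fun x => ⟪τ x, rot (B - A)⟫))) * h7

/-- The unit normal of an edge, oriented outwards, is a rotated and scaled edge vector. -/
theorem outward_normal {P Q R n : Plane} (h : cross (Q - P) (R - P) ≠ 0) (hn : ‖n‖ = 1)
    (ho : ⟪n, Q - P⟫ = 0) (s : ℝ) (hs : s = if ⟪n, R - P⟫ ≤ 0 then 1 else -1) :
    (s * dist P Q) • n =
      (cross (Q - P) (R - P) / |cross (Q - P) (R - P)|) • rot (Q - P) := by
  have hL : dist P Q ^ 2 = (Q - P) 0 ^ 2 + (Q - P) 1 ^ 2 := by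
    rw [dist_comm, dist_eq_norm, ← real_inner_self_eq_norm_sq, inner_eq]; ring
  have hn' : n 0 ^ 2 + n 1 ^ 2 = 1 := by
    have := real_inner_self_eq_norm_sq n
    rw [inner_eq, hn] at this; linarith
  have hL0 : 0 ≤ dist P Q := dist_nonneg
  rw [inner_eq] at ho hs
  generalize dist P Q = L at *
  generalize hq : Q - P = q at *
  generalize hr : R - P = r at *
  -- A vector orthogonal to q is a multiple c of `rot q`, and unit length forces c = ±1/L. The sign
  -- of c is then compared with the orientation of the triangle.
  obtain ⟨c, h0, h1, hc⟩ : ∃ c, n 0 = c * q 1 ∧ n 1 = -(c * q 0) ∧ (c * L) ^ 2 = 1 := by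
    have hLpos : L ≠ 0 := by
      rintro rfl
      have h0 : q 0 = 0 := by nlinarith [sq_nonneg (q 0), sq_nonneg (q 1)]
      have h1 : q 1 = 0 := by nlinarith [sq_nonneg (q 0), sq_nonneg (q 1)]
      simp [cross, h0, h1] at h
    have hL2 : q 0 ^ 2 + q 1 ^ 2 ≠ 0 := by rw [← hL]; positivity
    refine ⟨(n 0 * q 1 - n 1 * q 0) / L ^ 2, ?_, ?_, ?_⟩
    · rw [hL]; field_simp; linear_combination (q 0) * ho
    · rw [hL]; field_simp; linear_combination (q 1) * ho
    · rw [hL, mul_pow, hL]; field_simp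
      linear_combination (q 0 ^ 2 + q 1 ^ 2) * hn' - (n 0 * q 0 + n 1 * q 1) * ho
  have hs' : s = if c * cross q r < 0 then -1 else 1 := by
    rw [hs, h0, h1]
    have : c * q 1 * r 0 + -(c * q 0) * r 1 = -(c * cross q r) := by simp only [cross]; ring
    rw [this]
    split_ifs <;> first | rfl | linarith
  have key : s * L * c = cross q r / |cross q r| := by
    rw [mul_assoc, mul_comm L c]
    have hcL : c * L = 1 ∨ c * L = -1 := mul_self_eq_one_iff.1 (by rw [← sq]; exact hc)
    rcases h.lt_or_gt with hD | hD <;> rcases hcL with hcL | hcL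
    · have hc0 : 0 < c := pos_of_mul_pos_left (by rw [hcL]; exact one_pos) hL0
      rw [abs_of_neg hD, div_neg, div_self h, hs', if_pos (mul_neg_of_pos_of_neg hc0 hD), hcL]
      ring
    · have hc0 : c < 0 := neg_of_mul_neg_left (by rw [hcL]; norm_num) hL0
      rw [abs_of_neg hD, div_neg, div_self h, hs', if_neg (mul_pos_of_neg_of_neg hc0 hD).not_gt,
        hcL]
      ring
    · have hc0 : 0 < c := pos_of_mul_pos_left (by rw [hcL]; exact one_pos) hL0
      rw [abs_of_pos hD, div_self h, hs', if_neg (mul_pos hc0 hD).not_gt, hcL]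
      ring
    · have hc0 : c < 0 := neg_of_mul_neg_left (by rw [hcL]; norm_num) hL0
      rw [abs_of_pos hD, div_self h, hs', if_pos (mul_neg_of_neg_of_pos hc0 hD), hcL]
      ring
  ext j
  fin_cases j
  · simp [rot, h0, ← key]; ring
  · simp [rot, h1, ← key]; ring

/-! ### Triangles and their edges -/

theorem exists_smul_of_cross_eq_zero {a b : Plane} (ha : a ≠ 0) (h : cross a b = 0) :
    ∃ r : ℝ, b = r • a := by
  have hn : a 0 ^ 2 + a 1 ^ 2 ≠ 0 := by
    intro h0
    apply ha
    ext j
    fin_cases j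
    · simpa using (by nlinarith [sq_nonneg (a 0), sq_nonneg (a 1)] : a 0 = 0)
    · simpa using (by nlinarith [sq_nonneg (a 0), sq_nonneg (a 1)] : a 1 = 0)
  refine ⟨(a 0 * b 0 + a 1 * b 1) / (a 0 ^ 2 + a 1 ^ 2), ?_⟩
  simp only [cross] at h
  ext j
  fin_cases j
  · simp; field_simp; linear_combination -(a 1) * h
  · simp; field_simp; linear_combination (a 0) * h

theorem cross_ne_zero_of_affineIndependent {A B C : Plane} {T : Finset Plane}
    (hT : AffineIndependent ℝ ((↑) : T → Plane)) (hc : T.card = 3) (h : T = {A, B, C}) :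
    cross (B - A) (C - A) ≠ 0 := by
  classical
  subst h
  have hAB : A ≠ B := by
    rintro rfl
    simp at hc
    have := Finset.card_le_two (a := A) (b := C)
    omega
  have hi : ¬ Collinear ℝ {A, B, C} := by
    intro h
    have h2 := hT.finrank_vectorSpan (n := 2) (by rw [Fintype.card_coe, hc])
    have hr : range ((↑) : ({A, B, C} : Finset Plane) → Plane) = {A, B, C} := by
      ext; simp
    rw [← hr] at h
    have := collinear_iff_finrank_le_one.1 h
    omega
  intro h0
  apply hi
  obtain ⟨r, hr⟩ := exists_smul_of_cross_eq_zero (sub_ne_zero.2 hAB.symm) h0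
  rw [collinear_iff_of_mem (p₀ := A) (by simp)]
  refine ⟨B - A, ?_⟩
  simp only [mem_insert_iff, mem_singleton_iff, vadd_eq_add, forall_eq_or_imp, forall_eq]
  exact ⟨⟨0, by simp⟩, ⟨1, by simp⟩, ⟨r, by rw [← hr]; simp⟩⟩

namespace Mesh

variable {M : Mesh} {F T T' : Finset Plane}

theorem mem_tris : T ∈ M.tris ↔ T ∈ M.complex.faces ∧ T.card = 3 := by simp [tris]

theorem mem_edges : F ∈ M.edges ↔ F ∈ M.complex.faces ∧ F.card = 2 := by simp [edges]

theorem mem_trisAt : T ∈ M.trisAt F ↔ T ∈ M.tris ∧ F ⊆ T := by simp [trisAt]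

theorem mem_edgesOf : F ∈ M.edgesOf T ↔ F ∈ M.edges ∧ F ⊆ T := by simp [edgesOf]

theorem hull_inter_subset (hF : F ∈ M.complex.faces) (hT : T ∈ M.complex.faces) {x : Plane}
    (h1 : x ∈ hull F) (h2 : x ∈ hull T) : x ∈ convexHull ℝ ((F : Set Plane) ∩ T) :=
  M.complex.inter_subset_convexHull hF hT ⟨h1, h2⟩

theorem cross_ne_zero {A B C : Plane} (hT : T ∈ M.tris) (h : T = {A, B, C}) :
    cross (B - A) (C - A) ≠ 0 :=
  cross_ne_zero_of_affineIndependent (M.complex.indep (mem_tris.1 hT).1) (mem_tris.1 hT).2 h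

theorem exists_pair (hF : F ∈ M.edges) : ∃ P Q, P ≠ Q ∧ F = {P, Q} := by
  obtain ⟨P, Q, h, hPQ⟩ := Finset.card_eq_two.1 (mem_edges.1 hF).2
  exact ⟨P, Q, h, by rw [hPQ]⟩

/-- The third vertex of a triangle. -/
theorem exists_third (hT : T ∈ M.tris) {P Q : Plane} (hPQ : P ≠ Q) (h : {P, Q} ⊆ T) :
    ∃ R, T = {P, Q, R} := by
  classical
  have h1 : (T \ {P, Q}).card = 1 := by
    rw [Finset.card_sdiff_of_subset h, (mem_tris.1 hT).2, Finset.card_pair hPQ]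
  obtain ⟨R, hR⟩ := Finset.card_eq_one.1 h1
  refine ⟨R, ?_⟩
  rw [← Finset.sdiff_union_of_subset h, hR]
  ext; simp; tauto

theorem isCompact_hull (s : Finset Plane) : IsCompact (hull s) :=
  s.finite_toSet.isCompact_convexHull ℝ

theorem isClosed_hull (s : Finset Plane) : IsClosed (hull s) := (isCompact_hull s).isClosed

theorem interior_hull_nonempty (hT : T ∈ M.tris) : (interior (hull T)).Nonempty := by
  rw [hull, interior_convexHull_nonempty_iff_affineSpan_eq_top]
  have h := (M.complex.indep (mem_tris.1 hT).1).affineSpan_eq_top_iff_card_eq_finrank_add_one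
  simp only [Subtype.range_coe_subtype, Finset.setOfPred_mem] at h
  rw [h, Fintype.card_coe, (mem_tris.1 hT).2, finrank_euclideanSpace, Fintype.card_fin]

theorem closure_interior_hull (hT : T ∈ M.tris) : closure (interior (hull T)) = hull T := by
  have hc : Convex ℝ (hull T) := convex_convexHull ℝ _
  rw [hc.closure_interior_eq_closure_of_nonempty_interior (interior_hull_nonempty hT),
    (isClosed_hull T).closure_eq]

theorem hull_subset_closedDomain (hT : T ∈ M.tris) : hull T ⊆ M.closedDomain :=
  subset_biUnion_of_mem (u := fun T => hull T) (Finset.mem_coe.2 hT)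

theorem interior_hull_subset_domain (hT : T ∈ M.tris) : interior (hull T) ⊆ M.domain :=
  interior_mono (hull_subset_closedDomain hT)

theorem closedDomain_subset_closure : M.closedDomain ⊆ closure M.domain := by
  refine iUnion₂_subset fun T hT => ?_
  rw [← closure_interior_hull hT]
  exact closure_mono (interior_hull_subset_domain hT)

theorem hull_mono {s t : Finset Plane} (h : s ⊆ t) : hull s ⊆ hull t :=
  convexHull_mono (Finset.coe_subset.2 h)

theorem exists_tri_of_edge (hF : F ∈ M.edges) : ∃ T ∈ M.tris, F ⊆ T := by
  obtain ⟨T, hT, hFT, hc⟩ := M.pure F (mem_edges.1 hF).1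
  exact ⟨T, mem_tris.2 ⟨hT, hc⟩, hFT⟩

theorem hull_edge_subset_closedDomain (hF : F ∈ M.edges) : hull F ⊆ M.closedDomain := by
  obtain ⟨T, hT, hFT⟩ := exists_tri_of_edge hF
  exact (hull_mono hFT).trans (hull_subset_closedDomain hT)

/-- A triangle that contains an inner point of an edge has this edge as one of its edges. -/
theorem subset_of_mem_openSegment {P Q x : Plane} (hPQ : P ≠ Q) (hF : {P, Q} ∈ M.edges)
    (hx : x ∈ openSegment ℝ P Q) (hT : T ∈ M.tris) (hxT : x ∈ hull T) : {P, Q} ⊆ T := by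
  classical
  have h := hull_inter_subset (mem_edges.1 hF).1 (mem_tris.1 hT).1
    (by rw [hull_pair]; exact openSegment_subset_segment ℝ P Q hx) hxT
  have hxP : x ≠ P := by rintro rfl; exact hPQ (left_mem_openSegment_iff.1 hx)
  have hxQ : x ≠ Q := by rintro rfl; exact hPQ (right_mem_openSegment_iff.1 hx)
  have hP : P ∈ T := by
    by_contra hP
    have : ((({P, Q} : Finset Plane) : Set Plane) ∩ T) ⊆ {Q} := by
      rintro y ⟨hy, hyT⟩
      simp only [Finset.coe_insert, Finset.coe_singleton, mem_insert_iff, mem_singleton_iff] at hy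
      rcases hy with rfl | rfl
      · exact absurd hyT hP
      · rfl
    have := convexHull_mono (𝕜 := ℝ) this h
    rw [convexHull_singleton] at this
    exact hxQ this
  have hQ : Q ∈ T := by
    by_contra hQ
    have : ((({P, Q} : Finset Plane) : Set Plane) ∩ T) ⊆ {P} := by
      rintro y ⟨hy, hyT⟩
      simp only [Finset.coe_insert, Finset.coe_singleton, mem_insert_iff, mem_singleton_iff] at hy
      rcases hy with rfl | rfl
      · rfl
      · exact absurd hyT hQ
    have := convexHull_mono (𝕜 := ℝ) this h
    rw [convexHull_singleton] at this
    exact hxP this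
  exact Finset.insert_subset hP (Finset.singleton_subset_iff.2 hQ)

/-- The number t is the barycentric coordinate of x at R. Thus the whole triangle lies on the same
side of the line PQ as R. -/
theorem exists_inner_eq_mul {P Q R n x : Plane} (hn : ⟪n, Q - P⟫ = 0)
    (hx : x ∈ hull {P, Q, R}) : ∃ t, 0 ≤ t ∧ ⟪n, x - P⟫ = t * ⟪n, R - P⟫ := by
  rw [hull_triple] at hx
  obtain ⟨⟨s, t⟩, ⟨hs, ht, hst⟩, rfl⟩ := hx
  refine ⟨t, ht, ?_⟩
  simp only [triMap, add_sub_cancel_left, add_assoc, inner_add_right, inner_smul_right, hn]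
  ring

/-- The two sides of an edge that contains an interior point of a union of triangles. -/
theorem exists_pair_of_mem_interior {P Q x n : Plane} (hPQ : P ≠ Q) (hF : {P, Q} ∈ M.edges)
    (hn : n ≠ 0) (ho : ⟪n, Q - P⟫ = 0)
    (hx : x ∈ openSegment ℝ P Q) {S : Finset (Finset Plane)} (hS : S ⊆ M.tris)
    (hxS : x ∈ interior (⋃ T ∈ S, hull T)) :
    ∃ T ∈ S, ∃ T' ∈ S, T ≠ T' ∧ {P, Q} ⊆ T ∧ {P, Q} ⊆ T' := by
  classical
  -- A neighbourhood of x that avoids the triangles not containing x: any triangle of S reached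
  -- within it contains x and hence has the edge PQ.
  have hU : interior (⋃ T ∈ S, hull T) ∩
      (⋂ T ∈ S.filter (fun T => x ∉ hull T), (hull T)ᶜ) ∈ nhds x := by
    refine Filter.inter_mem (isOpen_interior.mem_nhds hxS) ?_
    refine (Filter.biInter_finset_mem _).2 fun T hT => ?_
    exact (isClosed_hull T).isOpen_compl.mem_nhds (Finset.mem_filter.1 hT).2
  have key (m : Plane) : ∃ T ∈ S, {P, Q} ⊆ T ∧ ∃ ε : ℝ, 0 < ε ∧ x + ε • m ∈ hull T := by
    have hc : Filter.Tendsto (fun ε : ℝ => x + ε • m) (nhdsWithin 0 (Ioi 0)) (nhds x) := by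
      have : Continuous fun ε : ℝ => x + ε • m := by fun_prop
      simpa using (this.tendsto 0).mono_left nhdsWithin_le_nhds
    obtain ⟨ε, hε, hε'⟩ := ((hc.eventually_mem hU).and self_mem_nhdsWithin).exists
    obtain ⟨h1, h2⟩ := hε
    obtain ⟨T, hT, hεT⟩ := mem_iUnion₂.1 (interior_subset h1)
    refine ⟨T, hT, ?_, ε, hε', hεT⟩
    refine subset_of_mem_openSegment hPQ hF hx (hS hT) ?_
    by_contra hxT
    exact mem_iInter₂.1 h2 T (Finset.mem_filter.2 ⟨hT, hxT⟩) hεT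
  obtain ⟨T, hT, hFT, ε, hε, h⟩ := key n
  -- The edge is left in the two normal directions; a single triangle cannot contain points on both
  -- sides of its own edge.
  obtain ⟨T', hT', hFT', ε', hε', h'⟩ := key (-n)
  refine ⟨T, hT, T', hT', ?_, hFT, hFT'⟩
  rintro rfl
  obtain ⟨R, rfl⟩ := exists_third (hS hT) hPQ hFT
  obtain ⟨t, ht, h1⟩ := exists_inner_eq_mul ho h
  obtain ⟨t', ht', h2⟩ := exists_inner_eq_mul ho h'
  have hxP : ⟪n, x - P⟫ = 0 := by
    obtain ⟨a, b, ha, hb, hab, rfl⟩ := hx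
    obtain rfl : a = 1 - b := by linarith
    have : (1 - b) • P + b • Q - P = b • (Q - P) := by module
    rw [this, inner_smul_right, ho, mul_zero]
  have hnn : 0 < ⟪n, n⟫ := real_inner_self_pos.2 hn
  rw [add_sub_right_comm, inner_add_right, hxP, zero_add, inner_smul_right] at h1 h2
  rw [inner_neg_right] at h2
  have h3 : 0 < t * ⟪n, R - P⟫ := by rw [← h1]; positivity
  have h4 : t' * ⟪n, R - P⟫ < 0 := by rw [← h2]; nlinarith
  rcases le_total 0 ⟪n, R - P⟫ with h5 | h5 <;> nlinarith

/-- Otherwise n would be orthogonal to the two independent vectors Q - P and R - P. -/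
theorem inner_third_ne_zero {P Q R n : Plane} (hT : {P, Q, R} ∈ M.tris) (hn : n ≠ 0)
    (ho : ⟪n, Q - P⟫ = 0) : ⟪n, R - P⟫ ≠ 0 := by
  have h := cross_ne_zero hT rfl
  intro h0
  rw [inner_eq] at ho h0
  apply hn
  have e0 : n 0 * cross (Q - P) (R - P) = 0 := by
    simp only [cross]; linear_combination (R - P) 1 * ho - (Q - P) 1 * h0
  have e1 : n 1 * cross (Q - P) (R - P) = 0 := by
    simp only [cross]; linear_combination (Q - P) 0 * h0 - (R - P) 0 * ho
  ext j
  fin_cases j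
  · simpa [h] using e0
  · simpa [h] using e1

theorem mem_segment_of_inner_eq_zero {P Q R n x : Plane} (ho : ⟪n, Q - P⟫ = 0)
    (hR : ⟪n, R - P⟫ ≠ 0) (hx : x ∈ hull {P, Q, R}) (h : ⟪n, x - P⟫ = 0) : x ∈ segment ℝ P Q := by
  rw [hull_triple] at hx
  obtain ⟨⟨s, t⟩, ⟨hs, ht, hst⟩, rfl⟩ := hx
  simp only [triMap, add_sub_cancel_left, add_assoc, inner_add_right, inner_smul_right, ho,
    mul_zero, zero_add, mul_eq_zero, hR, or_false] at h
  subst h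
  refine ⟨1 - s, s, by simpa using hst, hs, by ring, ?_⟩
  simp only [triMap]
  module

/-- Two triangles that share an edge and lie on the same side of it coincide. -/
theorem eq_of_same_side {P Q R R' n : Plane} (hT : {P, Q, R} ∈ M.tris)
    (hT' : {P, Q, R'} ∈ M.tris) (hn : n ≠ 0) (ho : ⟪n, Q - P⟫ = 0)
    (h : 0 < ⟪n, R - P⟫ * ⟪n, R' - P⟫) :
    ({P, Q, R} : Finset Plane) = {P, Q, R'} := by
  classical
  have hD := cross_ne_zero hT rfl
  set D := cross (Q - P) (R - P) with hDdef
  -- By Cramer's rule, α and γ are the coordinates of R' - P in the basis Q - P, R - P; being on the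
  -- same side means γ > 0.
  set α := cross (R' - P) (R - P) / D with hα
  set γ := cross (Q - P) (R' - P) / D with hγ
  have hR' : R' - P = α • (Q - P) + γ • (R - P) := by
    ext j
    fin_cases j
    · simp only [hα, hγ]; simp; field_simp; simp [D, cross]; ring
    · simp only [hα, hγ]; simp; field_simp; simp [D, cross]; ring
  have hγpos : 0 < γ := by
    rw [hR', inner_add_right, inner_smul_right, inner_smul_right, ho] at h
    by_contra hγ0
    nlinarith [mul_self_nonneg ⟪n, R - P⟫]
  by_contra hne
  -- The midpoint of PQ is pushed towards R' by an amount ε so small that the point stays in the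
  -- triangle PQR as well. Conformity would put it in the hull of the common vertices, hence on PQ
  -- if the triangles differed, but its normal component is not zero.
  set ε : ℝ := 1 / (2 * (1 + |α| + γ)) with hε
  have hαabs := abs_nonneg α
  have hεpos : 0 < ε := by positivity
  have hε1 : ε * (2 * (1 + |α| + γ)) = 1 := by rw [hε]; field_simp
  have hx1 : triMap P Q R' ((1 - ε) / 2, ε) ∈ hull {P, Q, R'} := by
    rw [hull_triple]
    refine mem_image_of_mem _ ⟨?_, hεpos.le, ?_⟩ <;> simp only <;> nlinarith
  have hxe : triMap P Q R' ((1 - ε) / 2, ε) = triMap P Q R ((1 - ε) / 2 + ε * α, ε * γ) := by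
    simp only [triMap, hR']; module
  have hx2 : triMap P Q R' ((1 - ε) / 2, ε) ∈ hull {P, Q, R} := by
    rw [hxe, hull_triple]
    have h1 := neg_abs_le α
    have h2 := le_abs_self α
    refine mem_image_of_mem _ ⟨?_, by positivity, ?_⟩ <;> simp only <;> nlinarith
  have hx := hull_inter_subset (mem_tris.1 hT).1 (mem_tris.1 hT').1 hx2 hx1
  have hsub : ((({P, Q, R} : Finset Plane) : Set Plane) ∩ ({P, Q, R'} : Finset Plane)) ⊆
      {P, Q} := by
    rintro y ⟨h1, h2⟩
    simp only [Finset.coe_insert, Finset.coe_singleton, mem_insert_iff,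
      mem_singleton_iff] at h1 h2 ⊢
    rcases h1 with h1 | h1 | rfl
    · exact Or.inl h1
    · exact Or.inr h1
    · rcases h2 with h2 | h2 | rfl
      · exact Or.inl h2
      · exact Or.inr h2
      · exact absurd rfl hne
  have hx3 := convexHull_mono (𝕜 := ℝ) hsub hx
  rw [convexHull_pair, hxe] at hx3
  obtain ⟨a, b, ha, hb, hab, hx3⟩ := hx3
  have hx4 : triMap P Q R ((1 - ε) / 2 + ε * α, ε * γ) - P = b • (Q - P) := by
    rw [← hx3]; obtain rfl : a = 1 - b := by linarith
    module
  have hRn := inner_third_ne_zero hT hn ho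
  have hx5 := congrArg (fun y => ⟪n, y⟫) hx4
  simp only [triMap, add_sub_cancel_left, add_assoc, inner_add_right, inner_smul_right, ho,
    mul_zero, zero_add] at hx5
  have : ε * γ ≠ 0 := by positivity
  exact (mul_ne_zero this hRn) hx5

end Mesh

namespace CutMesh

open Mesh

variable {M : CutMesh} {F T T' : Finset Plane} {i j : Fin 2}

/-! ### Signs and jumps -/

theorem nF_ne_zero (hF : F ∈ M.edges) : M.nF F ≠ 0 := by
  have := M.norm_nF F hF
  intro h
  simp [h] at this

theorem inner_nF {P Q : Plane} (hF : {P, Q} ∈ M.edges) : ⟪M.nF {P, Q}, Q - P⟫ = 0 :=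
  M.nF_orthogonal _ hF P (by simp) Q (by simp)

theorem sgn_eq {P Q R : Plane} (hF : {P, Q} ∈ M.edges) :
    M.sgn {P, Q, R} {P, Q} = if ⟪M.nF {P, Q}, R - P⟫ ≤ 0 then 1 else -1 := by
  have h : PointsOut (M.nF {P, Q}) {P, Q} {P, Q, R} ↔ ⟪M.nF {P, Q}, R - P⟫ ≤ 0 := by
    have ho := inner_nF hF
    refine ⟨fun h => h P (by simp) R (by simp), fun h x hx y hy => ?_⟩
    have h1 : ⟪M.nF {P, Q}, x - P⟫ = 0 := by
      rcases Finset.mem_insert.1 hx with rfl | hx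
      · simp
      · rw [Finset.mem_singleton.1 hx, ho]
    have h2 : ⟪M.nF {P, Q}, y - P⟫ ≤ 0 := by
      rcases Finset.mem_insert.1 hy with rfl | hy
      · simp
      · rcases Finset.mem_insert.1 hy with rfl | hy
        · rw [ho]
        · rw [Finset.mem_singleton.1 hy]; exact h
    have h3 : y - x = (y - P) - (x - P) := by abel
    rw [h3, inner_sub_right, h1, sub_zero]
    exact h2
  simp only [sgn, h]

theorem sgn_mul_self (T F : Finset Plane) : M.sgn T F * M.sgn T F = 1 := by
  unfold sgn; split_ifs <;> norm_num

theorem sgn_ne_zero (T F : Finset Plane) : M.sgn T F ≠ 0 := by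
  unfold sgn; split_ifs <;> norm_num

/-- Distinct triangles at an edge lie on opposite sides of it, by `eq_of_same_side`. -/
theorem sgn_eq_neg (hF : F ∈ M.edges) (hT : T ∈ M.trisAt F) (hT' : T' ∈ M.trisAt F) (h : T ≠ T') :
    M.sgn T' F = -M.sgn T F := by
  obtain ⟨P, Q, hPQ, rfl⟩ := exists_pair hF
  obtain ⟨hT, hFT⟩ := mem_trisAt.1 hT
  obtain ⟨hT', hFT'⟩ := mem_trisAt.1 hT'
  obtain ⟨R, rfl⟩ := exists_third hT hPQ hFT
  obtain ⟨R', rfl⟩ := exists_third hT' hPQ hFT'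
  have hn := nF_ne_zero hF
  have ho := inner_nF hF
  have h1 := inner_third_ne_zero hT hn ho
  have h2 := inner_third_ne_zero hT' hn ho
  have h3 : ¬ 0 < ⟪M.nF {P, Q}, R - P⟫ * ⟪M.nF {P, Q}, R' - P⟫ :=
    fun h' => h (eq_of_same_side hT hT' hn ho h')
  rw [sgn_eq hF, sgn_eq hF]
  rcases h1.lt_or_gt with h1 | h1 <;> rcases h2.lt_or_gt with h2 | h2
  · exact absurd (mul_pos_of_neg_of_neg h1 h2) h3
  · rw [if_pos h1.le, if_neg h2.not_ge]
  · rw [if_neg h1.not_ge, if_pos h2.le]; norm_num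
  · exact absurd (mul_pos h1 h2) h3

theorem trisAt_eq_pair [DecidableEq (Finset Plane)] (hF : F ∈ M.edges) (hT : T ∈ M.trisAt F)
    (hT' : T' ∈ M.trisAt F) (h : T ≠ T') : M.trisAt F = {T, T'} := by
  refine Finset.Subset.antisymm (fun T'' hT'' => ?_) ?_
  -- Three distinct triangles at F would have pairwise opposite signs, which is impossible for
  -- nonzero numbers.
  · by_contra hn
    simp only [Finset.mem_insert, Finset.mem_singleton, not_or] at hn
    have h1 := sgn_eq_neg hF hT hT' h
    have h2 := sgn_eq_neg hF hT hT'' (Ne.symm hn.1)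
    have h3 := sgn_eq_neg hF hT' hT'' (Ne.symm hn.2)
    have := sgn_ne_zero (M := M) T F
    apply this
    linarith
  · exact Finset.insert_subset hT (Finset.singleton_subset_iff.2 hT')

theorem jump_eq_of_ne (hF : F ∈ M.edges) (hT : T ∈ M.trisAt F)
    (hT' : T' ∈ M.trisAt F) (h : T ≠ T') (w : Finset Plane → ℝ) :
    M.jump F w = M.sgn T F * (w T - w T') := by
  classical
  rw [jump, trisAt_eq_pair hF hT hT' h, Finset.sum_pair h, sgn_eq_neg hF hT hT' h]
  ring

/-! ### The two sides of the interface -/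

theorem isClosed_Γ : IsClosed M.Γ := isClosed_frontier.inter isClosed_frontier

theorem Ω_union : M.Ω 0 ∪ M.Ω 1 = M.domain \ M.Γ := M.union_Ω

theorem Ω_subset (i : Fin 2) : M.Ω i ⊆ M.domain \ M.Γ := by
  rw [← Ω_union]
  fin_cases i
  · exact subset_union_left
  · exact subset_union_right

theorem mem_Ω_of_domain {x : Plane} (hx : x ∈ M.domain) (h : x ∉ M.Γ) : ∃ i, x ∈ M.Ω i := by
  have : x ∈ M.Ω 0 ∪ M.Ω 1 := by rw [Ω_union]; exact ⟨hx, h⟩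
  rcases this with h | h
  exacts [⟨0, h⟩, ⟨1, h⟩]

theorem Ω_subset_side (i : Fin 2) : M.Ω i ⊆ M.side i :=
  fun _ hx => ⟨subset_closure hx, (Ω_subset i hx).2⟩

theorem disjoint_Ω_of_ne (h : i ≠ j) : Disjoint (M.Ω i) (M.Ω j) := by
  fin_cases i <;> fin_cases j
  · exact absurd rfl h
  · exact M.disjoint_Ω
  · exact M.disjoint_Ω.symm
  · exact absurd rfl h

/-- An open set disjoint from another one is disjoint from its closure too, so a common point of the
closures lies in neither set and hence in both frontiers. -/
theorem mem_Γ_of_closure {x : Plane} (hij : i ≠ j) (hi : x ∈ closure (M.Ω i))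
    (hj : x ∈ closure (M.Ω j)) : x ∈ M.Γ := by
  have h {i j : Fin 2} (hij : i ≠ j) (hi : x ∈ closure (M.Ω i)) (hj : x ∈ closure (M.Ω j)) :
      x ∈ frontier (M.Ω i) := by
    refine ⟨hi, fun hx => ?_⟩
    rw [(M.isOpen_Ω i).interior_eq] at hx
    exact ((disjoint_Ω_of_ne hij).closure_right (M.isOpen_Ω i)).notMem_of_mem_left hx hj
  have h1 := h hij hi hj
  have h2 := h hij.symm hj hi
  fin_cases i <;> fin_cases j
  · exact absurd rfl hij
  · exact ⟨h1, h2⟩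
  · exact ⟨h2, h1⟩
  · exact absurd rfl hij

theorem disjoint_side (hij : i ≠ j) : Disjoint (M.side i) (M.side j) :=
  Set.disjoint_left.2 fun _ hi hj => hi.2 (mem_Γ_of_closure hij hi.1 hj.1)

/-- The open domain is dense in the closed polygon and Γ is closed, so x is a limit of points of Ω¹
∪ Ω². This covers points of the outer boundary. -/
theorem exists_mem_side {x : Plane} (hx : x ∈ M.closedDomain) (h : x ∉ M.Γ) :
    ∃ i, x ∈ M.side i := by
  have h1 : x ∈ closure (M.Ω 0 ∪ M.Ω 1) := by
    rw [Ω_union, mem_closure_iff_frequently]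
    have h2 : ∀ᶠ y in nhds x, y ∉ M.Γ := isClosed_Γ.isOpen_compl.mem_nhds h
    exact (mem_closure_iff_frequently.1 (closedDomain_subset_closure hx)).and_eventually h2
  rw [closure_union] at h1
  rcases h1 with h1 | h1
  exacts [⟨0, h1, h⟩, ⟨1, h1, h⟩]

/-- Near a point of a side, the polygon consists of points of the same side. -/
theorem eventually_mem_side {x : Plane} (hx : x ∈ M.side i) :
    ∀ᶠ y in nhds x, y ∈ M.closedDomain → y ∈ M.side i := by
  have h1 : ∀ᶠ y in nhds x, y ∉ M.Γ := isClosed_Γ.isOpen_compl.mem_nhds hx.2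
  have h2 : ∀ᶠ y in nhds x, y ∉ closure (M.Ω i.rev) :=
    isClosed_closure.isOpen_compl.mem_nhds fun h =>
      hx.2 (mem_Γ_of_closure (by fin_cases i <;> decide) hx.1 h)
  filter_upwards [h1, h2] with y hy1 hy2 hyd
  obtain ⟨j, hj⟩ := exists_mem_side hyd hy1
  by_cases hij : j = i
  · rwa [hij] at hj
  · have : j = i.rev := by fin_cases i <;> fin_cases j <;> simp_all
    exact absurd (this ▸ hj.1) hy2

theorem mem_Ω_of_side {x : Plane} (hx : x ∈ M.side i) (h : x ∈ M.domain) : x ∈ M.Ω i := by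
  obtain ⟨j, hj⟩ := mem_Ω_of_domain h hx.2
  by_cases hij : j = i
  · rwa [hij] at hj
  · exact absurd hx ((disjoint_side hij).notMem_of_mem_left (Ω_subset_side j hj))

theorem mem_trisI : T ∈ M.trisI i ↔ T ∈ M.tris ∧ (hull T ∩ M.Ω i).Nonempty := by simp [trisI]

theorem mem_edgesI : F ∈ M.edgesI i ↔ F ∈ M.edges ∧ (hull F ∩ M.side i).Nonempty := by
  simp [edgesI]

theorem mem_fittedEdges : F ∈ M.fittedEdges ↔ F ∈ M.edges ∧ hull F ⊆ M.Γ := by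
  simp [fittedEdges]

theorem mem_edgesΓ : F ∈ M.edgesΓ ↔ F ∈ M.edges ∧ (hull F ∩ M.Γ).Nonempty := by
  simp [edgesΓ]

theorem mem_cutTris : T ∈ M.cutTris ↔ T ∈ M.tris ∧ ∀ i, T ∈ M.trisI i := by
  simp only [cutTris, mem_trisI, Finset.mem_filter]
  exact ⟨fun h => ⟨h.1, fun i => ⟨h.1, h.2 i⟩⟩, fun h => ⟨h.1, fun i => (h.2 i).2⟩⟩

/-- A triangle that contains a point of a side meets the corresponding subdomain. -/
theorem mem_trisI_of_side {x : Plane} (hx : x ∈ M.side i) (hT : T ∈ M.tris) (hxT : x ∈ hull T) :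
    T ∈ M.trisI i := by
  rw [← closure_interior_hull hT] at hxT
  obtain ⟨y, hy, hyT⟩ := ((mem_closure_iff_frequently.1 hxT).and_eventually
    (eventually_mem_side hx)).exists
  have hyd := interior_hull_subset_domain hT hy
  exact mem_trisI.2 ⟨hT, y, interior_subset hy, mem_Ω_of_side (hyT (interior_subset hyd)) hyd⟩

theorem trisAt_subset_trisI (hF : F ∈ M.edgesI i) : M.trisAt F ⊆ M.trisI i := by
  intro T hT
  obtain ⟨hF, x, hxF, hx⟩ := mem_edgesI.1 hF
  obtain ⟨hT, hFT⟩ := mem_trisAt.1 hT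
  exact mem_trisI_of_side hx hT (hull_mono hFT hxF)

/-- A connected part of the polygon that does not meet the interface lies on one side of it. -/
theorem subset_side_of_isPreconnected {S : Set Plane} (hS : IsPreconnected S)
    (hd : S ⊆ M.closedDomain) (hΓ : ∀ x ∈ S, x ∉ M.Γ) : ∃ i, S ⊆ M.side i := by
  have h := isPreconnected_iff_subset_of_disjoint_closed.1 hS (closure (M.Ω 0)) (closure (M.Ω 1))
    isClosed_closure isClosed_closure (fun x hx => ?_) ?_
  · rcases h with h | h
    · exact ⟨0, fun x hx => ⟨h hx, hΓ x hx⟩⟩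
    · exact ⟨1, fun x hx => ⟨h hx, hΓ x hx⟩⟩
  · obtain ⟨i, hi⟩ := exists_mem_side (hd hx) (hΓ x hx)
    fin_cases i
    exacts [Or.inl hi.1, Or.inr hi.1]
  · rw [Set.eq_empty_iff_forall_notMem]
    rintro x ⟨hx, h0, h1⟩
    exact hΓ x hx (mem_Γ_of_closure (by decide) h0 h1)

/-- An edge is connected, so away from Γ it belongs to exactly one subdomain. Hence just one index
is active in the first case of `EdgeDofs`. -/
theorem exists_hull_subset_side (hF : F ∈ M.edges) (h : F ∉ M.edgesΓ) :
    ∃ i, hull F ⊆ M.side i ∧ F ∈ M.edgesI i ∧ ∀ j, j ≠ i → hull F ∩ M.side j = ∅ := by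
  obtain ⟨i, hi⟩ := subset_side_of_isPreconnected (M := M)
    (convex_convexHull ℝ (F : Set Plane)).isPreconnected (hull_edge_subset_closedDomain hF)
    fun x hx hxΓ => h (mem_edgesΓ.2 ⟨hF, x, hx, hxΓ⟩)
  refine ⟨i, hi, mem_edgesI.2 ⟨hF, ?_⟩, fun j hj => ?_⟩
  · obtain ⟨P, Q, -, rfl⟩ := exists_pair hF
    have hP : P ∈ hull {P, Q} := by rw [hull_pair]; exact left_mem_segment ℝ P Q
    exact ⟨P, hP, hi hP⟩
  · exact Set.eq_empty_of_forall_notMem fun x hx =>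
      (disjoint_side hj).notMem_of_mem_left hx.2 (hi hx.1)

theorem notMem_edgesI_of_fitted (hF : F ∈ M.fittedEdges) (i : Fin 2) : F ∉ M.edgesI i := by
  rintro h
  obtain ⟨-, x, hx, hxs⟩ := mem_edgesI.1 h
  exact hxs.2 ((mem_fittedEdges.1 hF).2 hx)

/-- Otherwise the interior of the triangle would lie in the frontier of an open set, and such a
frontier has empty interior. -/
theorem exists_mem_trisI (hT : T ∈ M.tris) : ∃ i, T ∈ M.trisI i := by
  by_contra! h
  have h1 : interior (hull T) ⊆ frontier (M.Ω 0) := fun x hx => by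
    by_contra hx'
    obtain ⟨i, hi⟩ := mem_Ω_of_domain (interior_hull_subset_domain hT hx) fun h => hx' h.1
    exact h i (mem_trisI.2 ⟨hT, x, interior_subset hx, hi⟩)
  have h2 := interior_maximal h1 isOpen_interior
  rw [← frontier_compl, interior_frontier (M.isOpen_Ω 0).isClosed_compl] at h2
  exact (interior_hull_nonempty hT).ne_empty (subset_empty_iff.1 h2)

/-- A triangle with an edge in the interface is not cut. -/
theorem eq_of_mem_trisI_of_fitted (hF : F ∈ M.fittedEdges) (hFT : F ⊆ T) (hi : T ∈ M.trisI i)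
    (hj : T ∈ M.trisI j) : i = j := by
  obtain ⟨hF, hFΓ⟩ := mem_fittedEdges.1 hF
  obtain ⟨P, Q, hPQ, rfl⟩ := exists_pair hF
  obtain ⟨hT, y, hyT, hy⟩ := mem_trisI.1 hi
  obtain ⟨-, z, hzT, hz⟩ := mem_trisI.1 hj
  obtain ⟨R, rfl⟩ := exists_third hT hPQ hFT
  have ho := inner_nF hF
  have hR := inner_third_ne_zero hT (nF_ne_zero hF) ho
  set n := M.nF {P, Q} with hn
  have hPΓ : P ∈ M.Γ := hFΓ (by rw [hull_pair]; exact left_mem_segment ℝ P Q)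
  have hQΓ : Q ∈ M.Γ := hFΓ (by rw [hull_pair]; exact right_mem_segment ℝ P Q)
  have hPT : P ∈ hull {P, Q, R} := subset_convexHull ℝ _ (by simp)
  have hQT : Q ∈ hull {P, Q, R} := subset_convexHull ℝ _ (by simp)
  obtain ⟨a, b, hab⟩ := M.straight _ hT ⟨P, hPT, hPΓ⟩
  -- T ∩ Γ is a segment that contains P and Q, so it lies on the line PQ.
  have hline : ∀ x ∈ hull {P, Q, R}, x ∈ M.Γ → ⟪n, x - P⟫ = 0 := by
    have hP : P ∈ segment ℝ a b := by rw [← hab]; exact ⟨hPT, hPΓ⟩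
    have hQ : Q ∈ segment ℝ a b := by rw [← hab]; exact ⟨hQT, hQΓ⟩
    rw [segment_eq_image_lineMap] at hP hQ
    obtain ⟨s, -, hs⟩ := hP
    obtain ⟨t, -, ht⟩ := hQ
    have e (r : ℝ) : AffineMap.lineMap a b r = a + r • (b - a) := by
      rw [AffineMap.lineMap_apply_module]; module
    rw [e] at hs ht
    have h1 : ⟪n, b - a⟫ = 0 := by
      have h2 : Q - P = (t - s) • (b - a) := by rw [← hs, ← ht]; module
      rw [h2, inner_smul_right, mul_eq_zero] at ho
      rcases ho with h3 | h3
      · rw [h3, zero_smul, sub_eq_zero] at h2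
        exact absurd h2.symm hPQ
      · exact h3
    intro x hxT hxΓ
    have hx : x ∈ segment ℝ a b := by rw [← hab]; exact ⟨hxT, hxΓ⟩
    rw [segment_eq_image_lineMap] at hx
    obtain ⟨r, -, rfl⟩ := hx
    have h2 : AffineMap.lineMap a b r - P = (r - s) • (b - a) := by rw [e, ← hs]; module
    rw [h2, inner_smul_right, h1, mul_zero]
  have hne : ∀ x ∈ hull {P, Q, R}, ∀ k, x ∈ M.Ω k → ⟪n, x - P⟫ ≠ 0 := fun x hx k hk h0 =>
    (Ω_subset k hk).2 (hFΓ (by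
      rw [hull_pair]; exact mem_segment_of_inner_eq_zero ho hR hx h0))
  have hpos : ∀ x ∈ hull {P, Q, R}, ⟪n, x - P⟫ ≠ 0 → 0 < ⟪n, x - P⟫ * ⟪n, R - P⟫ := by
    intro x hx h0
    obtain ⟨t, ht, h1⟩ := exists_inner_eq_mul ho hx
    rw [h1] at h0 ⊢
    have ht' : 0 < t := lt_of_le_of_ne ht fun h => h0 (by rw [← h, zero_mul])
    rw [mul_assoc]
    exact mul_pos ht' (mul_self_pos.2 hR)
  -- The triangle without its edge PQ is convex and does not meet Γ, so it lies on one side of the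
  -- interface; it contains every point of T in either subdomain.
  have hconv : Convex ℝ {x ∈ hull {P, Q, R} | 0 < ⟪n, x - P⟫ * ⟪n, R - P⟫} := by
    intro x hx x' hx' α β hα hβ hαβ
    refine ⟨convex_convexHull ℝ _ hx.1 hx'.1 hα hβ hαβ, ?_⟩
    have h1 : α • x + β • x' - P = α • (x - P) + β • (x' - P) := by
      obtain rfl : α = 1 - β := by linarith
      module
    rw [h1, inner_add_right, inner_smul_right, inner_smul_right]
    have h2 := hx.2
    have h3 := hx'.2
    rcases hα.eq_or_lt with rfl | hα
    · obtain rfl : β = 1 := by linarith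
      simpa using h3
    · nlinarith [mul_pos hα h2, mul_nonneg hβ h3.le]
  obtain ⟨k, hk⟩ := subset_side_of_isPreconnected (M := M) hconv.isPreconnected
    (fun x hx => hull_subset_closedDomain hT hx.1)
    (fun x hx hxΓ => by
      have := hx.2
      rw [hline x hx.1 hxΓ, zero_mul] at this
      exact lt_irrefl _ this)
  have hside {l : Fin 2} {x : Plane} (hxT : x ∈ hull {P, Q, R}) (hx : x ∈ M.Ω l) : l = k := by
    by_contra hl
    exact (disjoint_side hl).notMem_of_mem_left (Ω_subset_side l hx)
      (hk ⟨hxT, hpos x hxT (hne x hxT l hx)⟩)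
  rw [hside hyT hy, hside hzT hz]

open Classical in
-- On an edge in Γ the normal points from Ω¹ to Ω², so the sign in the Green formula agrees with the
-- sign in the interface jump v¹ - v².
theorem sgn_of_fitted (hF : F ∈ M.fittedEdges) (hT : T ∈ M.trisAt F) :
    M.sgn T F = (if T ∈ M.trisI 0 then 1 else 0) - (if T ∈ M.trisI 1 then 1 else 0) := by
  have h1 := M.nF_interface F (mem_fittedEdges.1 hF).1 (mem_fittedEdges.1 hF).2 T hT
  obtain ⟨hT, hFT⟩ := mem_trisAt.1 hT
  have h2 : PointsOut (M.nF F) F T ↔ T ∈ M.trisI 0 := by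
    rw [h1, mem_trisI]; exact ⟨fun h => ⟨hT, h⟩, fun h => h.2⟩
  rw [sgn]
  simp only [h2]
  by_cases h0 : T ∈ M.trisI 0
  · rw [if_pos h0, if_pos h0,
      if_neg fun h => absurd (eq_of_mem_trisI_of_fitted hF hFT h0 h) (by decide)]
    norm_num
  · obtain ⟨i, hi⟩ := exists_mem_trisI (M := M) hT
    have : i = 1 := by
      fin_cases i
      · exact absurd hi h0
      · rfl
    rw [if_neg h0, if_neg h0, if_pos (this ▸ hi)]
    norm_num

/-- A point of the edge in the open domain would have nearby inner points of the edge there, and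
these force a triangle on each side. Passing to the open segment also covers the endpoints. -/
theorem notMem_domain_of_boundary (hF : F ∈ M.edges) (h : M.trisAt F = {T}) {x : Plane}
    (hx : x ∈ hull F) : x ∉ M.domain := by
  obtain ⟨P, Q, hPQ, rfl⟩ := exists_pair hF
  intro hxd
  rw [hull_pair, ← closure_openSegment] at hx
  obtain ⟨y, hyF, hy⟩ := ((mem_closure_iff_frequently.1 hx).and_eventually
    (isOpen_interior.mem_nhds hxd)).exists
  obtain ⟨T1, hT1, T2, hT2, hne, h1, h2⟩ := exists_pair_of_mem_interior hPQ hF (nF_ne_zero hF)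
    (inner_nF hF) hyF subset_rfl hy
  have h1 := mem_trisAt.2 ⟨hT1, h1⟩
  have h2 := mem_trisAt.2 ⟨hT2, h2⟩
  rw [h, Finset.mem_singleton] at h1 h2
  exact hne (h1.trans h2.symm)

theorem volume_segment (a b : Plane) : volume (segment ℝ a b) = 0 := by
  refine measure_mono_null (t := (line[ℝ, a, b] : Set Plane)) ?_
    (Measure.addHaar_affineSubspace volume _ ?_)
  · rw [← convexHull_pair]; exact convexHull_subset_affineSpan _
  · intro h
    have h1 : Module.finrank ℝ (vectorSpan ℝ {a, b}) ≤ 1 :=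
      collinear_iff_finrank_le_one.1 (collinear_pair ℝ a b)
    rw [← direction_affineSpan, h, AffineSubspace.direction_top, finrank_top,
      finrank_euclideanSpace, Fintype.card_fin] at h1
    omega

/-- A triangle consists of its parts in the subdomains, up to a null set. -/
theorem volume_hull_diff (hT : T ∈ M.tris) : volume (hull T \ (M.Ω 0 ∪ M.Ω 1)) = 0 := by
  have h1 : volume (hull T ∩ M.Γ) = 0 := by
    rcases (hull T ∩ M.Γ).eq_empty_or_nonempty with h | h
    · rw [h, measure_empty]
    · obtain ⟨a, b, hab⟩ := M.straight T hT h
      rw [Γ, hab, volume_segment]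
  have h2 : volume (frontier (hull T)) = 0 := (convex_convexHull ℝ _).addHaar_frontier volume
  refine measure_mono_null ?_ (measure_union_null h1 h2)
  rintro x ⟨hxT, hx⟩
  by_cases hxi : x ∈ interior (hull T)
  · left
    refine ⟨hxT, ?_⟩
    by_contra hΓ
    apply hx
    rw [Ω_union]
    exact ⟨interior_hull_subset_domain hT hxi, hΓ⟩
  · right
    exact ⟨subset_closure hxT, hxi⟩

end CutMesh

namespace CutMesh

open Mesh

variable {M : CutMesh} {c : Params} {F T T' : Finset Plane} {i j : Fin 2} {u v θ : Broken}
  {f : Plane → ℝ}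

/-! ### Conformity of the discrete solution -/

/-- The jump of a family of affine functions, as an affine function. -/
def jumpMap (M : CutMesh) (F : Finset Plane) (w : Finset Plane → Plane →ᵃ[ℝ] ℝ) :
    Plane →ᵃ[ℝ] ℝ :=
  ∑ T ∈ M.trisAt F, M.sgn T F • w T

theorem jumpMap_apply (F : Finset Plane) (w : Finset Plane → Plane →ᵃ[ℝ] ℝ) (x : Plane) :
    M.jumpMap F w x = M.jump F fun T => w T x := by
  classical
  have h (S : Finset (Finset Plane)) :
      (∑ T ∈ S, M.sgn T F • w T) x = ∑ T ∈ S, M.sgn T F * w T x := by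
    induction S using Finset.induction_on with
    | empty => simp
    | insert T S hT ih => simp [Finset.sum_insert hT, ih]
  exact h _

theorem affine_segment_eq_zero {P Q x : Plane} {g : Plane →ᵃ[ℝ] ℝ} (hP : g P = 0) (hQ : g Q = 0)
    (hx : x ∈ segment ℝ P Q) : g x = 0 := by
  rw [segment_eq_image_lineMap] at hx
  obtain ⟨t, -, rfl⟩ := hx
  rw [AffineMap.apply_lineMap, hP, hQ, AffineMap.lineMap_same_apply]

theorem nodeSgn_eq {N Q : Plane} :
    M.nodeSgn {N, Q} N = if 0 < ⟪M.nF {N, Q}, rot (Q - N)⟫ then 1 else -1 := by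
  classical
  have h : ∑ P ∈ {N, Q}, (P - N) = Q - N := by
    by_cases h : N = Q
    · simp [h]
    · rw [Finset.sum_pair h, sub_self, zero_add]
  simp only [nodeSgn, h]
  rfl

/-- The choice of the normal cancels in the product, which is the orientation of (N, Q, R). It
changes sign when Q and R are exchanged, and this makes the jumps around N cancel. -/
theorem nodeSgn_mul_sgn {N Q R : Plane} (hF : {N, Q} ∈ M.edges) (hT : {N, Q, R} ∈ M.tris) :
    M.nodeSgn {N, Q} N * M.sgn {N, Q, R} {N, Q} =
      cross (Q - N) (R - N) / |cross (Q - N) (R - N)| := by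
  have hD := cross_ne_zero hT rfl
  have h := outward_normal hD (M.norm_nF _ hF) (inner_nF hF) _ (sgn_eq (R := R) hF)
  -- Pairing with `rot (Q - N)` isolates the sign that defines `nodeSgn`.
  have h1 := congrArg (fun y => ⟪y, rot (Q - N)⟫) h
  simp only [inner_smul_left] at h1
  have hNQ : N ≠ Q := by
    rintro rfl
    simp [cross] at hD
  have hL : 0 < dist N Q := dist_pos.2 hNQ
  have hr : 0 < ⟪rot (Q - N), rot (Q - N)⟫ := by
    refine real_inner_self_pos.2 fun h0 => hNQ ?_
    have e0 := congrArg (fun y : Plane => y 0) h0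
    have e1 := congrArg (fun y : Plane => y 1) h0
    simp [rot] at e0 e1
    ext j
    fin_cases j
    · simp; linarith
    · simp; linarith
  rw [nodeSgn_eq]
  have hs := sgn_mul_self (M := M) {N, Q, R} {N, Q}
  generalize M.sgn {N, Q, R} {N, Q} = s at *
  generalize ⟪M.nF {N, Q}, rot (Q - N)⟫ = y at *
  generalize ⟪rot (Q - N), rot (Q - N)⟫ = r at *
  generalize dist N Q = L at *
  have hd : cross (Q - N) (R - N) / |cross (Q - N) (R - N)| = 1 ∨
      cross (Q - N) (R - N) / |cross (Q - N) (R - N)| = -1 := by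
    rcases hD.lt_or_gt with h | h
    · right; rw [abs_of_neg h, div_neg, div_self hD]
    · left; rw [abs_of_pos h, div_self hD]
  generalize cross (Q - N) (R - N) / |cross (Q - N) (R - N)| = δ at *
  simp only [conj_trivial] at h1
  rcases mul_self_eq_one_iff.1 hs with rfl | rfl <;> rcases hd with rfl | rfl
  · rw [if_pos (by nlinarith)]; norm_num
  · rw [if_neg (by nlinarith)]; norm_num
  · rw [if_neg (by nlinarith)]; norm_num
  · rw [if_pos (by nlinarith)]; norm_num

theorem mem_edgesAt {N : Plane} : F ∈ M.edgesAt N ↔ F ∈ M.edges ∧ N ∈ F := by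
  simp [edgesAt]

theorem pair_mem_edges {P Q : Plane} (hT : T ∈ M.tris) (hPQ : P ≠ Q) (h : {P, Q} ⊆ T) :
    {P, Q} ∈ M.edges :=
  mem_edges.2 ⟨M.complex.down_closed (mem_tris.1 hT).1 h (by simp), Finset.card_pair hPQ⟩

/-- Around a vertex, the jumps of a piecewise function add up to zero. -/
theorem sum_nodeSgn_mul_jump (N : Plane) (w : Finset Plane → ℝ) :
    ∑ F ∈ M.edgesAt N, M.nodeSgn F N * M.jump F w = 0 := by
  classical
  simp only [jump, Finset.mul_sum]
  -- Summation by triangles around N: each one has exactly two edges at N, and its value enters with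
  -- opposite orientations.
  rw [Finset.sum_comm' (t' := M.tris.filter fun T => N ∈ T)
    (s' := fun T => (M.edgesAt N).filter fun F => F ⊆ T)]
  · refine Finset.sum_eq_zero fun T hT => ?_
    obtain ⟨hT, hN⟩ := Finset.mem_filter.1 hT
    obtain ⟨Q, R, hNQ, hNR, hQR, rfl⟩ : ∃ Q R, N ≠ Q ∧ N ≠ R ∧ Q ≠ R ∧ T = {N, Q, R} := by
      have h1 : (T.erase N).card = 2 := by
        rw [Finset.card_erase_of_mem hN, (mem_tris.1 hT).2]
      obtain ⟨Q, R, hQR, h⟩ := Finset.card_eq_two.1 h1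
      have hQ : Q ∈ T.erase N := by rw [h]; simp
      have hR : R ∈ T.erase N := by rw [h]; simp
      exact ⟨Q, R, (Finset.ne_of_mem_erase hQ).symm, (Finset.ne_of_mem_erase hR).symm, hQR,
        by rw [← Finset.insert_erase hN, h]⟩
    have hTs : ({N, Q, R} : Finset Plane) = {N, R, Q} := by rw [Finset.pair_comm]
    have hNQe : {N, Q} ∈ M.edges := pair_mem_edges hT hNQ (by
      intro; simp only [Finset.mem_insert, Finset.mem_singleton]; tauto)
    have hNRe : {N, R} ∈ M.edges := pair_mem_edges hT hNR (by
      intro; simp only [Finset.mem_insert, Finset.mem_singleton]; tauto)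
    have hfil : ((M.edgesAt N).filter fun F => F ⊆ {N, Q, R}) = {{N, Q}, {N, R}} := by
      ext F
      simp only [Finset.mem_filter, mem_edgesAt, Finset.mem_insert, Finset.mem_singleton]
      constructor
      · rintro ⟨⟨hF, hNF⟩, hFT⟩
        obtain ⟨P, hP⟩ : ∃ P, F = {N, P} := by
          have h1 : (F.erase N).card = 1 := by
            rw [Finset.card_erase_of_mem hNF, (mem_edges.1 hF).2]
          obtain ⟨P, h⟩ := Finset.card_eq_one.1 h1
          exact ⟨P, by rw [← Finset.insert_erase hNF, h]⟩
        have hPT : P ∈ ({N, Q, R} : Finset Plane) := hFT (by rw [hP]; simp)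
        have hPN : P ≠ N := by
          rintro rfl
          have := (mem_edges.1 hF).2
          simp [hP] at this
        simp only [Finset.mem_insert, Finset.mem_singleton] at hPT
        rcases hPT with h | rfl | rfl
        · exact absurd h hPN
        · exact Or.inl hP
        · exact Or.inr hP
      · rintro (rfl | rfl)
        · exact ⟨⟨hNQe, by simp⟩, by
            intro; simp only [Finset.mem_insert, Finset.mem_singleton]; tauto⟩
        · exact ⟨⟨hNRe, by simp⟩, by
            intro; simp only [Finset.mem_insert, Finset.mem_singleton]; tauto⟩
    have hne : ({N, Q} : Finset Plane) ≠ {N, R} := by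
      intro h
      have : Q ∈ ({N, R} : Finset Plane) := by rw [← h]; simp
      simp only [Finset.mem_insert, Finset.mem_singleton] at this
      rcases this with h | h
      exacts [hNQ h.symm, hQR h]
    rw [hfil, Finset.sum_pair hne, ← mul_assoc, ← mul_assoc, nodeSgn_mul_sgn hNQe hT]
    have h2 := nodeSgn_mul_sgn hNRe (hTs ▸ hT)
    rw [← hTs] at h2
    rw [h2, cross_swap (R - N), abs_neg]
    ring
  · intro F T
    simp only [mem_trisAt, mem_edgesAt, Finset.mem_filter]
    constructor
    · rintro ⟨⟨hF, hN⟩, hT, hFT⟩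
      exact ⟨⟨⟨hF, hN⟩, hFT⟩, hT, hFT hN⟩
    · rintro ⟨⟨⟨hF, hN⟩, hFT⟩, hT, -⟩
      exact ⟨⟨hF, hN⟩, hT, hFT⟩

/-- Near N the edge runs through the interior of Ω_h^i, so both triangles at it meet Ω^i and
`Resolved` applies. -/
theorem mem_edgesI_of_interior (hM : M.Resolved) {N : Plane} (hN : N ∈ interior (M.domainI i))
    (hF : F ∈ M.edgesAt N) : F ∈ M.edgesI i := by
  obtain ⟨hF, hNF⟩ := mem_edgesAt.1 hF
  obtain ⟨P, Q, hPQ, rfl⟩ := exists_pair hF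
  have hN' : N ∈ closure (openSegment ℝ P Q) := by
    rw [closure_openSegment, ← hull_pair]
    exact subset_convexHull ℝ _ hNF
  obtain ⟨y, hyF, hy⟩ := ((mem_closure_iff_frequently.1 hN').and_eventually
    (isOpen_interior.mem_nhds hN)).exists
  obtain ⟨T, hT, T', hT', hne, h1, h2⟩ := exists_pair_of_mem_interior hPQ hF (nF_ne_zero hF)
    (inner_nF hF) hyF (fun T hT => (mem_trisI.1 hT).1) hy
  exact hM i _ hF T hT T' hT' hne h1 h2

theorem size_pos (hF : F ∈ M.edges) : 0 < size F := by
  obtain ⟨P, Q, hPQ, rfl⟩ := exists_pair hF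
  rw [size_pair]
  exact dist_pos.2 hPQ

theorem edgesI_subset : M.edgesI i ⊆ M.edges := fun _ hF => (mem_edgesI.1 hF).1

theorem jump_eq_zero_of_vertices (hF : F ∈ M.edges) {w : Finset Plane → Plane →ᵃ[ℝ] ℝ}
    (h : ∀ N ∈ F, M.jump F (fun T => w T N) = 0) {x : Plane} (hx : x ∈ hull F) :
    M.jump F (fun T => w T x) = 0 := by
  obtain ⟨P, Q, hPQ, rfl⟩ := exists_pair hF
  rw [hull_pair] at hx
  rw [← jumpMap_apply]
  refine affine_segment_eq_zero ?_ ?_ hx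
  · rw [jumpMap_apply]; exact h P (by simp)
  · rw [jumpMap_apply]; exact h Q (by simp)

/-- The multipliers detect the jumps. -/
theorem jump_eq_zero_of_b (hM : M.Resolved) (h : ∀ μ ∈ M.Mult, M.b c μ u = 0)
    (hF : F ∈ M.edgesI i) {x : Plane} (hx : x ∈ hull F) : M.jump F (fun T => u i T x) = 0 := by
  classical
  -- The factor h_F⁻¹ cancels the weight h_F in the vertex condition and in b_F^i, so the former
  -- becomes the vanishing sum of jumps and the latter a sum of squares.
  let μ : Broken := fun i F => if F ∈ M.edgesI i then (size F)⁻¹ • M.jumpMap F (u i) else 0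
  have hμ : μ ∈ M.Mult := by
    refine ⟨fun i F hF => if_neg hF, fun i N _ hN => ?_⟩
    rw [← sum_nodeSgn_mul_jump (M := M) N fun T => u i T N]
    refine Finset.sum_congr rfl fun F hF => ?_
    have hs := (size_pos (mem_edgesAt.1 hF).1).ne'
    simp only [μ, if_pos (mem_edgesI_of_interior hM hN hF)]
    rw [AffineMap.coe_smul, Pi.smul_apply, jumpMap_apply, smul_eq_mul]
    field_simp
  have hterm (i : Fin 2) (F : Finset Plane) (hF : F ∈ M.edgesI i) :
      bF c i F μ (fun x => M.jump F fun T => u i T x) =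
        c.k i / 2 * ∑ N ∈ F, (M.jump F fun T => u i T N) ^ 2 := by
    have hs := (size_pos (edgesI_subset hF)).ne'
    simp only [bF, μ, if_pos hF, Finset.mul_sum]
    refine Finset.sum_congr rfl fun N _ => ?_
    rw [AffineMap.coe_smul, Pi.smul_apply, jumpMap_apply, smul_eq_mul]
    field_simp
  have hb := h μ hμ
  rw [b] at hb
  have hk (i : Fin 2) : 0 < c.k i / 2 := half_pos (c.k_pos i)
  have hnn (i : Fin 2) (F : Finset Plane) (hF : F ∈ M.edgesI i) :
      0 ≤ bF c i F μ fun x => M.jump F fun T => u i T x := by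
    rw [hterm i F hF]
    exact mul_nonneg (hk i).le (Finset.sum_nonneg fun N _ => sq_nonneg _)
  have h1 := (Finset.sum_eq_zero_iff_of_nonneg fun i _ =>
    Finset.sum_nonneg fun F hF => hnn i F hF).1 hb i (Finset.mem_univ i)
  have h2 := (Finset.sum_eq_zero_iff_of_nonneg fun F hF => hnn i F hF).1 h1 F hF
  rw [hterm i F hF, mul_eq_zero, or_iff_right (hk i).ne',
    Finset.sum_eq_zero_iff_of_nonneg fun N _ => sq_nonneg _] at h2
  exact jump_eq_zero_of_vertices (edgesI_subset hF)
    (fun N hN => pow_eq_zero_iff two_ne_zero |>.1 (h2 N hN)) hx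

theorem mem_C_of_jump (hM : M.Resolved) (hu : u ∈ M.D)
    (h : ∀ i, ∀ F ∈ M.edgesI i, ∀ x ∈ hull F, M.jump F (fun T => u i T x) = 0) : u ∈ M.C := by
  refine ⟨hu, fun i F hF T hT T' hT' hFT hFT' x hx => ?_, fun i F hF T hT hb x hx => ?_⟩
  · by_cases hTT : T = T'
    · rw [hTT]
    · have h1 := h i F (hM i F hF T hT T' hT' hTT hFT hFT') x hx
      rw [jump_eq_of_ne hF (mem_trisAt.2 ⟨(mem_trisI.1 hT).1, hFT⟩)
        (mem_trisAt.2 ⟨(mem_trisI.1 hT').1, hFT'⟩) hTT, mul_eq_zero,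
        or_iff_right (sgn_ne_zero T F), sub_eq_zero] at h1
      exact h1
  · have h1 := h i F (mem_edgesI.2 ⟨hF, x, hx.1, frontier_subset_closure hx.2.1, hx.2.2⟩) x hx.1
    rw [jump, hb, Finset.sum_singleton, mul_eq_zero, or_iff_right (sgn_ne_zero T F)] at h1
    exact h1

/-- On a boundary edge crossed by Γ, membership in `C` only gives zero on the part adjoining Ω^i; an
affine function that vanishes there vanishes on the whole edge. -/
theorem jump_eq_zero_of_mem_C (hv : v ∈ M.C) (hF : F ∈ M.edgesI i) {x : Plane} (hx : x ∈ hull F) :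
    M.jump F (fun T => v i T x) = 0 := by
  have hFe := edgesI_subset hF
  have hsub := trisAt_subset_trisI hF
  by_cases hT : ∃ T ∈ M.trisAt F, ∃ T' ∈ M.trisAt F, T ≠ T'
  · obtain ⟨T, hT, T', hT', hne⟩ := hT
    rw [jump_eq_of_ne hFe hT hT' hne, hv.2.1 i F hFe T (hsub hT) T' (hsub hT') (mem_trisAt.1 hT).2
      (mem_trisAt.1 hT').2 x hx, sub_self, mul_zero]
  · push Not at hT
    obtain ⟨T, hT', hFT⟩ := exists_tri_of_edge hFe
    have hTF := mem_trisAt.2 ⟨hT', hFT⟩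
    have hone : M.trisAt F = {T} :=
      Finset.eq_singleton_iff_unique_mem.2 ⟨hTF, fun T' h => hT T' h T hTF⟩
    rw [jump, hone, Finset.sum_singleton]
    obtain ⟨-, x₀, hx₀, hs⟩ := mem_edgesI.1 hF
    have key : ∀ᶠ y in nhds x₀, y ∈ hull F → v i T y = 0 := by
      filter_upwards [eventually_mem_side hs] with y hy hyF
      have hys := hy (hull_edge_subset_closedDomain hFe hyF)
      refine hv.2.2 i F hFe T (hsub hTF) hone y ⟨hyF, ⟨hys.1, fun h => ?_⟩, hys.2⟩
      exact notMem_domain_of_boundary hFe hone hyF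
        (Ω_subset i (interior_subset h)).1
    have hc : Filter.Tendsto (fun ε : ℝ => AffineMap.lineMap x₀ x ε) (nhdsWithin 0 (Ioo 0 1))
        (nhds x₀) := by
      have : Continuous fun ε : ℝ => (AffineMap.lineMap x₀ x ε : Plane) :=
        AffineMap.lineMap_continuous
      simpa using (this.tendsto 0).mono_left nhdsWithin_le_nhds
    have : (nhdsWithin (0 : ℝ) (Ioo 0 1)).NeBot := by
      rw [nhdsWithin_Ioo_eq_nhdsGT one_pos]; infer_instance
    obtain ⟨ε, h1, h2⟩ := ((hc.eventually key).and self_mem_nhdsWithin).exists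
    -- The value at the point a fraction ε of the way from x₀ to x is ε times the value at x.
    have h3 := h1 ((convex_convexHull ℝ _).lineMap_mem hx₀ hx ⟨h2.1.le, h2.2.le⟩)
    rw [AffineMap.apply_lineMap, key.self_of_nhds hx₀, AffineMap.lineMap_apply_ring', sub_zero,
      add_zero, mul_eq_zero, or_iff_right h2.1.ne'] at h3
    rw [h3, mul_zero]

theorem jump_eq_zero_of_solvesMixed (hM : M.Resolved) (h : M.SolvesMixed c f u θ)
    (hF : F ∈ M.edgesI i) {x : Plane} (hx : x ∈ hull F) : M.jump F (fun T => u i T x) = 0 :=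
  jump_eq_zero_of_b hM h.2.2.2 hF hx

theorem solvesPrimal_of_solvesMixed (hM : M.Resolved) (h : M.SolvesMixed c f u θ) :
    M.SolvesPrimal c f u := by
  have hu : u ∈ M.C := mem_C_of_jump hM h.1 fun i F hF x hx =>
    jump_eq_zero_of_solvesMixed hM h hF hx
  refine ⟨hu, fun v hv => ?_⟩
  rw [← h.2.2.1 v hv.1]
  have hd : M.d c u v = 0 := by
    refine Finset.sum_eq_zero fun i _ => Finset.sum_eq_zero fun F hF => ?_
    refine setIntegral_eq_zero_of_forall_eq_zero fun x hx => ?_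
    rw [jump_eq_zero_of_mem_C hv hF hx.1, jump_eq_zero_of_mem_C hu hF hx.1]
    ring
  have hb : M.b c θ v = 0 := by
    refine Finset.sum_eq_zero fun i _ => Finset.sum_eq_zero fun F hF => ?_
    rw [bF, Finset.sum_eq_zero fun N hN => ?_, mul_zero]
    rw [jump_eq_zero_of_mem_C hv hF (subset_convexHull ℝ _ hN), mul_zero]
  rw [hd, hb]
  ring

end CutMesh

open Mesh

/-! ### Polynomials of degree at most one -/

theorem Poly_mono {m m' : ℕ} (h : m ≤ m') : Poly m ≤ Poly m' :=
  Submodule.span_mono fun _ ⟨a, b, hab, hp⟩ => ⟨a, b, hab.trans h, hp⟩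

theorem const_mem_Poly (m : ℕ) (r : ℝ) : (fun _ => r : Plane → ℝ) ∈ Poly m := by
  have h : (fun _ => 1 : Plane → ℝ) ∈ Poly m :=
    Submodule.subset_span ⟨0, 0, by omega, by ext; simp⟩
  convert (Poly m).smul_mem r h using 1
  ext; simp

theorem mem_Poly_zero {p : Plane → ℝ} : p ∈ Poly 0 ↔ ∃ r : ℝ, p = fun _ => r := by
  refine ⟨fun h => ?_, fun ⟨r, hr⟩ => hr ▸ const_mem_Poly 0 r⟩
  induction h using Submodule.span_induction with
  | mem p hp =>
    obtain ⟨a, b, hab, rfl⟩ := hp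
    obtain rfl : a = 0 := by omega
    obtain rfl : b = 0 := by omega
    exact ⟨1, by ext; simp⟩
  | zero => exact ⟨0, rfl⟩
  | add p q _ _ hp hq =>
    obtain ⟨r, rfl⟩ := hp
    obtain ⟨s, rfl⟩ := hq
    exact ⟨r + s, rfl⟩
  | smul t p _ hp =>
    obtain ⟨r, rfl⟩ := hp
    exact ⟨t * r, rfl⟩

theorem inner_mem_Poly (β : Plane) : (fun x => ⟪β, x⟫ : Plane → ℝ) ∈ Poly 1 := by
  have h0 : (fun x => x 0 : Plane → ℝ) ∈ Poly 1 :=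
    Submodule.subset_span ⟨1, 0, by omega, by ext; simp⟩
  have h1 : (fun x => x 1 : Plane → ℝ) ∈ Poly 1 :=
    Submodule.subset_span ⟨0, 1, by omega, by ext; simp⟩
  convert (Poly 1).add_mem ((Poly 1).smul_mem (β 0) h0) ((Poly 1).smul_mem (β 1) h1) using 1
  ext x
  simp [inner_eq]

theorem mem_Poly_one {p : Plane → ℝ} :
    p ∈ Poly 1 ↔ ∃ (r : ℝ) (β : Plane), p = fun x => r + ⟪β, x⟫ := by
  refine ⟨fun h => ?_, fun ⟨r, β, hr⟩ =>
    hr ▸ (Poly 1).add_mem (const_mem_Poly 1 r) (inner_mem_Poly β)⟩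
  induction h using Submodule.span_induction with
  | mem p hp =>
    obtain ⟨a, b, hab, rfl⟩ := hp
    have : (a = 0 ∧ b = 0) ∨ (a = 1 ∧ b = 0) ∨ (a = 0 ∧ b = 1) := by omega
    rcases this with ⟨rfl, rfl⟩ | ⟨rfl, rfl⟩ | ⟨rfl, rfl⟩
    · exact ⟨1, 0, by ext; simp⟩
    · exact ⟨0, !₂[1, 0], by ext; simp [inner_eq]⟩
    · exact ⟨0, !₂[0, 1], by ext; simp [inner_eq]⟩
  | zero => exact ⟨0, 0, by ext; simp⟩
  | add p q _ _ hp hq =>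
    obtain ⟨r, β, rfl⟩ := hp
    obtain ⟨s, β', rfl⟩ := hq
    exact ⟨r + s, β + β', by ext; simp [inner_add_left]; ring⟩
  | smul t p _ hp =>
    obtain ⟨r, β, rfl⟩ := hp
    exact ⟨t * r, t • β, by ext; simp [inner_smul_left]; ring⟩

theorem affine_eq (g : Plane →ᵃ[ℝ] ℝ) (x : Plane) : g x = g 0 + ⟪grad g, x⟫ := by
  have h1 : g x = g.linear x + g 0 := by
    have := g.map_vadd 0 x
    simpa using this
  have hdec : x = x 0 • EuclideanSpace.single 0 1 + x 1 • EuclideanSpace.single 1 1 := by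
    ext j; fin_cases j <;> simp
  rw [h1, inner_eq]
  conv_lhs => rw [hdec]
  simp only [map_add, map_smul, grad, smul_eq_mul]
  ring

theorem affine_mem_Poly (g : Plane →ᵃ[ℝ] ℝ) : (g : Plane → ℝ) ∈ Poly 1 :=
  mem_Poly_one.2 ⟨g 0, grad g, funext (affine_eq g)⟩

theorem exists_affine_of_mem_Poly {p : Plane → ℝ} (hp : p ∈ Poly 1) :
    ∃ g : Plane →ᵃ[ℝ] ℝ, p = g := by
  obtain ⟨r, β, rfl⟩ := mem_Poly_one.1 hp
  exact ⟨(innerₛₗ ℝ β).toAffineMap + AffineMap.const ℝ Plane r, by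
    ext x; simp [add_comm]⟩

theorem continuous_of_mem_Poly {m : ℕ} {p : Plane → ℝ} (hp : p ∈ Poly m) : Continuous p := by
  induction hp using Submodule.span_induction with
  | mem p hp => obtain ⟨a, b, -, rfl⟩ := hp; fun_prop
  | zero => exact continuous_const
  | add p q _ _ hp hq => exact hp.add hq
  | smul t p _ hp => exact hp.const_smul t

/-! ### The local Raviart-Thomas space -/

namespace LocalRT

variable {m : ℕ} {σ τ : Plane → Plane}

theorem add_mem (hσ : σ ∈ LocalRT m) (hτ : τ ∈ LocalRT m) :
    (fun x => σ x + τ x) ∈ LocalRT m := by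
  obtain ⟨a, b, ha, hb, rfl⟩ := hσ
  obtain ⟨a', b', ha', hb', rfl⟩ := hτ
  refine ⟨fun j => a j + a' j, b + b', fun j => (Poly m).add_mem (ha j) (ha' j),
    (Poly m).add_mem hb hb', ?_⟩
  ext x j
  simp
  ring

theorem sub_mem (hσ : σ ∈ LocalRT m) (hτ : τ ∈ LocalRT m) :
    (fun x => σ x - τ x) ∈ LocalRT m := by
  obtain ⟨a, b, ha, hb, rfl⟩ := hσ
  obtain ⟨a', b', ha', hb', rfl⟩ := hτ
  refine ⟨fun j => a j - a' j, b - b', fun j => (Poly m).sub_mem (ha j) (ha' j),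
    (Poly m).sub_mem hb hb', ?_⟩
  ext x j
  simp
  ring

theorem zero_mem : (fun _ => 0 : Plane → Plane) ∈ LocalRT m :=
  ⟨fun _ => 0, 0, fun _ => (Poly m).zero_mem, (Poly m).zero_mem, by ext x j; simp⟩

theorem sum_mem {ι : Type*} (s : Finset ι) {τ : ι → Plane → Plane}
    (h : ∀ k ∈ s, τ k ∈ LocalRT m) : (fun x => ∑ k ∈ s, τ k x) ∈ LocalRT m := by
  classical
  induction s using Finset.induction_on with
  | empty => simpa using zero_mem
  | insert k s hk ih =>
    simp only [Finset.sum_insert hk]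
    exact add_mem (h k (by simp)) (ih fun l hl => h l (by simp [hl]))

theorem smul_sub_mem {p : Plane → ℝ} (hp : p ∈ Poly m) (P : Plane) :
    (fun x => p x • (x - P)) ∈ LocalRT m := by
  refine ⟨fun j => -P j • p, p, fun j => (Poly m).smul_mem _ hp, hp, ?_⟩
  ext x j
  simp
  ring

theorem continuous (hσ : σ ∈ LocalRT m) : Continuous σ := by
  obtain ⟨a, b, ha, hb, rfl⟩ := hσ
  have ha' := fun j => continuous_of_mem_Poly (ha j)
  have hb' := continuous_of_mem_Poly hb
  fun_prop

/-- On a line, the normal component of a Raviart-Thomas field is a polynomial. -/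
theorem exists_trace (hσ : σ ∈ LocalRT m) (n P : Plane) :
    ∃ w ∈ Poly m, ∀ x, ⟪n, x - P⟫ = 0 → ⟪σ x, n⟫ = w x := by
  obtain ⟨a, b, ha, hb, rfl⟩ := hσ
  refine ⟨n 0 • a 0 + n 1 • a 1 + ⟪n, P⟫ • b, (Poly m).add_mem ((Poly m).add_mem
    ((Poly m).smul_mem _ (ha 0)) ((Poly m).smul_mem _ (ha 1))) ((Poly m).smul_mem _ hb),
    fun x hx => ?_⟩
  rw [inner_sub_right, sub_eq_zero, inner_eq] at hx
  -- On the line ⟪n, x⟫ is constant, so the part b(x) x of the field does not raise the degree.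
  simp only [Pi.add_apply, Pi.smul_apply, smul_eq_mul, ← hx, inner_eq]
  ring

/-- A Raviart-Thomas field of degree at most one is the sum of an affine and of a radial field. -/
theorem exists_decomp (hm : m = 0 ∨ m = 1) (hσ : σ ∈ LocalRT m) :
    ∃ (r : Fin 2 → ℝ) (α : Fin 2 → Plane) (β : Plane), (m = 0 → β = 0) ∧
      ∀ x j, σ x j = r j + ⟪α j, x⟫ + ⟪β, x⟫ * x j := by
  obtain ⟨a, b, ha, hb, rfl⟩ := hσ
  have hm1 : m ≤ 1 := by omega
  choose r α hα using fun j => mem_Poly_one.1 (Poly_mono hm1 (ha j))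
  obtain ⟨s, β, hβ, hβ0⟩ : ∃ (s : ℝ) (β : Plane), (b = fun x => s + ⟪β, x⟫) ∧ (m = 0 → β = 0) := by
    rcases hm with rfl | rfl
    · obtain ⟨s, hs⟩ := mem_Poly_zero.1 hb
      exact ⟨s, 0, by rw [hs]; ext; simp, fun _ => rfl⟩
    · obtain ⟨s, β, hs⟩ := mem_Poly_one.1 hb
      exact ⟨s, β, hs, by omega⟩
  -- The constant part s of the radial factor contributes s x, which is absorbed in the affine
  -- field.
  refine ⟨r, fun j => α j + EuclideanSpace.single j s, β, hβ0, fun x j => ?_⟩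
  simp only [hα, hβ, inner_add_left]
  simp [EuclideanSpace.inner_single_left]
  ring

end LocalRT

/-! ### Barycentric coordinates and the Raviart-Thomas bubble fields of a triangle. -/

namespace Mesh

variable {M : Mesh} {F T : Finset Plane}

/-- The vertices of a triangle, as an affine basis. -/
def affineBasis (hT : T ∈ M.tris) : AffineBasis T ℝ Plane where
  toFun := (↑)
  ind' := M.complex.indep (mem_tris.1 hT).1
  tot' := by
    rw [(M.complex.indep (mem_tris.1 hT).1).affineSpan_eq_top_iff_card_eq_finrank_add_one,
      Fintype.card_coe, (mem_tris.1 hT).2, finrank_euclideanSpace, Fintype.card_fin]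

theorem affineBasis_apply (hT : T ∈ M.tris) (P : T) : affineBasis hT P = (P : Plane) := rfl

/-- The barycentric coordinates of a triangle. -/
def bary (hT : T ∈ M.tris) (P : T) : Plane →ᵃ[ℝ] ℝ := (affineBasis hT).coord P

theorem sum_bary (hT : T ∈ M.tris) (x : Plane) : ∑ P, bary hT P x = 1 :=
  (affineBasis hT).sum_coord_apply_eq_one x

theorem sum_bary_smul (hT : T ∈ M.tris) (x : Plane) : ∑ P, bary hT P x • (P : Plane) = x :=
  (affineBasis hT).linear_combination_coord_eq_self x

theorem bary_ne (hT : T ∈ M.tris) {P Q : T} (h : P ≠ Q) : bary hT P Q = 0 :=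
  (affineBasis hT).coord_apply_ne h

theorem sum_bary_inner (hT : T ∈ M.tris) (β x : Plane) :
    ∑ P, bary hT P x * ⟪β, (P : Plane)⟫ = ⟪β, x⟫ := by
  conv_rhs => rw [← sum_bary_smul hT x]
  rw [inner_sum]
  simp_rw [inner_smul_right]

theorem hull_eq_bary (hT : T ∈ M.tris) : hull T = {x | ∀ P, 0 ≤ bary hT P x} := by
  have := (affineBasis hT).convexHull_eq_nonneg_coord
  have hr : range (affineBasis hT) = (T : Set Plane) := by
    ext x; simp [affineBasis_apply]
  rw [hr] at this
  exact this

theorem interior_hull_eq_bary (hT : T ∈ M.tris) :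
    interior (hull T) = {x | ∀ P, 0 < bary hT P x} := by
  have := (affineBasis hT).interior_convexHull
  have hr : range (affineBasis hT) = (T : Set Plane) := by
    ext x; simp [affineBasis_apply]
  rw [hr] at this
  exact this

/-- The fields of the local Raviart-Thomas space of degree one without normal components on the
edges. -/
def bubble (hT : T ∈ M.tris) (β x : Plane) : Plane :=
  ∑ P : T, (-⟪β, (P : Plane)⟫ * bary hT P x) • (x - P)

theorem bubble_mem (hT : T ∈ M.tris) (β : Plane) : bubble hT β ∈ LocalRT 1 :=
  LocalRT.sum_mem _ fun P _ =>
    LocalRT.smul_sub_mem ((Poly 1).smul_mem _ (affine_mem_Poly (bary hT P))) _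

/-- The field is the affine interpolant at the vertices of x ↦ ⟪β, x⟫ x, minus this quadratic field;
in particular it vanishes at the vertices. -/
theorem bubble_eq (hT : T ∈ M.tris) (β x : Plane) :
    bubble hT β x = ∑ P : T, (⟪β, (P : Plane)⟫ * bary hT P x) • (P : Plane) - ⟪β, x⟫ • x := by
  rw [← sum_bary_inner hT β x, Finset.sum_smul, ← Finset.sum_sub_distrib, bubble]
  refine Finset.sum_congr rfl fun P _ => ?_
  module

/-- The barycentric coordinates act as probabilities on the vertices with mean x, and the two sides
are the two expressions for the variance of ⟪β, P⟫. -/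
theorem inner_bubble (hT : T ∈ M.tris) (β x : Plane) :
    ⟪bubble hT β x, β⟫ = ∑ P : T, bary hT P x * ⟪β, (P : Plane) - x⟫ ^ 2 := by
  have h1 := sum_bary hT x
  have h2 := sum_bary_inner hT β x
  have h3 : ∑ P : T, bary hT P x * ⟪β, (P : Plane) - x⟫ ^ 2 =
      (∑ P : T, bary hT P x * ⟪β, (P : Plane)⟫ ^ 2) -
        2 * ⟪β, x⟫ * (∑ P : T, bary hT P x * ⟪β, (P : Plane)⟫) +
        ⟪β, x⟫ ^ 2 * ∑ P : T, bary hT P x := by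
    rw [Finset.mul_sum, Finset.mul_sum, ← Finset.sum_sub_distrib, ← Finset.sum_add_distrib]
    refine Finset.sum_congr rfl fun P _ => ?_
    rw [inner_sub_right]
    ring
  rw [h3, h1, h2, bubble_eq, real_inner_comm, inner_sub_right, inner_sum]
  simp only [inner_smul_right]
  have h4 : ∑ P : T, ⟪β, (P : Plane)⟫ * bary hT P x * ⟪β, (P : Plane)⟫ =
      ∑ P : T, bary hT P x * ⟪β, (P : Plane)⟫ ^ 2 :=
    Finset.sum_congr rfl fun P _ => by ring
  rw [h4]
  ring

theorem continuous_bubble (hT : T ∈ M.tris) (β : Plane) : Continuous (bubble hT β) :=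
  LocalRT.continuous (bubble_mem hT β)

theorem eq_zero_of_integral_bubble (hT : T ∈ M.tris) {β : Plane}
    (h : ∫ x in hull T, ⟪bubble hT β x, β⟫ = 0) : β = 0 := by
  have hc : Continuous fun x => ⟪bubble hT β x, β⟫ :=
    (continuous_bubble hT β).inner continuous_const
  have hnn : ∀ x ∈ hull T, 0 ≤ ⟪bubble hT β x, β⟫ := by
    intro x hx
    rw [hull_eq_bary hT] at hx
    rw [inner_bubble]
    exact Finset.sum_nonneg fun P _ => mul_nonneg (hx P) (sq_nonneg _)
  have hae := (setIntegral_eq_zero_iff_of_nonneg_ae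
    ((ae_restrict_iff' (isClosed_hull T).measurableSet).2 (Filter.Eventually.of_forall hnn))
    (hc.continuousOn.integrableOn_compact (isCompact_hull T))).1 h
  have hae' : (fun x => ⟪bubble hT β x, β⟫) =ᵐ[volume.restrict (interior (hull T))] fun _ => 0 :=
    ae_mono (Measure.restrict_mono interior_subset le_rfl) hae
  have hz := Measure.eqOn_open_of_ae_eq hae' isOpen_interior hc.continuousOn
    continuousOn_const
  obtain ⟨x, hx⟩ := interior_hull_nonempty hT
  have hx0 := hz hx
  rw [interior_hull_eq_bary hT] at hx
  simp only [inner_bubble] at hx0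
  rw [Finset.sum_eq_zero_iff_of_nonneg
    fun P _ => mul_nonneg (hx P).le (sq_nonneg _)] at hx0
  have h1 : ∀ P : T, ⟪β, (P : Plane)⟫ = ⟪β, x⟫ := fun P => by
    have := hx0 P (Finset.mem_univ P)
    rw [mul_eq_zero, or_iff_right (hx P).ne', sq_eq_zero_iff, inner_sub_right, sub_eq_zero] at this
    exact this
  -- Zero variance at an inner point makes ⟪β, ·⟫ take one value at all vertices, hence be constant
  -- on the plane. Its values at x and x + β differ by ⟪β, β⟫.
  have h2 := sum_bary_inner hT β (x + β)
  simp_rw [h1] at h2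
  rw [← Finset.sum_mul, sum_bary, one_mul, inner_add_right] at h2
  exact inner_self_eq_zero.1 (by linarith : ⟪β, β⟫ = 0)

/-- Taking the mean of the bubble is a linear map of the plane into itself; it is injective by
`eq_zero_of_integral_bubble`, hence surjective. -/
theorem exists_bubble (hT : T ∈ M.tris) (ξ : Plane) :
    ∃ β, ∀ ζ, ∫ x in hull T, ⟪bubble hT β x, ζ⟫ = ⟪ξ, ζ⟫ := by
  have hint (β : Plane) : IntegrableOn (bubble hT β) (hull T) :=
    (continuous_bubble hT β).continuousOn.integrableOn_compact (isCompact_hull T)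
  let L : Plane →ₗ[ℝ] Plane :=
    { toFun := fun β => ∫ x in hull T, bubble hT β x
      map_add' := fun β β' => by
        rw [← integral_add (hint β) (hint β')]
        congr 1
        ext1 x
        simp only [bubble, ← Finset.sum_add_distrib]
        refine Finset.sum_congr rfl fun P _ => ?_
        rw [inner_add_left]
        module
      map_smul' := fun r β => by
        rw [RingHom.id_apply, ← integral_smul]
        congr 1
        ext1 x
        simp only [bubble, Finset.smul_sum]
        refine Finset.sum_congr rfl fun P _ => ?_
        rw [inner_smul_left, conj_trivial]
        module }
  have hL (β ζ : Plane) : ∫ x in hull T, ⟪bubble hT β x, ζ⟫ = ⟪L β, ζ⟫ := by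
    rw [real_inner_comm]
    refine Eq.trans ?_ (integral_inner (hint β) ζ)
    simp_rw [real_inner_comm ζ]
  have hinj : Function.Injective L := by
    rw [← LinearMap.ker_eq_bot, LinearMap.ker_eq_bot']
    intro β hβ
    exact eq_zero_of_integral_bubble hT (by rw [hL, hβ, inner_zero_left])
  obtain ⟨β, hβ⟩ := LinearMap.injective_iff_surjective.1 hinj ξ
  exact ⟨β, fun ζ => by rw [hL, hβ]⟩

/-- A Raviart-Thomas field is determined by its values at the vertices and by its mean. -/
theorem eq_zero_of_vertices (hT : T ∈ M.tris) {m : ℕ} (hm : m = 0 ∨ m = 1) {σ : Plane → Plane}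
    (hσ : σ ∈ LocalRT m) (hv : ∀ P ∈ T, σ P = 0)
    (hi : m = 1 → ∀ ζ, ∫ x in hull T, ⟪σ x, ζ⟫ = 0) : σ = 0 := by
  obtain ⟨r, α, β, hβ, h⟩ := LocalRT.exists_decomp hm hσ
  -- The affine part of σ is determined by its values at the vertices, where it must cancel the part
  -- ⟪β, x⟫ x.
  have key (x : Plane) : σ x = -bubble hT β x := by
    ext j
    have h1 : (bubble hT β x) j =
        (∑ P : T, ⟪β, (P : Plane)⟫ * bary hT P x * (P : Plane) j) - ⟪β, x⟫ * x j := by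
      rw [bubble_eq]
      simp
    have h2 : r j + ⟪α j, x⟫ = -∑ P : T, ⟪β, (P : Plane)⟫ * bary hT P x * (P : Plane) j := by
      rw [← sum_bary_inner hT (α j) x, ← mul_one (r j), ← sum_bary hT x, Finset.mul_sum,
        ← Finset.sum_add_distrib, ← Finset.sum_neg_distrib]
      refine Finset.sum_congr rfl fun P _ => ?_
      have h3 := h P j
      rw [hv P P.2] at h3
      simp only [PiLp.zero_apply] at h3
      linear_combination -(bary hT P x) * h3
    rw [h x j, PiLp.neg_apply, h1, h2]
    ring
  have hβ0 : β = 0 := by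
    rcases hm with hm | hm
    · exact hβ hm
    · refine eq_zero_of_integral_bubble hT ?_
      have := hi hm β
      simp_rw [key, inner_neg_left] at this
      rw [integral_neg, neg_eq_zero] at this
      exact this
  ext1 x
  rw [key, hβ0]
  simp [bubble]

end Mesh

/-! ### Unisolvence of the degrees of freedom -/

theorem exists_affine_pair {P Q : Plane} (h : P ≠ Q) : ∃ g : Plane →ᵃ[ℝ] ℝ, g P = 1 ∧ g Q = 0 := by
  have h0 : ⟪P - Q, P⟫ - ⟪P - Q, Q⟫ ≠ 0 := by
    rw [← inner_sub_right]
    exact inner_self_ne_zero.2 (sub_ne_zero.2 h)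
  obtain ⟨g, hg⟩ := exists_affine_of_mem_Poly (p := fun x =>
    -(⟪P - Q, Q⟫ / (⟪P - Q, P⟫ - ⟪P - Q, Q⟫)) + ⟪(⟪P - Q, P⟫ - ⟪P - Q, Q⟫)⁻¹ • (P - Q), x⟫)
    (mem_Poly_one.2 ⟨_, _, rfl⟩)
  refine ⟨g, ?_, ?_⟩
  · rw [← hg]
    simp only [inner_smul_left, conj_trivial]
    field_simp
    ring
  · rw [← hg]
    simp only [inner_smul_left, conj_trivial]
    field_simp
    ring

theorem eq_zero_of_moments {M : Mesh} {F : Finset Plane} (hF : F ∈ M.edges) {w : Plane → ℝ}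
    (hw : w ∈ Poly 1) (h : lineIntegral (hull F) (fun x => w x * w x) = 0) :
    ∀ x ∈ hull F, w x = 0 := by
  obtain ⟨P, Q, hPQ, rfl⟩ := exists_pair hF
  obtain ⟨g, rfl⟩ := exists_affine_of_mem_Poly hw
  rw [hull_pair, lineIntegral_affine_mul hPQ] at h
  have hd : dist P Q / 6 ≠ 0 := by have := dist_pos.2 hPQ; positivity
  rw [mul_eq_zero, or_iff_right hd] at h
  intro x hx
  rw [hull_pair] at hx
  refine CutMesh.affine_segment_eq_zero ?_ ?_ hx
  · nlinarith [sq_nonneg (g P), sq_nonneg (g Q), sq_nonneg (g P + g Q)]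
  · nlinarith [sq_nonneg (g P), sq_nonneg (g Q), sq_nonneg (g P + g Q)]

/-- The polynomials on an edge represent the functionals of polynomials on the edge. -/
theorem exists_moments {M : Mesh} {F : Finset Plane} (hF : F ∈ M.edges) {m : ℕ}
    (hm : m = 0 ∨ m = 1) {ℓ : (Plane → ℝ) → ℝ}
    (hadd : ∀ v w : Plane → ℝ, Continuous v → Continuous w →
      ℓ (fun x => v x + w x) = ℓ v + ℓ w)
    (hmul : ∀ (r : ℝ) (v : Plane → ℝ), ℓ (fun x => r * v x) = r * ℓ v)
    (hcongr : ∀ v w : Plane → ℝ, (∀ x ∈ hull F, v x = w x) → ℓ v = ℓ w) :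
    ∃ g ∈ Poly m, ∀ v ∈ Poly m, lineIntegral (hull F) (fun x => g x * v x) = ℓ v := by
  obtain ⟨P, Q, hPQ, rfl⟩ := exists_pair hF
  have hd : dist P Q ≠ 0 := (dist_pos.2 hPQ).ne'
  rcases hm with rfl | rfl
  · refine ⟨fun _ => ℓ (fun _ => 1) / dist P Q, const_mem_Poly 0 _, fun v hv => ?_⟩
    obtain ⟨r, rfl⟩ := mem_Poly_zero.1 hv
    have h1 := hmul r fun _ => 1
    simp only [mul_one] at h1
    rw [h1, hull_pair, lineIntegral_segment hPQ]
    simp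
    field_simp
  · obtain ⟨p, hpP, hpQ⟩ := exists_affine_pair hPQ
    obtain ⟨q, hqQ, hqP⟩ := exists_affine_pair hPQ.symm
    set y := ℓ p
    set z := ℓ q
    -- The coefficients come from the inverse of the mass matrix |PQ|/6 · (2 1; 1 2) of the nodal
    -- basis.
    refine ⟨((2 / dist P Q * (2 * y - z)) • p + (2 / dist P Q * (2 * z - y)) • q :
      Plane →ᵃ[ℝ] ℝ), affine_mem_Poly _, fun v hv => ?_⟩
    obtain ⟨v, rfl⟩ := exists_affine_of_mem_Poly hv
    have hv1 : ℓ v = v P * y + v Q * z := by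
      rw [← hmul, ← hmul, ← hadd (fun x => v P * p x) (fun x => v Q * q x)
        (continuous_const.mul p.continuous_of_finiteDimensional)
        (continuous_const.mul q.continuous_of_finiteDimensional)]
      refine hcongr _ _ fun x hx => ?_
      rw [hull_pair] at hx
      have := CutMesh.affine_segment_eq_zero (g := v - (v P • p + v Q • q))
        (by simp [hpP, hqP]) (by simp [hpQ, hqQ]) hx
      simp only [AffineMap.coe_sub, AffineMap.coe_add, AffineMap.coe_smul, Pi.sub_apply,
        Pi.add_apply, Pi.smul_apply, smul_eq_mul] at this
      linarith
    rw [hull_pair, lineIntegral_affine_mul hPQ, hv1]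
    simp only [AffineMap.coe_add, AffineMap.coe_smul, Pi.add_apply, Pi.smul_apply, smul_eq_mul,
      hpP, hpQ, hqP, hqQ]
    field_simp
    ring

namespace CutMesh

variable {M : CutMesh} {c : Params} {F T T' : Finset Plane} {i j : Fin 2} {u v θ : Broken}
  {f : Plane → ℝ} {m : ℕ}

theorem inner_nF_hull (hF : F ∈ M.edges) {x y : Plane} (hx : x ∈ hull F) (hy : y ∈ hull F) :
    ⟪M.nF F, x - y⟫ = 0 := by
  obtain ⟨P, Q, hPQ, rfl⟩ := exists_pair hF
  have ho := inner_nF hF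
  have h (z : Plane) (hz : z ∈ hull {P, Q}) : ⟪M.nF {P, Q}, z - P⟫ = 0 := by
    rw [hull_pair, segment_eq_image'] at hz
    obtain ⟨t, -, rfl⟩ := hz
    simp only [add_sub_cancel_left, inner_smul_right, ho, mul_zero]
  have : x - y = (x - P) - (y - P) := by abel
  rw [this, inner_sub_right, h x hx, h y hy, sub_zero]

open Classical in
theorem erase_mem_edges (hT : T ∈ M.tris) {P : Plane} (hP : P ∈ T) : T.erase P ∈ M.edges := by
  have hc : (T.erase P).card = 2 := by rw [Finset.card_erase_of_mem hP, (mem_tris.1 hT).2]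
  exact mem_edges.2 ⟨M.complex.down_closed (mem_tris.1 hT).1 (Finset.erase_subset P T)
    (Finset.card_pos.1 (by omega)), hc⟩

open Classical in
theorem mem_edgesOf_iff (hT : T ∈ M.tris) : F ∈ M.edgesOf T ↔ ∃ P ∈ T, F = T.erase P := by
  constructor
  · intro h
    obtain ⟨hF, hFT⟩ := mem_edgesOf.1 h
    have h1 : (T \ F).card = 1 := by
      rw [Finset.card_sdiff_of_subset hFT, (mem_tris.1 hT).2, (mem_edges.1 hF).2]
    obtain ⟨P, hP⟩ := Finset.card_eq_one.1 h1
    have hPT : P ∈ T \ F := by rw [hP]; simp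
    refine ⟨P, (Finset.mem_sdiff.1 hPT).1, ?_⟩
    rw [← Finset.sdiff_singleton_eq_erase, ← hP, Finset.sdiff_sdiff_eq_self hFT]
  · rintro ⟨P, hP, rfl⟩
    exact mem_edgesOf.2 ⟨erase_mem_edges hT hP, Finset.erase_subset P T⟩

open Classical in
-- The constant κ is the signed distance from P to the line of the opposite edge.
theorem exists_height (hT : T ∈ M.tris) {P : Plane} (hP : P ∈ T) :
    ∃ κ : ℝ, κ ≠ 0 ∧ ∀ x ∈ hull (T.erase P), ⟪x - P, M.nF (T.erase P)⟫ = κ := by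
  have hF := erase_mem_edges hT hP
  obtain ⟨A, B, hAB, hF'⟩ := exists_pair hF
  have hT' : T = {A, B, P} := by
    rw [← Finset.insert_erase hP, hF']
    ext; simp only [Finset.mem_insert, Finset.mem_singleton]; tauto
  rw [hF'] at hF ⊢
  have h := inner_third_ne_zero (hT' ▸ hT) (nF_ne_zero hF) (inner_nF hF)
  refine ⟨-⟪M.nF {A, B}, P - A⟫, neg_ne_zero.2 h, fun x hx => ?_⟩
  have hA : A ∈ hull {A, B} := subset_convexHull ℝ _ (by simp)
  have h1 := inner_nF_hull hF hx hA
  have : x - P = (x - A) - (P - A) := by abel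
  rw [real_inner_comm, this, inner_sub_right, h1, zero_sub]

open Classical in
theorem bary_eq_zero (hT : T ∈ M.tris) (P : T) {x : Plane} (hx : x ∈ hull (T.erase P)) :
    bary hT P x = 0 := by
  obtain ⟨A, B, hAB, hF'⟩ := exists_pair (erase_mem_edges hT P.2)
  have h (Q : Plane) (hQ : Q ∈ T.erase P) : bary hT P Q = 0 :=
    bary_ne hT (Q := ⟨Q, Finset.mem_of_mem_erase hQ⟩) fun h =>
      Finset.ne_of_mem_erase hQ (by rw [h])
  rw [hF', hull_pair] at hx
  exact affine_segment_eq_zero (h A (by rw [hF']; simp)) (h B (by rw [hF']; simp)) hx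

/-- The local degrees of freedom can be prescribed. -/
theorem exists_local_flux (hT : T ∈ M.tris) (hm : m = 0 ∨ m = 1) {g : Finset Plane → Plane → ℝ}
    (hg : ∀ F ∈ M.edges, g F ∈ Poly m) (ξ : Plane) :
    ∃ σ ∈ LocalRT m, (∀ F ∈ M.edgesOf T, ∀ x ∈ hull F, ⟪σ x, M.nF F⟫ = g F x) ∧
      (m = 1 → ∀ ζ, ∫ x in hull T, ⟪σ x, ζ⟫ = ⟪ξ, ζ⟫) := by
  classical
  choose κ hκ0 hκ using fun P : T => exists_height (M := M) hT P.2
  have hsub (P Q : T) (h : Q ≠ P) {x : Plane} (hx : x ∈ hull (T.erase P)) :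
      ⟪x - Q, M.nF (T.erase P)⟫ = 0 := by
    rw [real_inner_comm]
    refine inner_nF_hull (erase_mem_edges hT P.2) hx (subset_convexHull ℝ _ ?_)
    exact Finset.mem_erase.2 ⟨fun h' => h (Subtype.ext h'), Q.2⟩
  -- On the edge opposite to P, x - Q is tangential for the other two vertices Q, which lie on that
  -- edge, while x - P has normal component κ P. The normal trace is therefore the given polynomial.
  let σ₀ : Plane → Plane := fun x => ∑ P : T, ((κ P)⁻¹ • g (T.erase P)) x • (x - P)
  have hσ₀ : σ₀ ∈ LocalRT m := LocalRT.sum_mem _ fun P _ =>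
    LocalRT.smul_sub_mem ((Poly m).smul_mem _ (hg _ (erase_mem_edges hT P.2))) _
  have htr : ∀ F ∈ M.edgesOf T, ∀ x ∈ hull F, ⟪σ₀ x, M.nF F⟫ = g F x := by
    intro F hF x hx
    obtain ⟨P, hP, rfl⟩ := (mem_edgesOf_iff hT).1 hF
    rw [sum_inner, Finset.sum_eq_single (⟨P, hP⟩ : T)]
    · rw [inner_smul_left, hκ ⟨P, hP⟩ x hx]
      simp only [Pi.smul_apply, smul_eq_mul, conj_trivial]
      have := hκ0 ⟨P, hP⟩
      field_simp
    · intro Q _ hQ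
      rw [inner_smul_left, hsub ⟨P, hP⟩ Q hQ hx, mul_zero]
    · simp
  rcases hm with rfl | rfl
  · exact ⟨σ₀, hσ₀, htr, by simp⟩
  · have hint : IntegrableOn σ₀ (hull T) :=
      (LocalRT.continuous hσ₀).continuousOn.integrableOn_compact (isCompact_hull T)
    obtain ⟨β, hβ⟩ := exists_bubble hT (ξ - ∫ x in hull T, σ₀ x)
    refine ⟨fun x => σ₀ x + bubble hT β x, LocalRT.add_mem hσ₀ (bubble_mem hT β),
      fun F hF x hx => ?_, fun _ ζ => ?_⟩
    -- The bubble does not disturb the traces: on the edge opposite to P the barycentric coordinate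
    -- of P is zero and the other terms are tangential.
    · rw [inner_add_left, htr F hF x hx, add_eq_left]
      obtain ⟨P, hP, rfl⟩ := (mem_edgesOf_iff hT).1 hF
      rw [bubble, sum_inner]
      refine Finset.sum_eq_zero fun Q _ => ?_
      rw [inner_smul_left]
      by_cases hQ : Q = ⟨P, hP⟩
      · rw [hQ, bary_eq_zero hT ⟨P, hP⟩ hx]; simp
      · rw [hsub ⟨P, hP⟩ Q hQ hx, mul_zero]
    · have h1 : ∫ x in hull T, ⟪σ₀ x, ζ⟫ = ⟪∫ x in hull T, σ₀ x, ζ⟫ := by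
        rw [real_inner_comm, ← integral_inner hint ζ]
        simp_rw [real_inner_comm ζ]
      simp_rw [inner_add_left]
      rw [integral_add, hβ, h1, inner_sub_left]
      · ring
      · exact ((LocalRT.continuous hσ₀).inner continuous_const).continuousOn.integrableOn_compact
          (isCompact_hull T)
      · exact ((continuous_bubble hT β).inner continuous_const).continuousOn.integrableOn_compact
          (isCompact_hull T)

theorem eq_zero_of_traces (hT : T ∈ M.tris) (hm : m = 0 ∨ m = 1) {σ : Plane → Plane}
    (hσ : σ ∈ LocalRT m) (ht : ∀ F ∈ M.edgesOf T, ∀ x ∈ hull F, ⟪σ x, M.nF F⟫ = 0)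
    (hi : m = 1 → ∀ ζ, ∫ x in hull T, ⟪σ x, ζ⟫ = 0) : σ = 0 := by
  classical
  refine eq_zero_of_vertices hT hm hσ (fun P hP => ?_) hi
  obtain ⟨Q, R, hQR, h⟩ := exists_pair (erase_mem_edges hT hP)
  have hT' : T = {P, Q, R} := by rw [← Finset.insert_erase hP, h]
  have hPQ : P ≠ Q := by
    rintro rfl
    have : P ∈ T.erase P := by rw [h]; simp
    exact absurd rfl (Finset.ne_of_mem_erase this)
  have hPR : P ≠ R := by
    rintro rfl
    have : P ∈ T.erase P := by rw [h]; simp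
    exact absurd rfl (Finset.ne_of_mem_erase this)
  -- At a vertex σ is parallel to each of the two adjacent edges, hence zero.
  have key (S : Plane) (hPS : P ≠ S) (hS : S ∈ T) : cross (S - P) (σ P) = 0 := by
    have hsub : {P, S} ⊆ T := Finset.insert_subset hP (Finset.singleton_subset_iff.2 hS)
    have hF := pair_mem_edges hT hPS hsub
    have h1 := inner_nF hF
    have h2 := ht _ (mem_edgesOf.2 ⟨hF, hsub⟩) P (subset_convexHull ℝ _ (by simp))
    rw [real_inner_comm, inner_eq] at h2
    rw [inner_eq] at h1
    have e0 : M.nF {P, S} 0 * cross (S - P) (σ P) = 0 := by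
      simp only [cross]; linear_combination (σ P) 1 * h1 - (S - P) 1 * h2
    have e1 : M.nF {P, S} 1 * cross (S - P) (σ P) = 0 := by
      simp only [cross]; linear_combination (S - P) 0 * h2 - (σ P) 0 * h1
    by_contra h0
    apply nF_ne_zero hF
    ext j
    fin_cases j
    · simpa [h0] using e0
    · simpa [h0] using e1
  have h1 := key Q hPQ (by rw [hT']; simp)
  have h2 := key R hPR (by rw [hT']; simp)
  have h3 := cross_ne_zero hT hT'
  have e0 : σ P 0 * cross (Q - P) (R - P) = 0 := by
    simp only [cross] at *; linear_combination (R - P) 0 * h1 - (Q - P) 0 * h2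
  have e1 : σ P 1 * cross (Q - P) (R - P) = 0 := by
    simp only [cross] at *; linear_combination (R - P) 1 * h1 - (Q - P) 1 * h2
  ext j
  fin_cases j
  · simpa [h3] using e0
  · simpa [h3] using e1

/-! ### Existence and uniqueness of the flux -/

open Classical in
/-- The prescribed moments of the normal component of the flux on an edge. -/
def edgeMoment (M : CutMesh) (c : Params) (u θ : Broken) (F : Finset Plane) (v : Plane → ℝ) : ℝ :=
  if F ∈ M.fittedEdges then
    lineIntegral (hull F) (fun x => M.fluxΓF c u F * v x)
      - c.γ * c.kΓ * (size F)⁻¹ * lineIntegral (hull F) (fun x => M.jumpΓF u F x * v x)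
  else
    ∑ i : Fin 2, (lineIntegral (hull F ∩ M.side i) (fun x => M.meanFlux c u i F * v x)
      - bF c i F θ v)

theorem bF_eq_zero (hθ : θ ∈ M.Mult) (hF : F ∉ M.edgesI i) (v : Plane → ℝ) :
    bF c i F θ v = 0 := by
  rw [bF, hθ.1 i F hF]
  simp

/-- For the other index the integral is over the empty set and the multiplier is zero on F. -/
theorem edgeMoment_eq (hθ : θ ∈ M.Mult) (hF : F ∈ M.edges) (hΓ : F ∉ M.edgesΓ)
    (hi : F ∈ M.edgesI i) (v : Plane → ℝ) :
    M.edgeMoment c u θ F v =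
      lineIntegral (hull F) (fun x => M.meanFlux c u i F * v x) - bF c i F θ v := by
  obtain ⟨k, hk, -, hne⟩ := exists_hull_subset_side hF hΓ
  have hik : i = k := by
    by_contra h
    obtain ⟨-, x, hx⟩ := mem_edgesI.1 hi
    rw [hne i h] at hx
    exact hx
  subst hik
  rw [edgeMoment, if_neg fun h => notMem_edgesI_of_fitted h i hi, Finset.sum_eq_single i]
  · rw [inter_eq_left.2 hk]
  · intro j _ hj
    rw [hne j hj, bF_eq_zero hθ fun h => ?_]
    · simp [lineIntegral]
    · obtain ⟨-, x, hx⟩ := mem_edgesI.1 h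
      rw [hne j hj] at hx
      exact hx
  · simp

/-- This merges the three cases of the edge conditions into one functional; off Γ the sum over i has
a single active term. -/
theorem edgeDofs_iff (hθ : θ ∈ M.Mult) {σ : Finset Plane → Plane → Plane} :
    M.EdgeDofs c m u θ σ ↔ ∀ F ∈ M.edges, ∀ T ∈ M.trisAt F, ∀ v ∈ Poly m,
      lineIntegral (hull F) (fun x => ⟪σ T x, M.nF F⟫ * v x) = M.edgeMoment c u θ F v := by
  refine forall₂_congr fun F hF => forall₂_congr fun T _ => forall₂_congr fun v _ => ?_
  by_cases hfit : F ∈ M.fittedEdges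
  · have hΓ : F ∈ M.edgesΓ := by
      obtain ⟨P, Q, -, rfl⟩ := exists_pair hF
      have hP : P ∈ hull {P, Q} := subset_convexHull ℝ _ (by simp)
      exact mem_edgesΓ.2 ⟨hF, P, hP, (mem_fittedEdges.1 hfit).2 hP⟩
    simp [edgeMoment, hfit, hΓ]
  · by_cases hΓ : F ∈ M.edgesΓ
    · simp [edgeMoment, hfit, hΓ]
    · obtain ⟨k, -, hkI, -⟩ := exists_hull_subset_side hF hΓ
      constructor
      · intro h
        rw [h.1 k hkI hΓ, edgeMoment_eq hθ hF hΓ hkI]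
      · intro h
        refine ⟨fun i hi _ => ?_, fun h => absurd h hΓ, fun h => absurd h hfit⟩
        rw [h, edgeMoment_eq hθ hF hΓ hi]

theorem continuous_trace (F : Finset Plane) : Continuous (M.trace u i F) := by
  unfold trace
  exact continuous_finsetSum _ fun T _ => (u i T).continuous_of_finiteDimensional

theorem continuous_jumpΓF (F : Finset Plane) : Continuous (M.jumpΓF u F) :=
  (continuous_trace F).sub (continuous_trace F)

theorem bF_add (v w : Plane → ℝ) :
    bF c i F θ (fun x => v x + w x) = bF c i F θ v + bF c i F θ w := by
  simp only [bF, mul_add, Finset.sum_add_distrib]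

theorem bF_mul (r : ℝ) (v : Plane → ℝ) : bF c i F θ (fun x => r * v x) = r * bF c i F θ v := by
  simp only [bF, Finset.mul_sum]
  exact Finset.sum_congr rfl fun N _ => by ring

theorem lineIntegral_hull_add (hF : F ∈ M.edges) {S : Set Plane} (hS : S ⊆ hull F)
    {g g' : Plane → ℝ} (hg : Continuous g) (hg' : Continuous g') :
    lineIntegral S (fun x => g x + g' x) = lineIntegral S g + lineIntegral S g' := by
  obtain ⟨P, Q, -, rfl⟩ := exists_pair hF
  rw [hull_pair] at hS
  exact lineIntegral_add hS hg hg'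

theorem edgeMoment_add (hF : F ∈ M.edges) (v w : Plane → ℝ) (hv : Continuous v)
    (hw : Continuous w) :
    M.edgeMoment c u θ F (fun x => v x + w x) =
      M.edgeMoment c u θ F v + M.edgeMoment c u θ F w := by
  unfold edgeMoment
  split_ifs with h
  · have hj := continuous_jumpΓF (M := M) (u := u) F
    simp only [mul_add]
    rw [lineIntegral_hull_add hF subset_rfl (by fun_prop) (by fun_prop),
      lineIntegral_hull_add hF subset_rfl (by fun_prop) (by fun_prop)]
    ring
  · rw [← Finset.sum_add_distrib]
    refine Finset.sum_congr rfl fun i _ => ?_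
    simp only [mul_add, bF_add]
    rw [lineIntegral_hull_add hF inter_subset_left (by fun_prop) (by fun_prop)]
    ring

theorem edgeMoment_mul (r : ℝ) (v : Plane → ℝ) :
    M.edgeMoment c u θ F (fun x => r * v x) = r * M.edgeMoment c u θ F v := by
  unfold edgeMoment
  split_ifs with h
  · simp only [mul_left_comm _ r, lineIntegral_const_mul]
    ring
  · rw [Finset.mul_sum]
    refine Finset.sum_congr rfl fun i _ => ?_
    simp only [mul_left_comm _ r, lineIntegral_const_mul, bF_mul]
    ring

theorem measurableSet_hull_inter_side (F : Finset Plane) : MeasurableSet (hull F ∩ M.side i) :=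
  (isClosed_hull F).measurableSet.inter
    (isClosed_closure.measurableSet.diff isClosed_Γ.measurableSet)

theorem edgeMoment_congr {v w : Plane → ℝ} (h : ∀ x ∈ hull F, v x = w x) :
    M.edgeMoment c u θ F v = M.edgeMoment c u θ F w := by
  have h1 (g : Plane → ℝ) : lineIntegral (hull F) (fun x => g x * v x) =
      lineIntegral (hull F) (fun x => g x * w x) :=
    setIntegral_congr_fun (isClosed_hull F).measurableSet fun x hx => by simp only [h x hx]
  have h2 (i : Fin 2) (g : Plane → ℝ) : lineIntegral (hull F ∩ M.side i) (fun x => g x * v x) =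
      lineIntegral (hull F ∩ M.side i) (fun x => g x * w x) :=
    setIntegral_congr_fun (measurableSet_hull_inter_side F) fun x hx => by simp only [h x hx.1]
  have h3 (i : Fin 2) : bF c i F θ v = bF c i F θ w := by
    simp only [bF]
    rw [Finset.sum_congr rfl fun N hN => by rw [h N (subset_convexHull ℝ _ hN)]]
  unfold edgeMoment
  simp only [h1, h2, h3]

/-- The prescribed mean of the flux in a triangle, as a functional of vectors. -/
def interiorMoment (M : CutMesh) (c : Params) (u : Broken) (T : Finset Plane) (ζ : Plane) : ℝ :=
  ∑ i : Fin 2, (∫ _ in hull T ∩ M.Ω i, c.k i * ⟪grad (u i T), ζ⟫)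
    - M.interfaceTerm c u T ζ
    + ∑ i : Fin 2, ∑ F ∈ M.edgesOf T ∩ M.ghostEdges i,
        c.γg * c.k i * size F * lineIntegral (hull F) fun _ =>
          M.jump F (fun T' => ⟪grad (u i T'), M.nF F⟫) * (M.sgn T F * ⟪ζ, M.nF F⟫)

/-- The moment is linear in ζ, hence represented by a vector, which `exists_local_flux` takes as the
prescribed mean. -/
theorem exists_interiorMoment (M : CutMesh) (c : Params) (u : Broken) (T : Finset Plane) :
    ∃ ξ : Plane, ∀ ζ, M.interiorMoment c u T ζ = ⟪ξ, ζ⟫ := by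
  classical
  have hmean (n ζ : Plane) : M.meanΓ c T ζ n =
      ⟪(∑ i : Fin 2, if T ∈ M.trisI i then c.ω i * c.k i else 0) • n, ζ⟫ := by
    rw [inner_smul_left, conj_trivial, Finset.sum_mul, meanΓ]
    refine Finset.sum_congr rfl fun i _ => ?_
    split_ifs
    · rw [real_inner_comm]; ring
    · simp
  have h1 : ∃ ξ : Plane, ∀ ζ, M.interfaceTerm c u T ζ = ⟪ξ, ζ⟫ := by
    by_cases hT : T ∈ M.cutTris
    · refine ⟨lineIntegral (hull T ∩ M.Γ) (jumpΓ u T) •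
        (∑ i : Fin 2, if T ∈ M.trisI i then c.ω i * c.k i else 0) • M.nΓ T, fun ζ => ?_⟩
      rw [interfaceTerm, if_pos hT, lineIntegral_const_mul, hmean, mul_comm, ← real_inner_smul_left]
    · refine ⟨∑ F ∈ M.edgesOf T ∩ M.fittedEdges, lineIntegral (hull F) (M.jumpΓF u F) •
        (∑ i : Fin 2, if T ∈ M.trisI i then c.ω i * c.k i else 0) • M.nF F, fun ζ => ?_⟩
      rw [interfaceTerm, if_neg hT, sum_inner]
      refine Finset.sum_congr rfl fun F _ => ?_
      rw [lineIntegral_const_mul, hmean, mul_comm, ← real_inner_smul_left]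
  obtain ⟨ξ, hξ⟩ := h1
  refine ⟨(∑ i : Fin 2, (∫ _ in hull T ∩ M.Ω i, (1 : ℝ)) • c.k i • grad (u i T)) - ξ +
    ∑ i : Fin 2, ∑ F ∈ M.edgesOf T ∩ M.ghostEdges i,
      (c.γg * c.k i * size F * lineIntegral (hull F) (fun _ =>
        M.jump F (fun T' => ⟪grad (u i T'), M.nF F⟫) * M.sgn T F)) • M.nF F, fun ζ => ?_⟩
  simp only [interiorMoment, inner_add_left, inner_sub_left, sum_inner, inner_smul_left,
    conj_trivial, hξ]
  congr 1
  · congr 1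
    refine Finset.sum_congr rfl fun i _ => ?_
    rw [← integral_mul_const]
    simp
  · refine Finset.sum_congr rfl fun i _ => Finset.sum_congr rfl fun F _ => ?_
    have : (fun _ : Plane => M.jump F (fun T' => ⟪grad (u i T'), M.nF F⟫) *
        (M.sgn T F * ⟪ζ, M.nF F⟫)) = fun _ => ⟪ζ, M.nF F⟫ *
        (M.jump F (fun T' => ⟪grad (u i T'), M.nF F⟫) * M.sgn T F) := by
      ext; ring
    rw [this, lineIntegral_const_mul, real_inner_comm]
    ring

theorem exists_flux (hm : m = 0 ∨ m = 1) (hθ : θ ∈ M.Mult) : ∃ σ, M.IsFlux c m u θ σ := by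
  classical
  have hg (F : Finset Plane) : ∃ g : Plane → ℝ, F ∈ M.edges → g ∈ Poly m ∧ ∀ v ∈ Poly m,
      lineIntegral (hull F) (fun x => g x * v x) = M.edgeMoment c u θ F v := by
    by_cases hF : F ∈ M.edges
    · obtain ⟨g, hg, hg'⟩ := exists_moments hF hm (ℓ := M.edgeMoment c u θ F)
        (edgeMoment_add hF) edgeMoment_mul fun v w h => edgeMoment_congr h
      exact ⟨g, fun _ => ⟨hg, hg'⟩⟩
    · exact ⟨0, fun h => absurd h hF⟩
  choose g hg using hg
  have hσ (T : Finset Plane) : ∃ σ : Plane → Plane, (T ∈ M.tris → σ ∈ LocalRT m ∧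
      (∀ F ∈ M.edgesOf T, ∀ x ∈ hull F, ⟪σ x, M.nF F⟫ = g F x) ∧
      (m = 1 → ∀ ζ, ∫ x in hull T, ⟪σ x, ζ⟫ = M.interiorMoment c u T ζ)) ∧
      (T ∉ M.tris → σ = 0) := by
    by_cases hT : T ∈ M.tris
    · obtain ⟨ξ, hξ⟩ := exists_interiorMoment M c u T
      obtain ⟨σ, h1, h2, h3⟩ := exists_local_flux hT hm (fun F hF => (hg F hF).1) ξ
      exact ⟨σ, fun _ => ⟨h1, h2, fun h ζ => by rw [h3 h, hξ]⟩, fun h => absurd hT h⟩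
    · exact ⟨0, fun h => absurd h hT, fun _ => rfl⟩
  choose σ hσ hσ0 using hσ
  have htr (F : Finset Plane) (hF : F ∈ M.edges) (T : Finset Plane) (hT : T ∈ M.trisAt F) :
      ∀ x ∈ hull F, ⟪σ T x, M.nF F⟫ = g F x :=
    (hσ T (mem_trisAt.1 hT).1).2.1 F (mem_edgesOf.2 ⟨hF, (mem_trisAt.1 hT).2⟩)
  refine ⟨σ, ⟨fun T hT => (hσ T hT).1, hσ0, fun F hF T hT T' hT' x hx => ?_⟩,
    (edgeDofs_iff hθ).2 fun F hF T hT v hv => ?_, fun h T hT ζ => (hσ T hT).2.2 h ζ⟩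
  · rw [htr F hF T hT x hx, htr F hF T' hT' x hx]
  · rw [← (hg F hF).2 v hv]
    exact setIntegral_congr_fun (isClosed_hull F).measurableSet fun x hx => by
      simp only [htr F hF T hT x hx]

theorem flux_unique (hm : m = 0 ∨ m = 1) (hθ : θ ∈ M.Mult) {σ τ : Finset Plane → Plane → Plane}
    (hσ : M.IsFlux c m u θ σ) (hτ : M.IsFlux c m u θ τ) : σ = τ := by
  ext1 T
  by_cases hT : T ∈ M.tris
  swap
  · rw [hσ.1.2.1 T hT, hτ.1.2.1 T hT]
  have hσT := hσ.1.1 T hT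
  have hτT := hτ.1.1 T hT
  have hc1 := LocalRT.continuous hσT
  have hc2 := LocalRT.continuous hτT
  have h : (fun x => σ T x - τ T x) = 0 := by
    refine eq_zero_of_traces hT hm (LocalRT.sub_mem hσT hτT) (fun F hF => ?_) fun hm1 ζ => ?_
    · obtain ⟨hFe, hFT⟩ := mem_edgesOf.1 hF
      have hTF := mem_trisAt.2 ⟨hT, hFT⟩
      obtain ⟨P, Q, hPQ, hF'⟩ := exists_pair hFe
      have hP : P ∈ hull F := subset_convexHull ℝ _ (by rw [hF']; simp)
      obtain ⟨w, hw, htr⟩ := LocalRT.exists_trace (LocalRT.sub_mem hσT hτT) (M.nF F) P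
      have htr' : ∀ x ∈ hull F, ⟪σ T x - τ T x, M.nF F⟫ = w x := fun x hx =>
        htr x (inner_nF_hull hFe hx hP)
      have hwc := continuous_of_mem_Poly hw
      -- The normal trace w of the difference is itself an admissible test polynomial, so its square
      -- has integral zero.
      have hz := eq_zero_of_moments hFe (w := w) (Poly_mono (by omega) hw) ?_
      · intro x hx
        rw [htr' x hx, hz x hx]
      · have h1 := (edgeDofs_iff hθ).1 hσ.2.1 F hFe T hTF w hw
        have h2 := (edgeDofs_iff hθ).1 hτ.2.1 F hFe T hTF w hw
        have h3 : lineIntegral (hull F) (fun x => w x * w x) =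
            lineIntegral (hull F) (fun x => ⟪σ T x, M.nF F⟫ * w x + -1 * (⟪τ T x, M.nF F⟫ * w x)) :=
          setIntegral_congr_fun (isClosed_hull F).measurableSet fun x hx => by
            rw [← htr' x hx, inner_sub_left]
            ring
        rw [h3, lineIntegral_hull_add hFe subset_rfl (by fun_prop) (by fun_prop),
          lineIntegral_const_mul, h1, h2]
        ring
    · have h1 := hσ.2.2 hm1 T hT ζ
      have h2 := hτ.2.2 hm1 T hT ζ
      simp_rw [inner_sub_left]
      rw [integral_sub, h1, h2, sub_self]
      · exact (hc1.inner continuous_const).continuousOn.integrableOn_compact (isCompact_hull T)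
      · exact (hc2.inner continuous_const).continuousOn.integrableOn_compact (isCompact_hull T)
  ext1 x
  exact sub_eq_zero.1 (congrFun h x)

end CutMesh

/-! ### Divergence of Raviart-Thomas fields -/

theorem contDiff_of_mem_Poly {m : ℕ} {p : Plane → ℝ} (hp : p ∈ Poly m) : ContDiff ℝ 1 p := by
  induction hp using Submodule.span_induction with
  | mem p hp => obtain ⟨a, b, -, rfl⟩ := hp; fun_prop
  | zero => exact contDiff_const
  | add p q _ _ hp hq => exact hp.add hq
  | smul t p _ hp => exact contDiff_const.smul hp

theorem divergence_eq_sum {τ : Plane → Plane} {x : Plane} (hτ : DifferentiableAt ℝ τ x) :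
    divergence τ x = ∑ j : Fin 2, fderiv ℝ (fun y => τ y j) x (EuclideanSpace.single j 1) := by
  refine Finset.sum_congr rfl fun j _ => ?_
  have h := (EuclideanSpace.proj (𝕜 := ℝ) j : Plane →L[ℝ] ℝ).hasFDerivAt.comp x hτ.hasFDerivAt
  have h' : HasFDerivAt (fun y => τ y j)
      ((EuclideanSpace.proj j : Plane →L[ℝ] ℝ).comp (fderiv ℝ τ x)) x := h
  rw [h'.fderiv]
  rfl

namespace LocalRT

variable {m : ℕ} {σ : Plane → Plane}

theorem contDiff (hσ : σ ∈ LocalRT m) : ContDiff ℝ 1 σ := by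
  obtain ⟨a, b, ha, hb, rfl⟩ := hσ
  rw [contDiff_euclidean]
  intro j
  have h1 := contDiff_of_mem_Poly (ha j)
  have h2 := contDiff_of_mem_Poly hb
  have h3 : ContDiff ℝ 1 fun x : Plane => x j := by fun_prop
  exact h1.add (h2.mul h3)

theorem divergence_mem (hm : m = 0 ∨ m = 1) (hσ : σ ∈ LocalRT m) : divergence σ ∈ Poly m := by
  obtain ⟨r, α, β, hβ, h⟩ := exists_decomp hm hσ
  -- The radial part ⟪β, x⟫ x has divergence ⟪β, x⟫ + 2⟪β, x⟫, with 2 the dimension.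
  have hd : divergence σ = fun x => (α 0 0 + α 1 1) + ⟪(3 : ℝ) • β, x⟫ := by
    ext x
    rw [divergence_eq_sum ((contDiff hσ).differentiable one_ne_zero x)]
    have hj (j : Fin 2) : fderiv ℝ (fun y => σ y j) x (EuclideanSpace.single j 1) =
        α j j + (β j * x j + ⟪β, x⟫) := by
      simp_rw [h]
      have e1 (γ : Plane) : HasFDerivAt (fun y : Plane => ⟪γ, y⟫) (innerSL ℝ γ) x :=
        (innerSL ℝ γ).hasFDerivAt
      have e2 : HasFDerivAt (fun y : Plane => y j) (EuclideanSpace.proj j : Plane →L[ℝ] ℝ) x :=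
        (EuclideanSpace.proj j : Plane →L[ℝ] ℝ).hasFDerivAt
      have e3 := ((e1 (α j)).const_add (r j)).add ((e1 β).mul e2)
      have e4 : HasFDerivAt (fun y : Plane => r j + ⟪α j, y⟫ + ⟪β, y⟫ * y j) _ x := e3
      rw [e4.fderiv]
      simp [EuclideanSpace.inner_single_right]
      ring
    rw [Fin.sum_univ_two, hj, hj, inner_smul_left, conj_trivial, inner_eq]
    ring
  rw [hd]
  rcases hm with rfl | rfl
  · rw [hβ rfl]
    simpa using const_mem_Poly 0 (α 0 0 + α 1 1)
  · exact mem_Poly_one.2 ⟨_, _, rfl⟩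

end LocalRT

theorem hasFDerivAt_affine (g : Plane →ᵃ[ℝ] ℝ) (x : Plane) :
    HasFDerivAt g (innerSL ℝ (grad g)) x := by
  have h : (g : Plane → ℝ) = fun y => g 0 + innerSL ℝ (grad g) y := by
    ext y; rw [affine_eq g y]; rfl
  rw [h]
  exact (innerSL ℝ (grad g)).hasFDerivAt.const_add _

theorem divergence_smul (g : Plane →ᵃ[ℝ] ℝ) {σ : Plane → Plane} {x : Plane}
    (hσ : DifferentiableAt ℝ σ x) :
    divergence (fun y => g y • σ y) x = divergence σ x * g x + ⟪σ x, grad g⟫ := by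
  have h := (hasFDerivAt_affine g x).smul hσ.hasFDerivAt
  have h' : HasFDerivAt (fun y => g y • σ y) _ x := h
  simp only [divergence, h'.fderiv, Fin.sum_univ_two, inner_eq]
  simp [EuclideanSpace.inner_single_right]
  ring

namespace CutMesh

variable {M : CutMesh} {c : Params} {F T T' : Finset Plane} {i j : Fin 2} {u v θ : Broken}
  {f : Plane → ℝ} {m : ℕ}

/-! ### The Green formula on a triangle of the mesh -/

theorem sgn_mul_lineIntegral {P Q R : Plane} (hF : {P, Q} ∈ M.edges) (hT : {P, Q, R} ∈ M.tris)
    (τ : Plane → Plane) :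
    M.sgn {P, Q, R} {P, Q} * lineIntegral (hull {P, Q}) (fun x => ⟪τ x, M.nF {P, Q}⟫) =
      cross (Q - P) (R - P) / |cross (Q - P) (R - P)| *
        segMean P Q fun x => ⟪τ x, rot (Q - P)⟫ := by
  have hD := cross_ne_zero hT rfl
  have hPQ : P ≠ Q := by
    rintro rfl
    simp [cross] at hD
  have h := outward_normal hD (M.norm_nF _ hF) (inner_nF hF) _ (sgn_eq (R := R) hF)
  rw [hull_pair, lineIntegral_segment hPQ, ← mul_assoc, segMean,
    ← intervalIntegral.integral_const_mul, ← intervalIntegral.integral_const_mul]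
  simp_rw [← real_inner_smul_right, h]

open Classical in
theorem edgesOf_triple {A B C : Plane} (hT : {A, B, C} ∈ M.tris) (hAB : A ≠ B) (hAC : A ≠ C)
    (hBC : B ≠ C) : M.edgesOf {A, B, C} = {{B, C}, {C, A}, {A, B}} := by
  have e1 : ({A, B, C} : Finset Plane).erase A = {B, C} := by
    ext x; simp only [Finset.mem_erase, Finset.mem_insert, Finset.mem_singleton]
    constructor
    · tauto
    · rintro (rfl | rfl) <;> tauto
  have e2 : ({A, B, C} : Finset Plane).erase B = {C, A} := by
    ext x; simp only [Finset.mem_erase, Finset.mem_insert, Finset.mem_singleton]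
    constructor
    · tauto
    · rintro (rfl | rfl) <;> tauto
  have e3 : ({A, B, C} : Finset Plane).erase C = {A, B} := by
    ext x; simp only [Finset.mem_erase, Finset.mem_insert, Finset.mem_singleton]
    constructor
    · tauto
    · rintro (rfl | rfl) <;> tauto
  ext F
  rw [mem_edgesOf_iff hT]
  simp only [Finset.mem_insert, Finset.mem_singleton, exists_eq_or_imp, exists_eq_left, e1, e2, e3]

/-- The Green formula on a triangle of the mesh. -/
theorem setIntegral_divergence_eq (hT : T ∈ M.tris) {τ : Plane → Plane} (hτ : ContDiff ℝ 1 τ) :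
    ∫ x in hull T, divergence τ x =
      ∑ F ∈ M.edgesOf T, M.sgn T F * lineIntegral (hull F) fun x => ⟪τ x, M.nF F⟫ := by
  classical
  obtain ⟨A, B, C, hAB, hAC, hBC, h⟩ := Finset.card_eq_three.1 (mem_tris.1 hT).2
  have h1 : T = {A, B, C} := by rw [h]
  subst h1
  have r1 : ({A, B, C} : Finset Plane) = {B, C, A} := by
    ext; simp only [Finset.mem_insert, Finset.mem_singleton]; tauto
  have r2 : ({A, B, C} : Finset Plane) = {C, A, B} := by
    ext; simp only [Finset.mem_insert, Finset.mem_singleton]; tauto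
  have hmem (F : Finset Plane) (hF : F ∈ M.edgesOf {A, B, C}) : F ∈ M.edges :=
    (mem_edgesOf.1 hF).1
  have hE := edgesOf_triple hT hAB hAC hBC
  rw [hE] at hmem
  have hF1 := hmem {B, C} (by simp)
  have hF2 := hmem {C, A} (by simp)
  have hF3 := hmem {A, B} (by simp)
  have n12 : ({B, C} : Finset Plane) ≠ {C, A} := by
    intro h
    have : B ∈ ({C, A} : Finset Plane) := by rw [← h]; simp
    simp only [Finset.mem_insert, Finset.mem_singleton] at this
    tauto
  have n13 : ({B, C} : Finset Plane) ≠ {A, B} := by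
    intro h
    have : C ∈ ({A, B} : Finset Plane) := by rw [← h]; simp
    simp only [Finset.mem_insert, Finset.mem_singleton] at this
    tauto
  have n23 : ({C, A} : Finset Plane) ≠ {A, B} := by
    intro h
    have : C ∈ ({A, B} : Finset Plane) := by rw [← h]; simp
    simp only [Finset.mem_insert, Finset.mem_singleton] at this
    tauto
  have g1 := sgn_mul_lineIntegral hF1 (r1 ▸ hT) τ
  have g2 := sgn_mul_lineIntegral hF2 (r2 ▸ hT) τ
  have g3 := sgn_mul_lineIntegral hF3 hT τ
  rw [← r1] at g1
  rw [← r2] at g2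
  have c1 : cross (C - B) (A - B) = cross (B - A) (C - A) := by simp [cross]; ring
  have c2 : cross (A - C) (B - C) = cross (B - A) (C - A) := by simp [cross]; ring
  rw [c1] at g1
  rw [c2] at g2
  rw [hE, Finset.sum_insert (by simp [n12, n13]), Finset.sum_pair n23, g1, g2, g3,
    setIntegral_divergence (cross_ne_zero hT rfl) hτ]
  ring

/-! ### The equation for a test function supported in one triangle -/

open Classical in
/-- The function that equals the affine function `g` on the triangle `T`, and zero elsewhere. -/
def testFn (M : CutMesh) (T : Finset Plane) (g : Plane →ᵃ[ℝ] ℝ) : Broken :=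
  fun i T' => if T' = T ∧ T ∈ M.trisI i then g else 0

theorem testFn_mem (T : Finset Plane) (g : Plane →ᵃ[ℝ] ℝ) : M.testFn T g ∈ M.D := by
  intro i T' hT'
  refine if_neg fun h => hT' ?_
  rw [h.1]
  exact h.2

theorem testFn_self {g : Plane →ᵃ[ℝ] ℝ} (h : T ∈ M.trisI i) : M.testFn T g i T = g :=
  if_pos ⟨rfl, h⟩

theorem testFn_ne {g : Plane →ᵃ[ℝ] ℝ} (h : T' ≠ T) : M.testFn T g i T' = 0 :=
  if_neg fun h' => h h'.1

theorem testFn_notMem {g : Plane →ᵃ[ℝ] ℝ} (h : T ∉ M.trisI i) : M.testFn T g i T' = 0 :=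
  if_neg fun h' => h h'.2

theorem grad_zero : grad 0 = 0 := by
  ext j; simp [grad]

open Classical in
-- The functional φ is point evaluation in d_h and b_h, and the normal derivative in the ghost
-- penalty.
theorem jump_testFn (hT : T ∈ M.tris) (hF : F ∈ M.edgesI i) (g : Plane →ᵃ[ℝ] ℝ)
    {φ : (Plane →ᵃ[ℝ] ℝ) → ℝ} (hφ : φ 0 = 0) :
    M.jump F (fun T' => φ (M.testFn T g i T')) =
      if F ∈ M.edgesOf T then M.sgn T F * φ g else 0 := by
  have hFe := edgesI_subset hF
  split_ifs with h
  · have hTF := mem_trisAt.2 ⟨hT, (mem_edgesOf.1 h).2⟩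
    rw [jump, Finset.sum_eq_single T, testFn_self (trisAt_subset_trisI hF hTF)]
    · intro T' _ hne
      rw [testFn_ne hne, hφ, mul_zero]
    · exact fun h' => absurd hTF h'
  · refine Finset.sum_eq_zero fun T' hT' => ?_
    dsimp only
    rw [testFn_ne, hφ, mul_zero]
    rintro rfl
    exact h (mem_edgesOf.2 ⟨hFe, (mem_trisAt.1 hT').2⟩)

theorem sum_setIntegral_testFn (hT : T ∈ M.tris) (g : Plane →ᵃ[ℝ] ℝ)
    (φ : Finset Plane → Plane → (Plane →ᵃ[ℝ] ℝ) → ℝ) (hφ : ∀ T x, φ T x 0 = 0) :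
    ∑ T' ∈ M.trisI i, ∫ x in hull T' ∩ M.Ω i, φ T' x (M.testFn T g i T') =
      ∫ x in hull T ∩ M.Ω i, φ T x g := by
  by_cases h : T ∈ M.trisI i
  · rw [Finset.sum_eq_single T, testFn_self h]
    · intro T' _ hne
      rw [testFn_ne hne]
      simp [hφ]
    · exact fun h' => absurd h h'
  · have he : hull T ∩ M.Ω i = ∅ := by
      rw [← Set.not_nonempty_iff_eq_empty]
      exact fun h' => h (mem_trisI.2 ⟨hT, h'⟩)
    rw [he, Measure.restrict_empty, integral_zero_measure]
    refine Finset.sum_eq_zero fun T' _ => ?_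
    rw [testFn_notMem h]
    simp [hφ]

open Classical in
theorem sum_trace_testFn (hT : T ∈ M.tris) (hF : F ∈ M.fittedEdges) (g : Plane →ᵃ[ℝ] ℝ)
    {φ : (Plane →ᵃ[ℝ] ℝ) → ℝ} (hφ : φ 0 = 0) :
    ∑ T' ∈ M.trisAt F ∩ M.trisI i, φ (M.testFn T g i T') =
      if F ∈ M.edgesOf T then (if T ∈ M.trisI i then φ g else 0) else 0 := by
  have hFe := (mem_fittedEdges.1 hF).1
  split_ifs with h1 h2
  · have hTF := mem_trisAt.2 ⟨hT, (mem_edgesOf.1 h1).2⟩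
    rw [Finset.sum_eq_single T, testFn_self h2]
    · intro T' _ hne
      rw [testFn_ne hne, hφ]
    · exact fun h' => absurd (Finset.mem_inter.2 ⟨hTF, h2⟩) h'
  · refine Finset.sum_eq_zero fun T' _ => ?_
    rw [testFn_notMem h2, hφ]
  · refine Finset.sum_eq_zero fun T' hT' => ?_
    rw [testFn_ne, hφ]
    rintro rfl
    exact h1 (mem_edgesOf.2 ⟨hFe, (mem_trisAt.1 (Finset.mem_inter.1 hT').1).2⟩)

open Classical in
/-- The interface terms of `a_h` for a test function supported in one triangle. -/
theorem interface_testFn (hT : T ∈ M.tris) (g : Plane →ᵃ[ℝ] ℝ) :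
    (∑ T' ∈ M.cutTris, lineIntegral (hull T' ∩ M.Γ) fun x =>
      c.γ * c.kΓ / size T' * jumpΓ u T' x * jumpΓ (M.testFn T g) T' x
        - M.fluxΓ c u T' * jumpΓ (M.testFn T g) T' x
        - M.fluxΓ c (M.testFn T g) T' * jumpΓ u T' x) +
    (∑ F ∈ M.fittedEdges, lineIntegral (hull F) fun x =>
      c.γ * c.kΓ / size F * M.jumpΓF u F x * M.jumpΓF (M.testFn T g) F x
        - M.fluxΓF c u F * M.jumpΓF (M.testFn T g) F x
        - M.fluxΓF c (M.testFn T g) F * M.jumpΓF u F x) =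
    -M.interfaceTerm c u T (grad g) -
      ∑ F ∈ M.edgesOf T with F ∈ M.fittedEdges, M.sgn T F * M.edgeMoment c u θ F g := by
  -- Both components of the test function are g on a cut triangle, so only the term with its flux
  -- and the jump of u survives.
  have hcut : (∑ T' ∈ M.cutTris, lineIntegral (hull T' ∩ M.Γ) fun x =>
      c.γ * c.kΓ / size T' * jumpΓ u T' x * jumpΓ (M.testFn T g) T' x
        - M.fluxΓ c u T' * jumpΓ (M.testFn T g) T' x
        - M.fluxΓ c (M.testFn T g) T' * jumpΓ u T' x) =
      if T ∈ M.cutTris then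
        -lineIntegral (hull T ∩ M.Γ) fun x => M.meanΓ c T (grad g) (M.nΓ T) * jumpΓ u T x
      else 0 := by
    have hne (T' : Finset Plane) (h : T' ≠ T) : lineIntegral (hull T' ∩ M.Γ) (fun x =>
        c.γ * c.kΓ / size T' * jumpΓ u T' x * jumpΓ (M.testFn T g) T' x
        - M.fluxΓ c u T' * jumpΓ (M.testFn T g) T' x
        - M.fluxΓ c (M.testFn T g) T' * jumpΓ u T' x) = 0 := by
      simp [jumpΓ, fluxΓ, testFn_ne h, grad_zero, lineIntegral]
    split_ifs with h
    · rw [Finset.sum_eq_single T (fun T' _ h' => hne T' h') fun h' => absurd h h',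
        ← neg_one_mul, ← lineIntegral_const_mul]
      have hi := (mem_cutTris.1 h).2
      congr 1
      ext x
      simp only [jumpΓ, fluxΓ, meanΓ, testFn_self (hi _), if_pos (hi _)]
      ring
    · exact Finset.sum_eq_zero fun T' hT' => hne T' fun h' => h (h' ▸ hT')
  have hfit (F : Finset Plane) (hF : F ∈ M.fittedEdges) : (lineIntegral (hull F) fun x =>
      c.γ * c.kΓ / size F * M.jumpΓF u F x * M.jumpΓF (M.testFn T g) F x
        - M.fluxΓF c u F * M.jumpΓF (M.testFn T g) F x
        - M.fluxΓF c (M.testFn T g) F * M.jumpΓF u F x) =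
      if F ∈ M.edgesOf T then
        -lineIntegral (hull F) (fun x => M.meanΓ c T (grad g) (M.nF F) * M.jumpΓF u F x)
          - M.sgn T F * M.edgeMoment c u θ F g
      else 0 := by
    have htr (i : Fin 2) (x : Plane) := sum_trace_testFn (i := i) hT hF g (φ := fun h => h x) rfl
    have htn (i : Fin 2) := sum_trace_testFn (i := i) hT hF g (φ := fun h => ⟪grad h, M.nF F⟫)
      (by simp [grad_zero])
    have hFe := (mem_fittedEdges.1 hF).1
    split_ifs with h
    · have hs := sgn_of_fitted hF (mem_trisAt.2 ⟨hT, (mem_edgesOf.1 h).2⟩)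
      have hjump (x : Plane) : M.jumpΓF (M.testFn T g) F x = M.sgn T F * g x := by
        rw [jumpΓF, trace, trace, htr, htr, if_pos h, if_pos h, hs]
        split_ifs <;> ring
      have hflux : M.fluxΓF c (M.testFn T g) F = M.meanΓ c T (grad g) (M.nF F) := by
        simp only [fluxΓF, traceNormal, htn, if_pos h, meanΓ]
        refine Finset.sum_congr rfl fun i _ => ?_
        split_ifs <;> ring
      have hg : Continuous g := g.continuous_of_finiteDimensional
      have hj := continuous_jumpΓF (M := M) (u := u) F
      simp only [hjump, hflux, edgeMoment, if_pos hF]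
      have e : (fun x => c.γ * c.kΓ / size F * M.jumpΓF u F x * (M.sgn T F * g x)
          - M.fluxΓF c u F * (M.sgn T F * g x)
          - M.meanΓ c T (grad g) (M.nF F) * M.jumpΓF u F x) = fun x =>
          ((M.sgn T F * (c.γ * c.kΓ * (size F)⁻¹)) * (M.jumpΓF u F x * g x) +
            (-M.sgn T F) * (M.fluxΓF c u F * g x)) +
            (-1) * (M.meanΓ c T (grad g) (M.nF F) * M.jumpΓF u F x) := by
        ext x; ring
      rw [e, lineIntegral_hull_add hFe subset_rfl (by fun_prop) (by fun_prop),
        lineIntegral_hull_add hFe subset_rfl (by fun_prop) (by fun_prop),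
        lineIntegral_const_mul _ (M.sgn T F * _), lineIntegral_const_mul _ (-M.sgn T F),
        lineIntegral_const_mul _ (-1)]
      ring
    · simp only [jumpΓF, trace, fluxΓF, traceNormal, htr, htn, if_neg h]
      simp [lineIntegral]
  rw [hcut, Finset.sum_congr rfl hfit, ← Finset.sum_filter,
    Finset.filter_mem_eq_inter, Finset.filter_mem_eq_inter, Finset.sum_sub_distrib,
    Finset.sum_neg_distrib, interfaceTerm, Finset.inter_comm M.fittedEdges]
  split_ifs with h
  -- A cut triangle has no edge in Γ, so the two kinds of interface pieces never occur together in
  -- T.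
  · have he : M.edgesOf T ∩ M.fittedEdges = ∅ := by
      refine Finset.eq_empty_of_forall_notMem fun F hF => ?_
      obtain ⟨h1, h2⟩ := Finset.mem_inter.1 hF
      have hi := (mem_cutTris.1 h).2
      exact absurd (eq_of_mem_trisI_of_fitted h2 (mem_edgesOf.1 h1).2 (hi 0) (hi 1)) (by decide)
    rw [he]
    simp
  · ring

open Classical in
/-- The form `a_h` for a test function supported in one triangle. -/
theorem a_testFn (hT : T ∈ M.tris) (g : Plane →ᵃ[ℝ] ℝ) :
    M.a c u (M.testFn T g) = M.interiorMoment c u T (grad g) -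
      ∑ F ∈ M.edgesOf T,
        if F ∈ M.fittedEdges then M.sgn T F * M.edgeMoment c u θ F g else 0 := by
  have h1 (i : Fin 2) : ∑ T' ∈ M.trisI i, (∫ _ in hull T' ∩ M.Ω i,
      c.k i * ⟪grad (u i T'), grad (M.testFn T g i T')⟫) =
      ∫ _ in hull T ∩ M.Ω i, c.k i * ⟪grad (u i T), grad g⟫ :=
    sum_setIntegral_testFn hT g
      (fun T' _ h => c.k i * ⟪grad (u i T'), grad h⟫) (by simp [grad_zero])
  have h2 (i : Fin 2) : ∑ F ∈ M.ghostEdges i, c.γg * size F * lineIntegral (hull F) (fun _ =>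
      c.k i * M.jump F (fun T => ⟪grad (u i T), M.nF F⟫) *
        M.jump F (fun T' => ⟪grad (M.testFn T g i T'), M.nF F⟫)) =
      ∑ F ∈ M.edgesOf T ∩ M.ghostEdges i,
        c.γg * c.k i * size F * lineIntegral (hull F) fun _ =>
          M.jump F (fun T' => ⟪grad (u i T'), M.nF F⟫) * (M.sgn T F * ⟪grad g, M.nF F⟫) := by
    rw [Finset.inter_comm, ← Finset.filter_mem_eq_inter, Finset.sum_filter]
    refine Finset.sum_congr rfl fun F hF => ?_
    have hFI : F ∈ M.edgesI i := (Finset.mem_filter.1 hF).1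
    rw [jump_testFn hT hFI g (φ := fun h => ⟪grad h, M.nF F⟫) (by simp [grad_zero])]
    split_ifs with h
    · rw [← lineIntegral_const_mul, ← lineIntegral_const_mul]
      congr 1
      ext
      ring
    · simp [lineIntegral]
  -- On edges contained in Γ the edge moment does not involve θ, so any multiplier may be inserted.
  have h3 := interface_testFn (c := c) (u := u) (θ := θ) hT g
  rw [Finset.sum_filter] at h3
  rw [a, add_assoc, h3]
  simp only [h1, h2, interiorMoment]
  ring

open Classical in
/-- The consistency terms for a test function supported in one triangle. -/
theorem d_sub_b_testFn (hT : T ∈ M.tris) (hθ : θ ∈ M.Mult)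
    (hu : ∀ i, ∀ F ∈ M.edgesI i, ∀ x ∈ hull F, M.jump F (fun T => u i T x) = 0)
    (g : Plane →ᵃ[ℝ] ℝ) :
    M.d c u (M.testFn T g) - M.b c θ (M.testFn T g) =
      ∑ F ∈ M.edgesOf T,
        if F ∈ M.fittedEdges then 0 else M.sgn T F * M.edgeMoment c u θ F g := by
  have hterm (i : Fin 2) (F : Finset Plane) (hF : F ∈ M.edgesI i) :
      (lineIntegral (hull F ∩ M.side i) fun x =>
        M.meanFlux c u i F * M.jump F (fun T' => M.testFn T g i T' x)
          + M.meanFlux c (M.testFn T g) i F * M.jump F (fun T => u i T x)) -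
        (bF c i F θ fun x => M.jump F fun T' => M.testFn T g i T' x) =
      if F ∈ M.edgesOf T then M.sgn T F *
        (lineIntegral (hull F ∩ M.side i) (fun x => M.meanFlux c u i F * g x) - bF c i F θ g)
      else 0 := by
    have hj (x : Plane) := jump_testFn hT hF g (φ := fun h => h x) rfl
    have e1 : (lineIntegral (hull F ∩ M.side i) fun x =>
        M.meanFlux c u i F * M.jump F (fun T' => M.testFn T g i T' x)
          + M.meanFlux c (M.testFn T g) i F * M.jump F (fun T => u i T x)) =
        lineIntegral (hull F ∩ M.side i) fun x =>
          M.meanFlux c u i F * if F ∈ M.edgesOf T then M.sgn T F * g x else 0 := by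
      refine setIntegral_congr_fun (measurableSet_hull_inter_side F) fun x hx => ?_
      -- The symmetric term of d_h vanishes because u has no jump on the edges of F_h^i.
      simp only [hj x, hu i F hF x hx.1]
      ring
    rw [e1]
    simp only [hj]
    split_ifs with h
    · rw [bF_mul, mul_sub, ← lineIntegral_const_mul]
      simp only [mul_left_comm]
    · simp [lineIntegral, bF]
  -- Edges of T outside F_h^i contribute zero, so the sum can be taken over all edges of T for both
  -- indices.
  have hside (F : Finset Plane) (i : Fin 2) (hF : F ∈ M.edges) (h : F ∉ M.edgesI i) :
      lineIntegral (hull F ∩ M.side i) (fun x => M.meanFlux c u i F * g x) - bF c i F θ g = 0 := by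
    have he : hull F ∩ M.side i = ∅ := by
      rw [← Set.not_nonempty_iff_eq_empty]
      exact fun h' => h (mem_edgesI.2 ⟨hF, h'⟩)
    rw [he, bF_eq_zero hθ h]
    simp [lineIntegral]
  rw [d, b, ← Finset.sum_sub_distrib]
  simp only [← Finset.sum_sub_distrib]
  have hi (i : Fin 2) : ∑ F ∈ M.edgesI i, ((lineIntegral (hull F ∩ M.side i) fun x =>
        M.meanFlux c u i F * M.jump F (fun T' => M.testFn T g i T' x)
          + M.meanFlux c (M.testFn T g) i F * M.jump F (fun T => u i T x)) -
        (bF c i F θ fun x => M.jump F fun T' => M.testFn T g i T' x)) =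
      ∑ F ∈ M.edgesOf T, M.sgn T F *
        (lineIntegral (hull F ∩ M.side i) (fun x => M.meanFlux c u i F * g x) - bF c i F θ g) := by
    rw [Finset.sum_congr rfl (hterm i), ← Finset.sum_filter, Finset.filter_mem_eq_inter,
      Finset.inter_comm, ← Finset.filter_mem_eq_inter, Finset.sum_filter]
    refine Finset.sum_congr rfl fun F hF => ?_
    split_ifs with h
    · rfl
    · rw [hside F i (mem_edgesOf.1 hF).1 h, mul_zero]
  simp only [hi]
  rw [Finset.sum_comm]
  refine Finset.sum_congr rfl fun F hF => ?_
  rw [← Finset.mul_sum]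
  split_ifs with h
  · rw [Finset.sum_eq_zero fun i _ => hside F i (mem_edgesOf.1 hF).1 (notMem_edgesI_of_fitted h i),
      mul_zero]
  · rw [edgeMoment, if_neg h]

theorem ae_hull (hT : T ∈ M.tris) {S : Set Plane} (hS : M.Ω 0 ∪ M.Ω 1 ⊆ S) :
    (hull T ∩ S : Set Plane) =ᵐ[volume] hull T := by
  rw [ae_eq_set]
  refine ⟨by simp [sdiff_eq_empty.2 inter_subset_left], ?_⟩
  refine measure_mono_null ?_ (volume_hull_diff hT)
  rintro x ⟨hx, hx'⟩
  exact ⟨hx, fun h => hx' ⟨hx, hS h⟩⟩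

/-- The integrability of f is given on the open domain, which contains the closed triangle only up
to a null set. -/
theorem integrableOn_hull (hf : MemLp f 2 (volume.restrict M.domain)) (hT : T ∈ M.tris) :
    IntegrableOn f (hull T) := by
  have hfin : IsFiniteMeasure (volume.restrict (hull T ∩ M.domain)) := by
    refine isFiniteMeasure_restrict.2 ?_
    exact ((measure_mono inter_subset_left).trans_lt (isCompact_hull T).measure_lt_top).ne
  have h1 : IntegrableOn f (hull T ∩ M.domain) :=
    (hf.mono_measure (Measure.restrict_mono inter_subset_right le_rfl)).integrable one_le_two
  exact h1.congr_set_ae (ae_hull hT (by rw [Ω_union]; exact sdiff_subset)).symm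

/-- The same g is used in both subdomains, so the two parts of T add up to T up to a null set. -/
theorem l_testFn (hf : MemLp f 2 (volume.restrict M.domain)) (hT : T ∈ M.tris)
    (g : Plane →ᵃ[ℝ] ℝ) : M.l f (M.testFn T g) = ∫ x in hull T, f x * g x := by
  have hi (i : Fin 2) : ∑ T' ∈ M.trisI i, (∫ x in hull T' ∩ M.Ω i, f x * M.testFn T g i T' x) =
      ∫ x in hull T ∩ M.Ω i, f x * g x :=
    sum_setIntegral_testFn hT g (fun _ x h => f x * h x) (by simp)
  have hint : IntegrableOn (fun x => f x * g x) (hull T) :=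
    (integrableOn_hull hf hT).mul_continuousOn g.continuous_of_finiteDimensional.continuousOn
      (isCompact_hull T)
  rw [l, Fin.sum_univ_two, hi, hi, ← setIntegral_union
    (M.disjoint_Ω.mono inter_subset_right inter_subset_right)
    ((isClosed_hull T).measurableSet.inter (M.isOpen_Ω 1).measurableSet)
    (hint.mono_set inter_subset_left) (hint.mono_set inter_subset_left), ← inter_union_distrib_left]
  exact setIntegral_congr_set (ae_hull hT subset_rfl)

/-! ### Local conservation -/

theorem grad_const (r : ℝ) : grad (AffineMap.const ℝ Plane r) = 0 := by
  ext j; simp [grad]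

/-- The core of local conservation: the Green formula for g σ, with the degrees of freedom inserted,
is compared with the mixed equation tested by g on T alone. -/
theorem setIntegral_divergence_mul (hM : M.Resolved)
    (hf : MemLp f 2 (volume.restrict M.domain)) (hm : m = 0 ∨ m = 1)
    (h : M.SolvesMixed c f u θ) {σ : Finset Plane → Plane → Plane} (hσ : M.IsFlux c m u θ σ)
    (hT : T ∈ M.tris) {p : Plane → ℝ} (hp : p ∈ Poly m) :
    ∫ x in hull T, divergence (σ T) x * p x = -∫ x in hull T, f x * p x := by
  classical
  obtain ⟨g, rfl, hg0⟩ : ∃ g : Plane →ᵃ[ℝ] ℝ, p = g ∧ (m = 0 → grad g = 0) := by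
    rcases hm with rfl | rfl
    · obtain ⟨r, rfl⟩ := mem_Poly_zero.1 hp
      exact ⟨AffineMap.const ℝ Plane r, rfl, fun _ => grad_const r⟩
    · obtain ⟨g, hg⟩ := exists_affine_of_mem_Poly hp
      exact ⟨g, hg, by omega⟩
  have hσT := hσ.1.1 T hT
  have hcd := LocalRT.contDiff hσT
  have hgc : Continuous g := g.continuous_of_finiteDimensional
  have hgd : ContDiff ℝ 1 g := contDiff_of_mem_Poly (affine_mem_Poly g)
  -- For m = 0 no interior condition is imposed, but then g is constant and both sides are zero.
  have hint : ∫ x in hull T, ⟪σ T x, grad g⟫ = M.interiorMoment c u T (grad g) := by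
    rcases hm with hm | hm
    · obtain ⟨ξ, hξ⟩ := exists_interiorMoment M c u T
      rw [hξ, hg0 hm]
      simp
    · exact hσ.2.2 hm T hT (grad g)
  have hgreen := setIntegral_divergence_eq hT (hgd.smul hcd)
  have hsplit : ∫ x in hull T, divergence (fun y => g y • σ T y) x =
      (∫ x in hull T, divergence (σ T) x * g x) + ∫ x in hull T, ⟪σ T x, grad g⟫ := by
    rw [← integral_add]
    · simp_rw [divergence_smul g (hcd.differentiable one_ne_zero _)]
    · exact ((continuous_of_mem_Poly (LocalRT.divergence_mem hm hσT)).mul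
        hgc).continuousOn.integrableOn_compact (isCompact_hull T)
    · exact (hcd.continuous.inner continuous_const).continuousOn.integrableOn_compact
        (isCompact_hull T)
  have hedge : ∑ F ∈ M.edgesOf T, M.sgn T F *
      lineIntegral (hull F) (fun x => ⟪g x • σ T x, M.nF F⟫) =
      ∑ F ∈ M.edgesOf T, M.sgn T F * M.edgeMoment c u θ F g := by
    refine Finset.sum_congr rfl fun F hF => ?_
    obtain ⟨hFe, hFT⟩ := mem_edgesOf.1 hF
    rw [← (edgeDofs_iff h.2.1).1 hσ.2.1 F hFe T (mem_trisAt.2 ⟨hT, hFT⟩) g hp]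
    simp_rw [real_inner_smul_left, mul_comm]
  have hmix := h.2.2.1 _ (testFn_mem T g)
  have hd := d_sub_b_testFn (c := c) hT h.2.1
    (fun i F hF x hx => jump_eq_zero_of_solvesMixed hM h hF hx) g
  rw [a_testFn (θ := θ) hT g, l_testFn hf hT g] at hmix
  -- The edges in Γ come from a_h and all others from d_h - b_h; together they give the full
  -- boundary of T.
  have hsum : ∑ F ∈ M.edgesOf T, M.sgn T F * M.edgeMoment c u θ F g =
      (∑ F ∈ M.edgesOf T, if F ∈ M.fittedEdges then M.sgn T F * M.edgeMoment c u θ F g else 0) +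
      ∑ F ∈ M.edgesOf T, if F ∈ M.fittedEdges then 0 else M.sgn T F * M.edgeMoment c u θ F g := by
    rw [← Finset.sum_add_distrib]
    refine Finset.sum_congr rfl fun F _ => ?_
    split_ifs <;> ring
  have hgreen' : ∫ x in hull T, divergence (fun y => g y • σ T y) x =
      ∑ F ∈ M.edgesOf T, M.sgn T F * M.edgeMoment c u θ F g := by
    rw [← hedge]; exact hgreen
  linarith

theorem isL2Projection_divergence (hM : M.Resolved)
    (hf : MemLp f 2 (volume.restrict M.domain)) (hm : m = 0 ∨ m = 1)
    (h : M.SolvesMixed c f u θ) {σ : Finset Plane → Plane → Plane} (hσ : M.IsFlux c m u θ σ)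
    (hT : T ∈ M.tris) : IsL2Projection m (hull T) f fun x => -divergence (σ T) x := by
  have hσT := hσ.1.1 T hT
  have hdiv := LocalRT.divergence_mem hm hσT
  refine ⟨(Poly m).neg_mem hdiv, fun p hp => ?_⟩
  have hpc := continuous_of_mem_Poly hp
  simp_rw [sub_neg_eq_add, add_mul]
  rw [integral_add, setIntegral_divergence_mul hM hf hm h hσ hT hp, add_neg_cancel]
  · exact (integrableOn_hull hf hT).mul_continuousOn hpc.continuousOn (isCompact_hull T)
  · exact ((continuous_of_mem_Poly hdiv).mul hpc).continuousOn.integrableOn_compact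
      (isCompact_hull T)

end CutMesh

end CutFEM

end

theorem mainTheorem2 (M : CutFEM.CutMesh) (c : CutFEM.Params) (hM : M.Resolved)
    (f : CutFEM.Plane → ℝ) (hf : MemLp f 2 (volume.restrict M.domain))
    (m : ℕ) (hm : m = 0 ∨ m = 1)
    (u θ : CutFEM.Broken) (h : M.SolvesMixed c f u θ) :
    M.SolvesPrimal c f u ∧
    (∃! σ : Finset CutFEM.Plane → CutFEM.Plane → CutFEM.Plane, M.IsFlux c m u θ σ) ∧
    ∀ σ : Finset CutFEM.Plane → CutFEM.Plane → CutFEM.Plane, M.IsFlux c m u θ σ →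
      ∀ T ∈ M.tris, ∃ q : CutFEM.Plane → ℝ, CutFEM.IsL2Projection m (CutFEM.hull T) f q ∧
        ∀ x ∈ CutFEM.hull T, CutFEM.divergence (σ T) x = -q x := by
  refine ⟨CutFEM.CutMesh.solvesPrimal_of_solvesMixed hM h, ?_, fun σ hσ T hT =>
    ⟨_, CutFEM.CutMesh.isL2Projection_divergence hM hf hm h hσ hT, fun x _ => (neg_neg _).symm⟩⟩
  obtain ⟨σ, hσ⟩ := CutFEM.CutMesh.exists_flux (c := c) (u := u) hm h.2.1
  exact ⟨σ, hσ, fun τ hτ => CutFEM.CutMesh.flux_unique hm h.2.1 hτ hσ⟩
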